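/- Let $n\ge 1$ and write points of $\mathbb{R}^{1+n}$ as $x=(x_0,\underline{x})$. Consider one of three problems: (a) the Dirichlet problem for $\Delta u=0$ in the unit ball $D=B_1\subset\mathbb{R}^{1+n}$, with $\sigma$ the normalized surface measure on $\partial D$ and kernel $P(x,y)=\frac{1-|x|^2}{|x-y|^{n+1}}$; (b) the Dirichlet problem for $\Delta u=0$ in $D=\mathbb{R}^{1+n}_+=\{x_0>0\}$, with $\partial D=\mathbb{R}^n$, $\sigma$ Lebesgue measure and $P(x,\underline{y})=\frac{\Gamma(\frac{n+1}{2})}{\pi^{(n+1)/2}}\,\frac{x_0}{(x_0^2+|\underline{x}-\underline{y}|^2)^{(n+1)/2}}$; (c) the Cauchy problem for the heat equation $(\partial_t-\Delta)u=0$ in $D=\mathbb{R}^{1+n}_+$ (time $t=x_0$), with the same boundary and measure and $P(x,\underline{y})=(4\pi x_0)^{-n/2}e^{-|\underline{x}-\underline{y}|^2/(4x_0)}$. For $g\in L^2(\partial D)$ (real-valued) let $u_g(x)=\int_{\partial D}P(x,y)g(y)\,d\sigma(y)$, $x\in D$. Let $H^2$ be: in case (a), the harmonic functions in $D$ with $\|u\|_{H^2}=\sup_{0<r<1}\|u(r\,\cdot)\|_{L^2(\partial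 B_1)}<\infty$; in case (b), the harmonic functions in $D$ with $\|u\|_{H^2}=\sup_{t>0}\|u(t,\cdot)\|_{L^2(\mathbb{R}^n)}<\infty$; in case (c), the functions $u=u_g$, $g\in L^2(\mathbb{R}^n)$, with $\|u\|_{H^2}=\big\|\sup_{t>0,\ |\underline{z}-\cdot|\le\alpha\sqrt t}|u(t,\underline{z})|\big\|_{L^2(\mathbb{R}^n)}<\infty$, for a fixed aperture $\alpha\ge0$ ($\alpha=0$ gives the maximal function $\sup_{t>0}|u(t,\cdot)|$). For a probability space $(\Omega,\mathcal F,\mathbb{P})$, $L^2(\Omega,H^2)$ consists of the $H^2$-valued random variables $u$ with $\|u\|_{L^2(\Omega,H^2)}=(\mathbb{E}\|u(\cdot,\omega)\|_{H^2}^2)^{1/2}<\infty$. For $q\in D$ put $K_q=P(q,\cdot)\in L^2(\partial D)$ and $K(x,q)=\langle P(x,\cdot),P(q,\cdot)\rangle_{L^2(\partial D)}$, $x\in D$. Given $q_1,q_2,\ldots\in D$ and unit vectors $v_1,v_2,\ldots\in\mathbb{R}^{1+n}$, let $l(k)$ be the multiplicity of $q_k$ in $(q_1,\dots,q_k)$.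 The multiple kernels in $L^2(\partial D)$, and the lifted multiple kernels, which are functions on $D$, are $$\tilde K_{q_k}=\big[\partial_{v_k}^{\,l(k)-1}K_q\big]_{q=q_k},\qquad \tilde K^{D}_{q_k}(x)=\big[\partial_{v_k}^{\,l(k)-1}K(x,q)\big]_{q=q_k}\quad(x\in D),$$ where the directional derivatives are taken in $q$. Suppose that the $\tilde K_{q_k}$ in $L^2(\partial D)$ are linearly independent, so that they have a Gram–Schmidt orthonormalization $E_1,E_2,\ldots$. For $q\in D\setminus\{q_1,\dots,q_{k-1}\}$ let $E_k^q$ be the last element of the Gram–Schmidt orthonormalization of $\tilde K_{q_1},\dots,\tilde K_{q_{k-1}},K_q$ (with $E_k^q=0$ if $K_q$ lies in the span of the others). Let $f\in L^2(\Omega,L^2(\partial D))$, and let the $q_k$ be selected by the statistical maximal selection principle (SPOAFD2), that is, for every $k\ge1$, $$\mathbb{E}|\langle f_\omega,E_k\rangle|^2=\sup\{\mathbb{E}|\langle f_\omega,E_k^q\rangle|^2:\ q\in D,\ q\ne q_1,\dots,q_{k-1}\}.$$ Then $f_\omega=\sum_{k=1}^\infty\langle f_\omega,E_k\rangle E_k$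 in $L^2(\Omega,L^2(\partial D))$. The solution $u_{f_\omega}$ and the sums $\sum_{k=1}^N\langle f_\omega,E_k\rangle u_{E_k}$, $N\ge0$, belong to $L^2(\Omega,H^2)$, and $$u_{f_\omega}=\sum_{k=1}^\infty\langle f_\omega,E_k\rangle u_{E_k}=\lim_{N\to\infty}\sum_{k=1}^N c_k^{(N)}(\omega)\,\tilde K^{D}_{q_k}\qquad\text{in }L^2(\Omega,H^2).$$ Here, for every $N$, $(c^{(N)}_1(\omega),\dots,c^{(N)}_N(\omega))=\mathcal{C}_N=\mathcal{F}_N\mathcal{A}_N^{-1}$ with $\mathcal{F}_N=(\langle f_\omega,E_1\rangle,\dots,\langle f_\omega,E_N\rangle)$ and $\mathcal{A}_N=(a_{ij})_{1\le i,j\le N}$, $a_{ij}=\langle\tilde K_{q_i},E_j\rangle$. The matrix $\mathcal{A}_N$ is lower triangular and invertible, $\tilde K_{q_i}=\sum_{j=1}^N a_{ij}E_j$ in $L^2(\partial D)$ for $i\le N$, and $\sum_{k=1}^N\langle f_\omega,E_k\rangle u_{E_k}(x)=\sum_{k=1}^N c^{(N)}_k(\omega)\tilde K^{D}_{q_k}(x)$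 for all $x\in D$, $\omega\in\Omega$ and $N$. -/

import Mathlib

open MeasureTheory Filter Topology
open scoped ENNReal NNReal

noncomputable section

namespace SPOAFD

/-- The ambient Euclidean space `ℝ^{1+n}`; a point is `x = (x₀, x̲)` with `x₀ : ℝ`, `x̲ ∈ ℝ^n`. -/
abbrev Space (n : ℕ) : Type := EuclideanSpace ℝ (Fin (n + 1))

/-- The last `n` coordinates `x̲` of `x = (x₀, x̲)`. -/
def tail {n : ℕ} (x : Space n) : EuclideanSpace ℝ (Fin n) :=
  WithLp.toLp 2 (fun i : Fin n => x i.succ)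

/-- The point `(t, y)` of `ℝ^{1+n}`. -/
def point {n : ℕ} (t : ℝ) (y : EuclideanSpace ℝ (Fin n)) : Space n :=
  WithLp.toLp 2 (Fin.cons t (fun i : Fin n => y i))

/-- The three boundary value problems: the Dirichlet problem for the Laplace equation in the unit
ball and in the upper half-space, and the Cauchy problem for the heat equation. The number `α` is
the aperture of the parabolic cones in the maximal function that defines the norm of the heat
Hardy space; `α = 0` gives the vertical maximal function `sup_{t > 0} |u (t, x)|`. -/
inductive Problem : Type
  | dirichletBall : Problem
  | dirichletHalfSpace : Problem
  | heatCauchy (α : ℝ≥0) : Problem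

/-- The domain `D`: the open unit ball `B₁`, or the upper half-space `ℝ^{1+n}_+`. -/
def domain (n : ℕ) : Problem → Set (Space n)
  | .dirichletBall => Metric.ball 0 1
  | .dirichletHalfSpace => {x | 0 < x 0}
  | .heatCauchy _ => {x | 0 < x 0}

/-- The normalized surface measure of the unit sphere, as a measure on the ambient space. -/
def sphereMeasure (n : ℕ) : Measure (Space n) :=
  Measure.map (Subtype.val : Metric.sphere (0 : Space n) 1 → Space n)
    (((volume : Measure (Space n)).toSphere Set.univ)⁻¹ • (volume : Measure (Space n)).toSphere)

/-- Lebesgue measure of the boundary `{0} × ℝ^n` of the half-space, as a measure on the ambient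
space. -/
def planeMeasure (n : ℕ) : Measure (Space n) :=
  Measure.map (point 0) (volume : Measure (EuclideanSpace ℝ (Fin n)))

/-- The measure carried by the boundary `∂D`. -/
def boundaryMeasure (n : ℕ) : Problem → Measure (Space n)
  | .dirichletBall => sphereMeasure n
  | .dirichletHalfSpace => planeMeasure n
  | .heatCauchy _ => planeMeasure n

/-- The real Hilbert space `L²(∂D)`. -/
abbrev BoundaryL2 (n : ℕ) (p : Problem) : Type := Lp ℝ 2 (boundaryMeasure n p)

/-- The fundamental kernel `P(x, y)`, for `x ∈ D` and `y ∈ ∂D`: the Poisson kernel of the ball,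
the Poisson kernel of the half-space (where `y = (0, y̲)`, so that
`‖x - y‖² = x₀² + |x̲ - y̲|²`), or the heat kernel at time `x₀`. -/
def kernel (n : ℕ) : Problem → Space n → Space n → ℝ
  | .dirichletBall => fun x y => (1 - ‖x‖ ^ 2) / ‖x - y‖ ^ (n + 1)
  | .dirichletHalfSpace => fun x y =>
      Real.Gamma (((n : ℝ) + 1) / 2) / Real.pi ^ (((n : ℝ) + 1) / 2) * x 0 / ‖x - y‖ ^ (n + 1)
  | .heatCauchy _ => fun x y =>
      (1 / (4 * Real.pi * x 0)) ^ ((n : ℝ) / 2) * Real.exp (-‖tail x - tail y‖ ^ 2 / (4 * x 0))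

/-- The solution `u_g(x) = ∫_{∂D} P(x, y) g(y) dσ(y)` with boundary (or initial) value `g`. -/
def solution {n : ℕ} {p : Problem} (g : BoundaryL2 n p) (x : Space n) : ℝ :=
  ∫ y, kernel n p x y * g y ∂(boundaryMeasure n p)

/-- The norm of the Hardy space `H²` of the problem. Harmonic case: the supremum of the `L²`-norms
over the spheres `r ∂B₁`, `0 < r < 1`, or over the planes `{t} × ℝ^n`, `t > 0`. Heat case: the
`L²(ℝ^n)`-norm of the maximal function of `|u|` over the cones
`{(t, z) : t > 0, |z - y| ≤ α √t}`. -/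
def hardyNorm (n : ℕ) : Problem → (Space n → ℝ) → ℝ≥0∞
  | .dirichletBall => fun u =>
      ⨆ r ∈ Set.Ioo (0 : ℝ) 1, eLpNorm (fun s => u (r • s)) 2 (sphereMeasure n)
  | .dirichletHalfSpace => fun u =>
      ⨆ t ∈ Set.Ioi (0 : ℝ), eLpNorm (fun y => u (y + point t 0)) 2 (planeMeasure n)
  | .heatCauchy α => fun u =>
      (∫⁻ y : EuclideanSpace ℝ (Fin n),
        (⨆ (t : ℝ) (_ : 0 < t) (z : EuclideanSpace ℝ (Fin n)) (_ : ‖z - y‖ ≤ α * √t),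
          ‖u (point t z)‖ₑ) ^ 2) ^ (1 / 2 : ℝ)

/-- The equation that the members of `H²` satisfy in `D`: they are harmonic, or are the heat
extension of a function in `L²(ℝ^n)`. -/
def IsSolutionIn (n : ℕ) : Problem → (Space n → ℝ) → Prop
  | .dirichletBall => fun u =>
      InnerProductSpace.HarmonicOnNhd u (domain n .dirichletBall)
  | .dirichletHalfSpace => fun u =>
      InnerProductSpace.HarmonicOnNhd u (domain n .dirichletHalfSpace)
  | .heatCauchy α => fun u =>
      ∃ g : BoundaryL2 n (.heatCauchy α), ∀ x ∈ domain n (.heatCauchy α), u x = solution g x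

/-- Membership in the Hardy space `H²`: `h²(B₁)`, `h²(ℝ^{1+n}_+)` or `H²_heat(ℝ^{1+n}_+)`. -/
def MemHardy (n : ℕ) (p : Problem) (u : Space n → ℝ) : Prop :=
  IsSolutionIn n p u ∧ hardyNorm n p u < ∞

section Stochastic

variable {Ω : Type*} [MeasurableSpace Ω]

/-- The norm `(𝔼 ‖u(·, ω)‖²_{H²})^{1/2}` of the stochastic Hardy space. -/
def stochasticHardyNorm (n : ℕ) (p : Problem) (ℙ : Measure Ω) (u : Ω → Space n → ℝ) : ℝ≥0∞ :=
  (∫⁻ ω, hardyNorm n p (u ω) ^ 2 ∂ℙ) ^ (1 / 2 : ℝ)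

/-- Membership in the stochastic Hardy space `L²(Ω, H²)`. Because `H²` is separable with continuous
point evaluations that separate its points, an `H²`-valued map is a random variable exactly if all
its point evaluations are. -/
structure MemStochasticHardy (n : ℕ) (p : Problem) (ℙ : Measure Ω) (u : Ω → Space n → ℝ) :
    Prop where
  aemeasurable : ∀ x ∈ domain n p, AEMeasurable (fun ω => u ω x) ℙ
  memHardy : ∀ᵐ ω ∂ℙ, MemHardy n p (u ω)
  norm_lt_top : stochasticHardyNorm n p ℙ u < ∞

end Stochastic

open Classical in
/-- The class in `L²(∂D)` of a square integrable function (and `0` for any other function). -/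
def toL2 {n : ℕ} {p : Problem} (g : Space n → ℝ) : BoundaryL2 n p :=
  if h : MemLp g 2 (boundaryMeasure n p) then h.toLp g else 0

/-- The dictionary element `K_q = P(q, ·) ∈ L²(∂D)`, for `q ∈ D`. -/
def boundaryKernel (n : ℕ) (p : Problem) (q : Space n) : BoundaryL2 n p :=
  toL2 (kernel n p q)

/-- The reproducing kernel `K(x, q) = ⟨P_x, P_q⟩_{L²(∂D)}` on `D × D`. -/
def reproducingKernel (n : ℕ) (p : Problem) (x q : Space n) : ℝ :=
  ∫ y, kernel n p x y * kernel n p q y ∂(boundaryMeasure n p)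

open Classical in
/-- The number of earlier occurrences of `q k` in the sequence: `l(k) - 1`, with `l(k)` the
multiplicity of `q k` in `(q 0, …, q k)`. -/
def order {n : ℕ} (q : ℕ → Space n) (k : ℕ) : ℕ :=
  ((Finset.range k).filter (fun j => q j = q k)).card

/-- The `k`-th multiple kernel in `L²(∂D)`: the derivative of order `l(k) - 1` of the function
`K_q` with respect to `q`, in the direction `v k`, at `q = q k`. -/
def multipleKernel {n : ℕ} (p : Problem) (q v : ℕ → Space n) (k : ℕ) : BoundaryL2 n p :=
  toL2 (fun y => iteratedDeriv (order q k) (fun τ : ℝ => kernel n p (q k + τ • v k) y) 0)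

/-- The `k`-th lifted multiple kernel, a function on `D`: the same derivative of the reproducing
kernel `K(x, q)` of `H²`. -/
def liftedMultipleKernel {n : ℕ} (p : Problem) (q v : ℕ → Space n) (k : ℕ) (x : Space n) : ℝ :=
  iteratedDeriv (order q k) (fun τ : ℝ => reproducingKernel n p x (q k + τ • v k)) 0

/-- The system `E_k`: consecutive Gram-Schmidt orthonormalization of the multiple kernels. -/
def orthoSystem {n : ℕ} (p : Problem) (q v : ℕ → Space n) (k : ℕ) : BoundaryL2 n p :=
  InnerProductSpace.gramSchmidtNormed ℝ (multipleKernel p q v) k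

/-- The `k`-th candidate `E_k^b`: the last element of the Gram-Schmidt orthonormalization of the
first `k` multiple kernels followed by the kernel `K_b`. -/
def candidate {n : ℕ} (p : Problem) (q v : ℕ → Space n) (k : ℕ) (b : Space n) :
    BoundaryL2 n p :=
  let r := boundaryKernel n p b - ∑ j ∈ Finset.range k,
    inner ℝ (boundaryKernel n p b) (orthoSystem p q v j) • orthoSystem p q v j
  (‖r‖)⁻¹ • r

/-- The sequence `q` (with directions `v` of differentiation at repeated points) is obtained by
applying the statistical maximal selection principle to `f`: every `q k` lies in `D`, the multiple
kernels admit a Gram-Schmidt orthonormalization, and, for every `k`, the element `E_k` realizes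
the supremum of `𝔼 |⟨f_ω, E_k^b⟩|²` over all `b ∈ D` that are distinct from the points selected
before. -/
structure IsMaximalSelection {Ω : Type*} [MeasurableSpace Ω] {n : ℕ} (p : Problem)
    (ℙ : Measure Ω) (f : Ω → BoundaryL2 n p) (q v : ℕ → Space n) : Prop where
  mem_domain : ∀ k, q k ∈ domain n p
  norm_direction : ∀ k, ‖v k‖ = 1
  linearIndependent : LinearIndependent ℝ (multipleKernel p q v)
  isLUB : ∀ k, IsLUB
    ((fun b => ∫ ω, (inner ℝ (f ω) (candidate p q v k b)) ^ 2 ∂ℙ) ''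
      {b | b ∈ domain n p ∧ ∀ j < k, b ≠ q j})
    (∫ ω, (inner ℝ (f ω) (orthoSystem p q v k)) ^ 2 ∂ℙ)

/-- The matrix `A_N` with entries `a_{ij} = ⟨K̃_{q_i}, E_j⟩`. -/
def kernelMatrix {n : ℕ} (p : Problem) (q v : ℕ → Space n) (N : ℕ) :
    Matrix (Fin N) (Fin N) ℝ :=
  Matrix.of fun i j => inner ℝ (multipleKernel p q v i) (orthoSystem p q v j)

/-- The row vector `F_N = (⟨g, E_0⟩, …, ⟨g, E_{N-1}⟩)`. -/
def fourierCoeffs {n : ℕ} (p : Problem) (q v : ℕ → Space n) (N : ℕ) (g : BoundaryL2 n p) :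
    Fin N → ℝ :=
  fun k => inner ℝ g (orthoSystem p q v k)

/-- The row vector `C_N = F_N A_N⁻¹` of the coefficients of the lifted multiple kernels. -/
def kernelCoeffs {n : ℕ} (p : Problem) (q v : ℕ → Space n) (N : ℕ) (g : BoundaryL2 n p) :
    Fin N → ℝ :=
  Matrix.vecMul (fourierCoeffs p q v N g) (kernelMatrix p q v N)⁻¹

end SPOAFD

end

open SPOAFD

/-!
The first assertion is abstract Hilbert space theory. Let `R_N f` be the remainder of the expansion
of `f` with respect to the orthonormal system `E`. By dominated convergence `R_N f` tends in
`L²(Ω, L²(∂D))` to some `g`, and since the kernels `K_b`, `b ∈ D`, are total, it suffices that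
`𝔼 ⟨R_N f, K_b⟩²` tends to `0` for every `b` (`tendsto_eLpNorm_remainder`). If `b` is one of the
selected points, `K_b` is the multiple kernel at its first occurrence, hence lies in the span of
finitely many `E_k`, and `⟨R_N f, K_b⟩` vanishes from then on. Otherwise `b` competes in every step
of the selection, so that `𝔼 ⟨R_k f, K_b⟩² ≤ ‖K_b‖² 𝔼 ⟨f, E_k⟩²`
(`integral_inner_remainder_sq_le`), and the right-hand side tends to `0` by Bessel's inequality.

The passage from the boundary into the domain needs that `g ↦ u_g` is bounded from `L²(∂D)` to `H²`
(`exists_hardyNorm_solution_le`). For the two Poisson kernels this is the Schur test; in the ball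
the kernels have integral `1`, because the Poisson integral of the constant `1` is radial and harmonic,
hence constant by the maximum principle. For the heat equation the Gaussian is a superposition of
indicators of balls, which dominates the maximal function over parabolic cones by the
Hardy-Littlewood maximal function, and the latter is bounded in `L²` by Vitali's covering lemma and
the layer cake formula. Membership of `u_g` in the Hardy space also requires that Poisson integrals
are harmonic.

Totality of the kernels (`eq_zero_of_solution_eq_zero`) holds because they are approximate
identities: if `u_g` vanishes, then `g` annihilates every smooth function with compact support.

Finally, a lifted multiple kernel is the solution whose boundary value is the multiple kernel
(`IsMaximalSelection.liftedMultipleKernel_eq`), as the derivatives in the pole may be taken under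
the integral sign. For the Poisson kernels, the map from the pole to the kernel, divided by its value at
a fixed pole, is smooth with values in the Banach algebra of bounded continuous functions on the
boundary; for the heat kernel one uses a holomorphic extension in the parameter of differentiation
that is dominated by a Gaussian (`iteratedDeriv_integral_of_differentiableOn`). The coefficients in
terms of the multiple kernels then come from inverting the triangular matrix of the Gram-Schmidt
process.
-/


noncomputable section

namespace SPOAFD

/-! ### Orthogonal expansions of Hilbert space valued random variables -/

section Hilbert

variable {H : Type*} [NormedAddCommGroup H] [InnerProductSpace ℝ H]

/-- The remainder `x - ∑_{k < N} ⟨x, E_k⟩ E_k` of the orthogonal expansion of `x`. -/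
def remainder (E : ℕ → H) (N : ℕ) (x : H) : H :=
  x - ∑ k ∈ Finset.range N, inner ℝ x (E k) • E k

lemma continuous_remainder (E : ℕ → H) (N : ℕ) : Continuous (remainder E N) := by
  unfold remainder
  fun_prop

lemma inner_remainder_self_right {E : ℕ → H} (hE : Orthonormal ℝ E) {j N : ℕ} (hj : j < N) (x : H) :
    inner ℝ (remainder E N x) (E j) = 0 := by
  rw [remainder, inner_sub_left, sum_inner, Finset.sum_eq_single_of_mem j (by simpa using hj)]
  · simp [inner_smul_left, hE.1 j]
  · intro k _ hk
    simp [inner_smul_left, hE.2 hk]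

/-- The remainder operators are symmetric. -/
lemma inner_remainder_comm (E : ℕ → H) (N : ℕ) (x y : H) :
    inner ℝ (remainder E N x) y = inner ℝ x (remainder E N y) := by
  simp only [remainder, inner_sub_left, inner_sub_right, sum_inner, inner_sum, inner_smul_left,
    inner_smul_right]
  congr 1
  refine Finset.sum_congr rfl fun k _ => ?_
  simp only [conj_trivial]
  rw [real_inner_comm (E k) y]
  ring

lemma norm_remainder_le {E : ℕ → H} (hE : Orthonormal ℝ E) (N : ℕ) (x : H) :
    ‖remainder E N x‖ ≤ ‖x‖ := by
  have h0 : inner ℝ (remainder E N x) (∑ k ∈ Finset.range N, inner ℝ x (E k) • E k) = 0 := by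
    rw [inner_sum]
    refine Finset.sum_eq_zero fun k hk => ?_
    rw [inner_smul_right, inner_remainder_self_right hE (Finset.mem_range.1 hk), mul_zero]
  have h1 := norm_add_sq_real (remainder E N x) (∑ k ∈ Finset.range N, inner ℝ x (E k) • E k)
  rw [h0, remainder, sub_add_cancel] at h1
  refine le_of_sq_le_sq ?_ (norm_nonneg _)
  rw [h1, remainder]
  nlinarith [sq_nonneg ‖∑ k ∈ Finset.range N, inner ℝ x (E k) • E k‖]

lemma tendsto_remainder [CompleteSpace H] {E : ℕ → H} (hE : Orthonormal ℝ E) (x : H) :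
    Tendsto (fun N => remainder E N x) atTop (𝓝 (x - ∑' k, inner ℝ x (E k) • E k)) := by
  have hs : Summable fun k => inner ℝ x (E k) • E k := by
    have := (hE.orthogonalFamily).summable_iff_norm_sq_summable (fun k => inner ℝ x (E k))
    simp only [LinearIsometry.toSpanSingleton_apply] at this
    rw [this]
    simpa only [real_inner_comm] using hE.inner_products_summable x
  exact tendsto_const_nhds.sub hs.hasSum.tendsto_sum_nat

variable {Ω : Type*} [MeasurableSpace Ω] {ℙ : Measure Ω}

/-- A random vector whose inner product with every element of a total set vanishes almost surely
vanishes almost surely; the exceptional null sets may depend on the element. -/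
lemma ae_eq_zero_of_forall_mem_inner [CompleteSpace H] {D : Set H}
    (hD : (Submodule.span ℝ D)ᗮ = ⊥) {g : Ω → H} (hg : AEStronglyMeasurable g ℙ)
    (h : ∀ d ∈ D, ∀ᵐ ω ∂ℙ, inner ℝ (g ω) d = 0) : g =ᵐ[ℙ] 0 := by
  have hall : ∀ d : H, ∀ᵐ ω ∂ℙ, inner ℝ (g ω) d = 0 := by
    have hspan : ∀ d ∈ Submodule.span ℝ D, ∀ᵐ ω ∂ℙ, inner ℝ (g ω) d = 0 := by
      intro d hd
      induction hd using Submodule.span_induction with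
      | mem d hd => exact h d hd
      | zero => simp
      | add x y _ _ hx hy =>
        filter_upwards [hx, hy] with ω h1 h2
        rw [inner_add_right, h1, h2, add_zero]
      | smul a x _ hx =>
        filter_upwards [hx] with ω h1
        rw [inner_smul_right, h1, mul_zero]
    intro d
    have hdense : Dense (Submodule.span ℝ D : Set H) := by
      rw [Submodule.dense_iff_topologicalClosure_eq_top, Submodule.topologicalClosure_eq_top_iff]
      exact hD
    obtain ⟨u, hu, hlim⟩ := mem_closure_iff_seq_limit.1 (hdense d)
    have : ∀ᵐ ω ∂ℙ, ∀ m, inner ℝ (g ω) (u m) = 0 := ae_all_iff.2 fun m => hspan _ (hu m)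
    filter_upwards [this] with ω hω
    have h1 : Tendsto (fun m => inner ℝ (g ω) (u m)) atTop (𝓝 (inner ℝ (g ω) d)) :=
      tendsto_const_nhds.inner hlim
    simp only [hω] at h1
    exact tendsto_nhds_unique h1 tendsto_const_nhds
  obtain ⟨t, ht, h't⟩ := hg.isSeparable_ae_range
  refine ae_eq_zero_of_forall_dual_of_isSeparable ℝ ht (fun c => ?_) h't
  filter_upwards [hall ((InnerProductSpace.toDual ℝ H).symm c)] with ω hω
  rw [real_inner_comm] at hω
  simpa using hω

/-- If the remainders of a square integrable random vector tend to zero against every element of a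
total set, then they tend to zero in `L²`. -/
lemma tendsto_eLpNorm_remainder [CompleteSpace H] {E : ℕ → H} (hE : Orthonormal ℝ E)
    {D : Set H} (hD : (Submodule.span ℝ D)ᗮ = ⊥) {f : Ω → H} (hf : MemLp f 2 ℙ)
    (h : ∀ d ∈ D, Tendsto (fun N => ∫ ω, inner ℝ (remainder E N (f ω)) d ^ 2 ∂ℙ) atTop (𝓝 0)) :
    Tendsto (fun N => eLpNorm (fun ω => remainder E N (f ω)) 2 ℙ) atTop (𝓝 0) := by
  set g : Ω → H := fun ω => f ω - ∑' k, inner ℝ (f ω) (E k) • E k with hgdef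
  have hlim : ∀ ω, Tendsto (fun N => remainder E N (f ω)) atTop (𝓝 (g ω)) :=
    fun ω => tendsto_remainder hE (f ω)
  have hmeas : ∀ N, AEStronglyMeasurable (fun ω => remainder E N (f ω)) ℙ := fun N =>
    (continuous_remainder E N).comp_aestronglyMeasurable hf.1
  have hgmeas : AEStronglyMeasurable g ℙ :=
    aestronglyMeasurable_of_tendsto_ae atTop hmeas (Eventually.of_forall hlim)
  have hsq : Integrable (fun ω => ‖f ω‖ ^ 2) ℙ := (memLp_two_iff_integrable_sq_norm hf.1).1 hf
  have hg0 : g =ᵐ[ℙ] 0 := by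
    refine ae_eq_zero_of_forall_mem_inner hD hgmeas fun d hd => ?_
    have h1 : Tendsto (fun N => ∫ ω, inner ℝ (remainder E N (f ω)) d ^ 2 ∂ℙ) atTop
        (𝓝 (∫ ω, inner ℝ (g ω) d ^ 2 ∂ℙ)) := by
      refine tendsto_integral_of_dominated_convergence (fun ω => ‖f ω‖ ^ 2 * ‖d‖ ^ 2) (fun N => ?_)
        (hsq.mul_const _) (fun N => Eventually.of_forall fun ω => ?_)
        (Eventually.of_forall fun ω => ((hlim ω).inner tendsto_const_nhds).pow 2)
      · exact ((hmeas N).inner aestronglyMeasurable_const).pow 2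
      · rw [Real.norm_eq_abs, abs_pow, ← mul_pow]
        gcongr
        exact (abs_real_inner_le_norm _ _).trans (by gcongr; exact norm_remainder_le hE N _)
    have h2 : ∫ ω, inner ℝ (g ω) d ^ 2 ∂ℙ = 0 := tendsto_nhds_unique h1 (h d hd)
    have hgint : Integrable (fun ω => inner ℝ (g ω) d ^ 2) ℙ := by
      refine (hsq.mul_const (‖d‖ ^ 2)).mono ((hgmeas.inner aestronglyMeasurable_const).pow 2)
        (Eventually.of_forall fun ω => ?_)
      have hle : ‖g ω‖ ≤ ‖f ω‖ :=
        le_of_tendsto (hlim ω).norm (Eventually.of_forall fun N => norm_remainder_le hE N _)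
      rw [Real.norm_eq_abs, abs_pow, Real.norm_of_nonneg (by positivity), ← mul_pow]
      gcongr
      exact (abs_real_inner_le_norm _ _).trans (by gcongr)
    have h3 := (integral_eq_zero_iff_of_nonneg (fun ω => sq_nonneg _) hgint).1 h2
    filter_upwards [h3] with ω hω
    simpa using hω
  have hfin : ∫⁻ ω, ‖f ω‖ₑ ^ 2 ∂ℙ ≠ ∞ := by
    have := hf.2
    rw [eLpNorm_lt_top_iff_lintegral_rpow_enorm_lt_top (by norm_num) (by norm_num)] at this
    simpa using this.ne
  have key : Tendsto (fun N => ∫⁻ ω, ‖remainder E N (f ω)‖ₑ ^ 2 ∂ℙ) atTop (𝓝 0) := by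
    have := tendsto_lintegral_of_dominated_convergence' (μ := ℙ)
      (F := fun N ω => ‖remainder E N (f ω)‖ₑ ^ 2) (f := fun _ => 0) (fun ω => ‖f ω‖ₑ ^ 2)
      (fun N => (hmeas N).enorm.pow_const 2)
      (fun N => Eventually.of_forall fun ω => ?_) hfin ?_
    · simpa using this
    · have hle : ‖remainder E N (f ω)‖ₑ ≤ ‖f ω‖ₑ :=
        enorm_le_iff_norm_le.2 (norm_remainder_le hE N _)
      show ‖remainder E N (f ω)‖ₑ ^ 2 ≤ ‖f ω‖ₑ ^ 2
      gcongr
    · filter_upwards [hg0] with ω hω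
      have h4 := hlim ω
      rw [hω] at h4
      have h5 := ((ENNReal.continuous_pow 2).tendsto _).comp h4.enorm
      simpa [Function.comp_def] using h5
  have h6 := ((ENNReal.continuous_rpow_const (y := (1 / 2 : ℝ))).tendsto 0).comp key
  simp only [one_div, inv_pos, Nat.ofNat_pos, ENNReal.zero_rpow_of_pos] at h6
  refine h6.congr fun N => ?_
  simp [eLpNorm_eq_lintegral_rpow_enorm_toReal (μ := ℙ) (p := 2) (by norm_num) (by norm_num)]

lemma tendsto_integral_inner_orthonormal_sq {E : ℕ → H} (hE : Orthonormal ℝ E)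
    {f : Ω → H} (hf : MemLp f 2 ℙ) :
    Tendsto (fun k => ∫ ω, inner ℝ (f ω) (E k) ^ 2 ∂ℙ) atTop (𝓝 0) := by
  have hsq : Integrable (fun ω => ‖f ω‖ ^ 2) ℙ := (memLp_two_iff_integrable_sq_norm hf.1).1 hf
  have := tendsto_integral_of_dominated_convergence (μ := ℙ)
    (F := fun k ω => inner ℝ (f ω) (E k) ^ 2) (f := fun _ => (0 : ℝ)) (fun ω => ‖f ω‖ ^ 2)
    (fun k => (hf.1.inner aestronglyMeasurable_const).pow 2) hsq
    (fun k => Eventually.of_forall fun ω => ?_) (Eventually.of_forall fun ω => ?_)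
  · simpa using this
  · rw [Real.norm_eq_abs, abs_pow]
    gcongr
    simpa [hE.1 k] using abs_real_inner_le_norm (f ω) (E k)
  · have := (hE.inner_products_summable (f ω)).tendsto_atTop_zero
    refine this.congr fun k => ?_
    rw [Real.norm_eq_abs, sq_abs, real_inner_comm]

/-- The estimate behind the maximal selection principle: the energy of the `k`-th remainder in the
direction of a dictionary element `d` is at most `‖d‖²` times the energy of the data in the
direction of the normalized `k`-th remainder of `d`. If that
remainder vanishes, both sides are `0`. -/
lemma integral_inner_remainder_sq_le {E : ℕ → H} (hE : Orthonormal ℝ E) (f : Ω → H)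
    (k : ℕ) (d : H) :
    ∫ ω, inner ℝ (remainder E k (f ω)) d ^ 2 ∂ℙ ≤
      ‖d‖ ^ 2 * ∫ ω, inner ℝ (f ω) ((‖remainder E k d‖)⁻¹ • remainder E k d) ^ 2 ∂ℙ := by
  have h : ∀ ω, inner ℝ (remainder E k (f ω)) d ^ 2 = ‖remainder E k d‖ ^ 2 *
      inner ℝ (f ω) ((‖remainder E k d‖)⁻¹ • remainder E k d) ^ 2 := by
    intro ω
    rw [inner_remainder_comm, inner_smul_right, ← mul_pow]
    by_cases h0 : remainder E k d = 0
    · simp [h0]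
    · rw [mul_inv_cancel_left₀ (norm_ne_zero_iff.2 h0)]
  simp only [h, integral_const_mul]
  refine mul_le_mul_of_nonneg_right ?_ (integral_nonneg fun ω => by positivity)
  have := norm_remainder_le hE k d
  gcongr

end Hilbert

/-! ### The Hardy-Littlewood maximal function -/

section Maximal

variable {V : Type*} [NormedAddCommGroup V] [NormedSpace ℝ V] [FiniteDimensional ℝ V]
  [MeasurableSpace V] [BorelSpace V] (μ : Measure V)

/-- The centered Hardy-Littlewood maximal function of `g`, over closed balls. Only rational radii
are used, so that its measurability is immediate; this changes it by at most a constant factor. -/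
def maximalFunction (g : V → ℝ≥0∞) (x : V) : ℝ≥0∞ :=
  ⨆ r : {r : ℚ // 0 < r}, (∫⁻ y in Metric.closedBall x (r : ℚ), g y ∂μ) /
    μ (Metric.closedBall x (r : ℚ))

variable {μ} [μ.IsAddHaarMeasure]

lemma measurable_setLIntegral_closedBall {X : Type*} [PseudoMetricSpace X] [MeasurableSpace X]
    [OpensMeasurableSpace X] [SecondCountableTopology X] {μ : Measure X} [SFinite μ]
    {g : X → ℝ≥0∞} (hg : Measurable g) (r : ℝ) :
    Measurable fun x => ∫⁻ y in Metric.closedBall x r, g y ∂μ := by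
  have h : ∀ x, ∫⁻ y in Metric.closedBall x r, g y ∂μ =
      ∫⁻ y, {z : X × X | dist z.2 z.1 ≤ r}.indicator (fun z => g z.2) (x, y) ∂μ := by
    intro x
    rw [← lintegral_indicator Metric.isClosed_closedBall.measurableSet]
    rfl
  simp only [h]
  refine Measurable.lintegral_prod_right' ((hg.comp measurable_snd).indicator ?_)
  exact (isClosed_le (by fun_prop) (by fun_prop)).measurableSet

lemma measurable_maximalFunction {g : V → ℝ≥0∞} (hg : Measurable g) :
    Measurable (maximalFunction μ g) := by
  have := FiniteDimensional.proper_real V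
  have : SecondCountableTopology V := inferInstance
  refine Measurable.iSup fun r => ?_
  simp only [Measure.addHaar_closedBall_center μ _ (_ : ℝ)]
  exact (measurable_setLIntegral_closedBall hg _).div_const _

/-- The ball averages over arbitrary radii, normalized by the volume of the ball, are controlled by
the maximal function: enlarge the radius to a rational one of at most twice the size. -/
lemma setLIntegral_closedBall_le (g : V → ℝ≥0∞) (x : V) {ρ : ℝ} (hρ : 0 < ρ) :
    ∫⁻ y in Metric.closedBall x ρ, g y ∂μ ≤
      ENNReal.ofReal ((2 * ρ) ^ Module.finrank ℝ V) * μ (Metric.ball 0 1) *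
        maximalFunction μ g x := by
  obtain ⟨r, hr1, hr2⟩ := exists_rat_btwn (show ρ < 2 * ρ by linarith)
  have hr0 : (0 : ℝ) < r := hρ.trans hr1
  have hvol : μ (Metric.closedBall x (r : ℝ)) =
      ENNReal.ofReal ((r : ℝ) ^ Module.finrank ℝ V) * μ (Metric.ball 0 1) :=
    Measure.addHaar_closedBall μ x hr0.le
  have hpos : μ (Metric.closedBall x (r : ℝ)) ≠ 0 := (Metric.measure_closedBall_pos μ x hr0).ne'
  have hfin : μ (Metric.closedBall x (r : ℝ)) ≠ ∞ := measure_closedBall_lt_top.ne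
  calc ∫⁻ y in Metric.closedBall x ρ, g y ∂μ
      ≤ ∫⁻ y in Metric.closedBall x (r : ℝ), g y ∂μ :=
        lintegral_mono_set (Metric.closedBall_subset_closedBall hr1.le)
    _ = μ (Metric.closedBall x (r : ℝ)) * ((∫⁻ y in Metric.closedBall x (r : ℝ), g y ∂μ) /
          μ (Metric.closedBall x (r : ℝ))) := (ENNReal.mul_div_cancel hpos hfin).symm
    _ ≤ μ (Metric.closedBall x (r : ℝ)) * maximalFunction μ g x := by
        gcongr
        exact le_iSup (fun r : {r : ℚ // 0 < r} => (∫⁻ y in Metric.closedBall x (r : ℚ), g y ∂μ) /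
          μ (Metric.closedBall x (r : ℚ))) ⟨r, by exact_mod_cast hr0⟩
    _ ≤ _ := by
        rw [hvol]
        gcongr

/-- The weak type `(1, 1)` estimate, by the Vitali covering lemma. -/
lemma mul_measure_lt_maximalFunction_le (g : V → ℝ≥0∞) (l : ℝ≥0∞) :
    l * μ {x | l < maximalFunction μ g x} ≤ 5 ^ Module.finrank ℝ V * ∫⁻ y, g y ∂μ := by
  have := FiniteDimensional.proper_real V
  have : SecondCountableTopology V := inferInstance
  -- Vitali's lemma needs bounded radii: exhaust the level set accordingly
  set S : ℕ → Set V := fun R => {x | ∃ r : ℝ, 0 < r ∧ r ≤ R ∧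
    l * μ (Metric.closedBall x r) ≤ ∫⁻ y in Metric.closedBall x r, g y ∂μ} with hS
  have hmono : Monotone S := fun R R' h x ⟨r, h0, h1, h2⟩ =>
    ⟨r, h0, h1.trans (by exact_mod_cast h), h2⟩
  have hsub : {x | l < maximalFunction μ g x} ⊆ ⋃ R, S R := by
    intro x hx
    obtain ⟨r, hr⟩ := lt_iSup_iff.1 (show l < ⨆ r, _ from hx)
    obtain ⟨R, hR⟩ := exists_nat_ge ((r : ℚ) : ℝ)
    have hr0 : (0 : ℝ) < (r : ℚ) := by exact_mod_cast r.2
    refine Set.mem_iUnion.2 ⟨R, (r : ℚ), hr0, hR, ?_⟩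
    exact (ENNReal.le_div_iff_mul_le (Or.inl (Metric.measure_closedBall_pos μ x hr0).ne')
      (Or.inl measure_closedBall_lt_top.ne)).1 hr.le
  have hbound : ∀ R, l * μ (S R) ≤ 5 ^ Module.finrank ℝ V * ∫⁻ y, g y ∂μ := by
    intro R
    choose! r hr0 hrR hr using fun x (hx : x ∈ S R) => hx
    obtain ⟨u, huS, hdisj, hcov⟩ := Vitali.exists_disjoint_subfamily_covering_enlargement_closedBall
      (S R) id r R hrR 5 (by norm_num)
    have hucount : u.Countable := by
      refine hdisj.countable_of_nonempty_interior fun x hx => ?_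
      exact (Metric.nonempty_ball.2 (hr0 x (huS hx))).mono Metric.ball_subset_interior_closedBall
    have hvol : ∀ x ∈ u, μ (Metric.closedBall x (5 * r x)) =
        5 ^ Module.finrank ℝ V * μ (Metric.closedBall x (r x)) := by
      intro x hx
      rw [Measure.addHaar_closedBall_mul μ x (by norm_num) (hr0 x (huS hx)).le,
        Measure.addHaar_closedBall_center μ x]
      congr 1
      rw [ENNReal.ofReal_pow (by norm_num)]
      norm_num
    calc l * μ (S R) ≤ l * μ (⋃ x ∈ u, Metric.closedBall x (5 * r x)) := by
          gcongr
          intro x hx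
          obtain ⟨b, hb, hsub⟩ := hcov x hx
          exact Set.mem_iUnion₂.2 ⟨b, hb, hsub (Metric.mem_closedBall_self (hr0 x hx).le)⟩
      _ ≤ l * ∑' x : u, μ (Metric.closedBall (x : V) (5 * r x)) := by
          gcongr
          exact measure_biUnion_le μ hucount _
      _ = ∑' x : u, 5 ^ Module.finrank ℝ V * (l * μ (Metric.closedBall (x : V) (r x))) := by
          rw [← ENNReal.tsum_mul_left]
          refine tsum_congr fun x => ?_
          rw [hvol x x.2]
          ring
      _ ≤ ∑' x : u, 5 ^ Module.finrank ℝ V * ∫⁻ y in Metric.closedBall (x : V) (r x), g y ∂μ := by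
          refine ENNReal.tsum_le_tsum fun x => ?_
          gcongr
          exact hr x (huS x.2)
      _ = 5 ^ Module.finrank ℝ V * ∫⁻ y in ⋃ x ∈ u, Metric.closedBall x (r x), g y ∂μ := by
          rw [ENNReal.tsum_mul_left,
            lintegral_biUnion (s := fun x => Metric.closedBall x (r x)) hucount
            (fun x _ => Metric.isClosed_closedBall.measurableSet) hdisj]
      _ ≤ _ := by
          gcongr
          exact Measure.restrict_le_self
  calc l * μ {x | l < maximalFunction μ g x} ≤ l * μ (⋃ R, S R) := by gcongr
    _ = ⨆ R, l * μ (S R) := by rw [hmono.measure_iUnion, ENNReal.mul_iSup]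
    _ ≤ _ := iSup_le hbound

/-- Truncation of the data at height `l` turns the weak type estimate into one that involves only
the large values of the data. -/
lemma mul_measure_two_mul_lt_maximalFunction_le {g : V → ℝ≥0∞} (hg : Measurable g)
    (l : ℝ≥0∞) :
    l * μ {x | 2 * l < maximalFunction μ g x} ≤
      5 ^ Module.finrank ℝ V * ∫⁻ y in {y | l < g y}, g y ∂μ := by
  have hms : MeasurableSet {y | l < g y} := measurableSet_lt measurable_const hg
  rw [← lintegral_indicator hms]
  refine le_trans ?_ (mul_measure_lt_maximalFunction_le _ l)
  gcongr l * μ ?_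
  intro x hx
  obtain ⟨r, hr⟩ := lt_iSup_iff.1 (show 2 * l < ⨆ r, _ from hx)
  refine show l < ⨆ r, _ from lt_iSup_iff.2 ⟨r, ?_⟩
  have hr0 : (0 : ℝ) < (r : ℚ) := by exact_mod_cast r.2
  have hpos := (Metric.measure_closedBall_pos μ x hr0).ne'
  have hfin : μ (Metric.closedBall x (r : ℚ)) ≠ ∞ := measure_closedBall_lt_top.ne
  have hle : ∫⁻ y in Metric.closedBall x (r : ℚ), g y ∂μ ≤
      (∫⁻ y in Metric.closedBall x (r : ℚ), {y | l < g y}.indicator g y ∂μ) +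
        l * μ (Metric.closedBall x (r : ℚ)) := by
    rw [← setLIntegral_const, ← lintegral_add_right _ measurable_const]
    refine lintegral_mono fun y => ?_
    by_cases hy : l < g y
    · simp [Set.indicator, hy]
    · simpa [Set.indicator, hy] using not_lt.1 hy
  have h2 := ENNReal.div_le_div_right hle (μ (Metric.closedBall x (r : ℚ)))
  rw [ENNReal.add_div, ENNReal.mul_div_cancel_right hpos hfin] at h2
  have h3 := hr.trans_le h2
  rw [two_mul] at h3
  exact lt_of_add_lt_add_right h3

lemma lintegral_Ioi_indicator_lt (a : ℝ≥0∞) :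
    ∫⁻ t in Set.Ioi (0 : ℝ), {t : ℝ | ENNReal.ofReal t < a}.indicator 1 t = a := by
  have hms : MeasurableSet {t : ℝ | ENNReal.ofReal t < a} :=
    measurableSet_lt ENNReal.measurable_ofReal measurable_const
  rw [lintegral_indicator_one hms, Measure.restrict_apply hms]
  induction a with
  | top => simp
  | coe a =>
    have : {t : ℝ | ENNReal.ofReal t < (a : ℝ≥0∞)} ∩ Set.Ioi 0 = Set.Ioo 0 (a : ℝ) := by
      ext t
      simp only [Set.mem_inter_iff, Set.mem_ofPred_eq, Set.mem_Ioi, Set.mem_Ioo]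
      constructor
      · rintro ⟨h1, h2⟩
        refine ⟨h2, ?_⟩
        rwa [← ENNReal.ofReal_coe_nnreal, ENNReal.ofReal_lt_ofReal_iff_of_nonneg h2.le] at h1
      · rintro ⟨h1, h2⟩
        refine ⟨?_, h1⟩
        rwa [← ENNReal.ofReal_coe_nnreal, ENNReal.ofReal_lt_ofReal_iff_of_nonneg h1.le]
    rw [this, Real.volume_Ioo, sub_zero, ENNReal.ofReal_coe_nnreal]

lemma sq_le_lintegral_Ioi_indicator (a : ℝ≥0∞) :
    a ^ 2 ≤ 8 * ∫⁻ t in Set.Ioi (0 : ℝ),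
      {t : ℝ | 2 * ENNReal.ofReal t < a}.indicator (fun t => ENNReal.ofReal t) t := by
  have hms : MeasurableSet {t : ℝ | 2 * ENNReal.ofReal t < a} :=
    measurableSet_lt (ENNReal.measurable_ofReal.const_mul 2) measurable_const
  rw [lintegral_indicator hms, Measure.restrict_restrict hms]
  induction a with
  | top =>
    have h : (∞ : ℝ≥0∞) ≤ ∫⁻ t in {t : ℝ | 2 * ENNReal.ofReal t < ∞} ∩ Set.Ioi 0,
        ENNReal.ofReal t := by
      calc (∞ : ℝ≥0∞) = ∫⁻ t in Set.Ioi (1 : ℝ), 1 := by simp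
        _ ≤ ∫⁻ t in Set.Ioi (1 : ℝ), ENNReal.ofReal t := by
          refine setLIntegral_mono ENNReal.measurable_ofReal fun t ht => ?_
          exact ENNReal.one_le_ofReal.2 (le_of_lt ht)
        _ ≤ _ := by
          refine lintegral_mono_set fun t ht => ⟨?_, ?_⟩
          · exact (ENNReal.mul_lt_top (by simp) ENNReal.ofReal_lt_top : 2 * ENNReal.ofReal t < ∞)
          · exact zero_lt_one.trans (show (1 : ℝ) < t from ht)
    rw [top_le_iff.1 h]
    simp
  | coe a =>
    have hset : {t : ℝ | 2 * ENNReal.ofReal t < (a : ℝ≥0∞)} ∩ Set.Ioi 0 =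
        Set.Ioo 0 ((a : ℝ) / 2) := by
      ext t
      simp only [Set.mem_inter_iff, Set.mem_ofPred_eq, Set.mem_Ioi, Set.mem_Ioo]
      have h2 : (2 : ℝ≥0∞) = ENNReal.ofReal 2 := by simp
      rw [h2, ← ENNReal.ofReal_mul (by norm_num), ← ENNReal.ofReal_coe_nnreal, and_comm]
      refine and_congr_right fun h0 => ?_
      rw [ENNReal.ofReal_lt_ofReal_iff_of_nonneg (by positivity), lt_div_iff₀ (by norm_num),
        mul_comm]
    rw [hset, ← ofReal_integral_eq_lintegral_ofReal, ← integral_Ioc_eq_integral_Ioo,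
      ← intervalIntegral.integral_of_le (by positivity), integral_id]
    · have h8 : (8 : ℝ≥0∞) = ENNReal.ofReal 8 := by simp
      rw [h8, ← ENNReal.ofReal_mul (by norm_num), ← ENNReal.ofReal_coe_nnreal,
        ← ENNReal.ofReal_pow (NNReal.coe_nonneg a)]
      exact ENNReal.ofReal_le_ofReal (by ring_nf; rfl)
    · exact (continuous_id.integrableOn_Icc).mono_set Set.Ioo_subset_Icc_self
    · filter_upwards [ae_restrict_mem measurableSet_Ioo] with t ht using ht.1.le

/-- The maximal theorem in `L²`. -/
theorem lintegral_maximalFunction_sq_le {g : V → ℝ≥0∞} (hg : Measurable g) :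
    ∫⁻ x, maximalFunction μ g x ^ 2 ∂μ ≤
      8 * 5 ^ Module.finrank ℝ V * ∫⁻ y, g y ^ 2 ∂μ := by
  have := FiniteDimensional.proper_real V
  have hM := measurable_maximalFunction (μ := μ) hg
  have hswap1 : Measurable fun z : V × ℝ => {z : V × ℝ | 2 * ENNReal.ofReal z.2 <
      maximalFunction μ g z.1}.indicator (fun z => ENNReal.ofReal z.2) z :=
    Measurable.indicator (by fun_prop) (measurableSet_lt (by fun_prop) (by fun_prop))
  have hswap2 : Measurable fun z : V × ℝ => g z.1 * {z : V × ℝ | ENNReal.ofReal z.2 <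
      g z.1}.indicator 1 z :=
    (hg.comp measurable_fst).mul (Measurable.indicator measurable_one
      (measurableSet_lt (by fun_prop) (by fun_prop)))
  calc ∫⁻ x, maximalFunction μ g x ^ 2 ∂μ
      ≤ ∫⁻ x, (8 * ∫⁻ t in Set.Ioi (0 : ℝ), {t : ℝ | 2 * ENNReal.ofReal t <
          maximalFunction μ g x}.indicator (fun t => ENNReal.ofReal t) t) ∂μ :=
        lintegral_mono fun x => sq_le_lintegral_Ioi_indicator _
    _ = 8 * ∫⁻ t in Set.Ioi (0 : ℝ), (∫⁻ x, {t : ℝ | 2 * ENNReal.ofReal t <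
          maximalFunction μ g x}.indicator (fun t => ENNReal.ofReal t) t ∂μ) := by
        rw [lintegral_const_mul' _ _ (by simp)]
        congr 1
        exact lintegral_lintegral_swap (f := fun x t => {t : ℝ | 2 * ENNReal.ofReal t <
          maximalFunction μ g x}.indicator (fun t => ENNReal.ofReal t) t) hswap1.aemeasurable
    _ = 8 * ∫⁻ t in Set.Ioi (0 : ℝ), ENNReal.ofReal t *
          μ {x | 2 * ENNReal.ofReal t < maximalFunction μ g x} := by
        congr 1
        refine lintegral_congr fun t => ?_
        have hms : MeasurableSet {x | 2 * ENNReal.ofReal t < maximalFunction μ g x} :=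
          measurableSet_lt measurable_const hM
        rw [← setLIntegral_const, ← lintegral_indicator hms]
        rfl
    _ ≤ 8 * ∫⁻ t in Set.Ioi (0 : ℝ), 5 ^ Module.finrank ℝ V *
          ∫⁻ y in {y | ENNReal.ofReal t < g y}, g y ∂μ := by
        gcongr 8 * ?_
        refine lintegral_mono fun t => ?_
        exact mul_measure_two_mul_lt_maximalFunction_le hg _
    _ = 8 * 5 ^ Module.finrank ℝ V * ∫⁻ t in Set.Ioi (0 : ℝ),
          ∫⁻ y, g y * {t : ℝ | ENNReal.ofReal t < g y}.indicator 1 t ∂μ := by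
        rw [lintegral_const_mul' _ _ (by finiteness), mul_assoc]
        congr 2
        refine lintegral_congr fun t => ?_
        have hms : MeasurableSet {y | ENNReal.ofReal t < g y} :=
          measurableSet_lt measurable_const hg
        rw [← lintegral_indicator hms]
        refine lintegral_congr fun y => ?_
        by_cases hy : ENNReal.ofReal t < g y <;> simp [Set.indicator, hy]
    _ = 8 * 5 ^ Module.finrank ℝ V * ∫⁻ y, (∫⁻ t in Set.Ioi (0 : ℝ),
          g y * {t : ℝ | ENNReal.ofReal t < g y}.indicator 1 t) ∂μ := by
        congr 1
        exact (lintegral_lintegral_swap (f := fun y t => g y *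
          {t : ℝ | ENNReal.ofReal t < g y}.indicator 1 t) hswap2.aemeasurable).symm
    _ = 8 * 5 ^ Module.finrank ℝ V * ∫⁻ y, g y ^ 2 ∂μ := by
        congr 1
        refine lintegral_congr fun y => ?_
        rw [lintegral_const_mul _ (measurable_one.indicator
          (measurableSet_lt ENNReal.measurable_ofReal measurable_const)),
          lintegral_Ioi_indicator_lt, sq]

end Maximal

/-! ### The half-space and its boundary -/

section HalfSpace

variable {n : ℕ}

@[simp] lemma point_apply_zero (t : ℝ) (y : EuclideanSpace ℝ (Fin n)) : point t y 0 = t := rfl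

@[simp] lemma tail_point (t : ℝ) (y : EuclideanSpace ℝ (Fin n)) : tail (point t y) = y := rfl

@[simp] lemma tail_apply (x : Space n) (i : Fin n) : tail x i = x i.succ := rfl

lemma point_tail (x : Space n) : point (x 0) (tail x) = x := by
  ext i
  refine Fin.cases rfl (fun i => rfl) i

lemma tail_add (x y : Space n) : tail (x + y) = tail x + tail y := rfl

lemma tail_smul (c : ℝ) (x : Space n) : tail (c • x) = c • tail x := rfl

lemma point_add (s t : ℝ) (y z : EuclideanSpace ℝ (Fin n)) :
    point s y + point t z = point (s + t) (y + z) := by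
  ext i
  refine Fin.cases rfl (fun i => rfl) i

lemma point_sub (s t : ℝ) (y z : EuclideanSpace ℝ (Fin n)) :
    point s y - point t z = point (s - t) (y - z) := by
  ext i
  refine Fin.cases rfl (fun i => rfl) i

lemma norm_sq_eq_tail (x : Space n) : ‖x‖ ^ 2 = x 0 ^ 2 + ‖tail x‖ ^ 2 := by
  simp [EuclideanSpace.norm_sq_eq, Fin.sum_univ_succ]

lemma norm_point_sq (t : ℝ) (y : EuclideanSpace ℝ (Fin n)) :
    ‖point t y‖ ^ 2 = t ^ 2 + ‖y‖ ^ 2 := by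
  simp [norm_sq_eq_tail]

lemma continuous_point (t : ℝ) : Continuous (point t : EuclideanSpace ℝ (Fin n) → Space n) := by
  refine (PiLp.continuous_toLp 2 _).comp (continuous_pi fun i => ?_)
  refine Fin.cases ?_ (fun i => ?_) i
  · exact continuous_const
  · simp only [Fin.cons_succ]
    fun_prop

lemma measurableEmbedding_point (t : ℝ) :
    MeasurableEmbedding (point t : EuclideanSpace ℝ (Fin n) → Space n) :=
  (continuous_point t).measurableEmbedding fun y z h => by simpa using congrArg tail h

lemma integral_planeMeasure (F : Space n → ℝ) :
    ∫ y, F y ∂(planeMeasure n) = ∫ y : EuclideanSpace ℝ (Fin n), F (point 0 y) :=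
  (measurableEmbedding_point 0).integral_map F

lemma lintegral_planeMeasure (F : Space n → ℝ≥0∞) :
    ∫⁻ y, F y ∂(planeMeasure n) = ∫⁻ y : EuclideanSpace ℝ (Fin n), F (point 0 y) :=
  (measurableEmbedding_point 0).lintegral_map F

lemma enorm_boundaryL2 {p : Problem} (g : BoundaryL2 n p) :
    ‖g‖ₑ = (∫⁻ y, ‖g y‖ₑ ^ 2 ∂(boundaryMeasure n p)) ^ (1 / 2 : ℝ) := by
  rw [Lp.enorm_def, eLpNorm_eq_lintegral_rpow_enorm_toReal (by norm_num) (by norm_num)]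
  simp

lemma enorm_boundaryL2_sq {p : Problem} (g : BoundaryL2 n p) :
    ‖g‖ₑ ^ 2 = ∫⁻ y, ‖g y‖ₑ ^ 2 ∂(boundaryMeasure n p) := by
  rw [enorm_boundaryL2, ← ENNReal.rpow_natCast, ← ENNReal.rpow_mul]
  norm_num

end HalfSpace

/-! ### The maximal function of the heat extension -/

section HeatMaximal

variable {n : ℕ}

lemma ofReal_exp_neg_eq_lintegral {a : ℝ} (ha : 0 ≤ a) : ENNReal.ofReal (Real.exp (-a)) =
    ∫⁻ s in Set.Ioi (0 : ℝ), (Set.Ioi a).indicator (fun s => ENNReal.ofReal (Real.exp (-s))) s := by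
  rw [lintegral_indicator measurableSet_Ioi, Measure.restrict_restrict measurableSet_Ioi,
    Set.Ioi_inter_Ioi, sup_of_le_left ha, ← integral_exp_neg_Ioi,
    ofReal_integral_eq_lintegral_ofReal (integrableOn_exp_neg_Ioi a)]
  exact Eventually.of_forall fun s => (Real.exp_pos _).le

/-- The Gaussian moment that bounds the heat extension by the maximal function. -/
def heatMaximalConst (n : ℕ) (α : ℝ≥0) : ℝ≥0∞ :=
  ENNReal.ofReal ((1 / (4 * Real.pi)) ^ ((n : ℝ) / 2)) *
    volume (Metric.ball (0 : EuclideanSpace ℝ (Fin n)) 1) *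
      ∫⁻ s in Set.Ioi (0 : ℝ), ENNReal.ofReal (Real.exp (-s) * (2 * (2 * √s + α)) ^ n)

lemma heatMaximalConst_lt_top (n : ℕ) (α : ℝ≥0) : heatMaximalConst n α < ∞ := by
  refine ENNReal.mul_lt_top (ENNReal.mul_lt_top ENNReal.ofReal_lt_top measure_ball_lt_top) ?_
  -- `x ^ n` is bounded by a multiple of `exp (x / 8)`
  set c : ℝ := 8 ^ n * n.factorial * Real.exp ((4 + 2 * α) / 8)
  have hle : ∀ s ∈ Set.Ioi (0 : ℝ), ENNReal.ofReal (Real.exp (-s) * (2 * (2 * √s + α)) ^ n) ≤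
      ENNReal.ofReal (c * Real.exp (-(1 / 2) * s)) := by
    intro s hs
    have hs0 : (0 : ℝ) < s := hs
    refine ENNReal.ofReal_le_ofReal ?_
    have hsq : √s ≤ 1 + s := by
      rw [Real.sqrt_le_left (by linarith)]
      nlinarith
    have hX : 2 * (2 * √s + α) ≤ 4 + 4 * s + 2 * α := by linarith
    have h0 : 0 ≤ 4 + 4 * s + 2 * (α : ℝ) := by positivity
    have h1 := Real.pow_div_factorial_le_exp ((4 + 4 * s + 2 * α) / 8) (by positivity) n
    rw [div_pow, div_div, div_le_iff₀ (by positivity)] at h1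
    calc Real.exp (-s) * (2 * (2 * √s + α)) ^ n
        ≤ Real.exp (-s) * (4 + 4 * s + 2 * α) ^ n := by gcongr
      _ ≤ Real.exp (-s) * (Real.exp ((4 + 4 * s + 2 * α) / 8) * (8 ^ n * n.factorial)) := by gcongr
      _ = 8 ^ n * n.factorial * (Real.exp (-s) * Real.exp ((4 + 4 * s + 2 * α) / 8)) := by ring
      _ = c * Real.exp (-(1 / 2) * s) := by
        simp only [c]
        rw [mul_assoc _ (Real.exp _) (Real.exp _), ← Real.exp_add, ← Real.exp_add]
        ring_nf
  refine (setLIntegral_mono' measurableSet_Ioi hle).trans_lt ?_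
  exact ((integrableOn_exp_mul_Ioi (by norm_num) 0).const_mul c).lintegral_lt_top

/-- On the parabolic cone with vertex `y` the heat extension of `G` is at most a constant times the
Hardy-Littlewood maximal function at `y`: a Gaussian is a superposition of indicators of balls. -/
lemma lintegral_heat_le_maximalFunction {α : ℝ≥0} {G : EuclideanSpace ℝ (Fin n) → ℝ≥0∞}
    (hG : Measurable G) {t : ℝ} (ht : 0 < t) {y z : EuclideanSpace ℝ (Fin n)}
    (hz : ‖z - y‖ ≤ α * √t) :
    ∫⁻ w, ENNReal.ofReal ((1 / (4 * Real.pi * t)) ^ ((n : ℝ) / 2) *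
        Real.exp (-‖z - w‖ ^ 2 / (4 * t))) * G w ≤
      heatMaximalConst n α * maximalFunction volume G y := by
  have hmeas : Measurable fun x : EuclideanSpace ℝ (Fin n) × ℝ =>
      {x : EuclideanSpace ℝ (Fin n) × ℝ | ‖z - x.1‖ ^ 2 / (4 * t) < x.2}.indicator
        (fun x => ENNReal.ofReal (Real.exp (-x.2))) x * G x.1 :=
    (Measurable.indicator (by fun_prop) (measurableSet_lt (by fun_prop) (by fun_prop))).mul
      (hG.comp measurable_fst)
  have hball : ∀ s ∈ Set.Ioi (0 : ℝ), {w | ‖z - w‖ ^ 2 / (4 * t) < s} ⊆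
      Metric.closedBall y (√t * (2 * √s + α)) := by
    intro s hs w hw
    have hs0 : (0 : ℝ) < s := hs
    have h1 : ‖z - w‖ ^ 2 < (2 * √t * √s) ^ 2 := by
      rw [mul_pow, mul_pow, Real.sq_sqrt ht.le, Real.sq_sqrt hs0.le]
      have : ‖z - w‖ ^ 2 / (4 * t) < s := hw
      rw [div_lt_iff₀ (by positivity)] at this
      linarith
    have h2 : ‖z - w‖ < 2 * √t * √s := lt_of_pow_lt_pow_left₀ 2 (by positivity) h1
    rw [mem_closedBall_iff_norm]
    calc ‖w - y‖ ≤ ‖z - w‖ + ‖z - y‖ := by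
          rw [← norm_neg (z - w), neg_sub]
          simpa using norm_add_le (w - z) (z - y)
      _ ≤ √t * (2 * √s + α) := by linarith
  set A : ℝ := (1 / (4 * Real.pi * t)) ^ ((n : ℝ) / 2) with hA
  have hA0 : 0 ≤ A := by positivity
  have hAt : A * √t ^ n = (1 / (4 * Real.pi)) ^ ((n : ℝ) / 2) := by
    have : √t ^ n = t ^ ((n : ℝ) / 2) := by
      rw [Real.sqrt_eq_rpow, ← Real.rpow_natCast, ← Real.rpow_mul ht.le]
      ring_nf
    rw [hA, this, ← Real.mul_rpow (by positivity) ht.le]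
    congr 1
    field_simp
  calc ∫⁻ w, ENNReal.ofReal (A * Real.exp (-‖z - w‖ ^ 2 / (4 * t))) * G w
      = ENNReal.ofReal A * ∫⁻ w, ∫⁻ s in Set.Ioi (0 : ℝ), (Set.Ioi (‖z - w‖ ^ 2 / (4 * t))).indicator
          (fun s => ENNReal.ofReal (Real.exp (-s))) s * G w := by
        rw [← lintegral_const_mul' _ _ ENNReal.ofReal_ne_top]
        refine lintegral_congr fun w => ?_
        rw [ENNReal.ofReal_mul hA0, neg_div, ofReal_exp_neg_eq_lintegral (by positivity), mul_assoc,
          lintegral_mul_const _ (Measurable.indicator (by fun_prop) measurableSet_Ioi)]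
    _ = ENNReal.ofReal A * ∫⁻ s in Set.Ioi (0 : ℝ), ∫⁻ w, (Set.Ioi (‖z - w‖ ^ 2 / (4 * t))).indicator
          (fun s => ENNReal.ofReal (Real.exp (-s))) s * G w := by
        congr 1
        exact lintegral_lintegral_swap (f := fun w s => (Set.Ioi (‖z - w‖ ^ 2 / (4 * t))).indicator
          (fun s => ENNReal.ofReal (Real.exp (-s))) s * G w) hmeas.aemeasurable
    _ ≤ ENNReal.ofReal A * ∫⁻ s in Set.Ioi (0 : ℝ), ENNReal.ofReal √t ^ n *
          (volume (Metric.ball (0 : EuclideanSpace ℝ (Fin n)) 1) * (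
          ENNReal.ofReal (Real.exp (-s) * (2 * (2 * √s + α)) ^ n) * maximalFunction volume G y)) := by
        gcongr ENNReal.ofReal A * ?_
        refine setLIntegral_mono' measurableSet_Ioi fun s hs => ?_
        have hs0 : 0 < √s := Real.sqrt_pos.2 hs
        have ht0 : 0 < √t := Real.sqrt_pos.2 ht
        have hms : MeasurableSet {w | ‖z - w‖ ^ 2 / (4 * t) < s} :=
          measurableSet_lt (by fun_prop) measurable_const
        calc ∫⁻ w, (Set.Ioi (‖z - w‖ ^ 2 / (4 * t))).indicator
              (fun s => ENNReal.ofReal (Real.exp (-s))) s * G w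
            = ENNReal.ofReal (Real.exp (-s)) * ∫⁻ w in {w | ‖z - w‖ ^ 2 / (4 * t) < s}, G w := by
              rw [← lintegral_const_mul' _ _ ENNReal.ofReal_ne_top, ← lintegral_indicator hms]
              refine lintegral_congr fun w => ?_
              by_cases hw : ‖z - w‖ ^ 2 / (4 * t) < s <;> simp [Set.indicator, hw]
          _ ≤ ENNReal.ofReal (Real.exp (-s)) *
                ∫⁻ w in Metric.closedBall y (√t * (2 * √s + α)), G w := by
              gcongr
              exact hball s hs
          _ ≤ ENNReal.ofReal (Real.exp (-s)) * (ENNReal.ofReal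
                ((2 * (√t * (2 * √s + α))) ^ Module.finrank ℝ (EuclideanSpace ℝ (Fin n))) *
                volume (Metric.ball (0 : EuclideanSpace ℝ (Fin n)) 1) *
                maximalFunction volume G y) := by
              gcongr
              exact setLIntegral_closedBall_le G y (by positivity)
          _ = _ := by
              rw [finrank_euclideanSpace_fin,
                show (2 * (√t * (2 * √s + α))) = √t * (2 * (2 * √s + α)) by ring, mul_pow,
                ENNReal.ofReal_mul (by positivity), ENNReal.ofReal_mul (Real.exp_pos _).le,
                ENNReal.ofReal_pow ht0.le]
              ring
    _ = heatMaximalConst n α * maximalFunction volume G y := by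
        have hms : Measurable fun s : ℝ =>
          ENNReal.ofReal (Real.exp (-s) * (2 * (2 * √s + α)) ^ n) := by fun_prop
        rw [lintegral_const_mul' _ _ (by finiteness),
          lintegral_const_mul' _ _ measure_ball_lt_top.ne,
          lintegral_mul_const _ hms, heatMaximalConst, ← hAt, ENNReal.ofReal_mul hA0,
          ENNReal.ofReal_pow (Real.sqrt_nonneg t)]
        ring

lemma kernel_heatCauchy_point (α : ℝ≥0) (t : ℝ) (z w : EuclideanSpace ℝ (Fin n)) :
    kernel n (.heatCauchy α) (point t z) (point 0 w) =
      (1 / (4 * Real.pi * t)) ^ ((n : ℝ) / 2) * Real.exp (-‖z - w‖ ^ 2 / (4 * t)) := rfl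

lemma exists_hardyNorm_solution_le_heatCauchy (n : ℕ) (α : ℝ≥0) :
    ∃ C : ℝ≥0, ∀ g : BoundaryL2 n (.heatCauchy α),
      hardyNorm n (.heatCauchy α) (solution g) ≤ C * ‖g‖ₑ := by
  set K : ℝ≥0∞ := (heatMaximalConst n α ^ 2 * (8 * 5 ^ n)) ^ (1 / 2 : ℝ) with hK
  have hKtop : K ≠ ∞ := by
    have := (heatMaximalConst_lt_top n α).ne
    exact ENNReal.rpow_ne_top_of_nonneg (by norm_num) (by finiteness)
  refine ⟨K.toNNReal, fun g => ?_⟩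
  rw [ENNReal.coe_toNNReal hKtop]
  set G : EuclideanSpace ℝ (Fin n) → ℝ≥0∞ := fun w => ‖g (point 0 w)‖ₑ with hGdef
  have hG : Measurable G :=
    ((Lp.stronglyMeasurable g).measurable.comp (continuous_point 0).measurable).enorm
  have hu : ∀ t : ℝ, 0 < t → ∀ y z : EuclideanSpace ℝ (Fin n), ‖z - y‖ ≤ α * √t →
      ‖solution g (point t z)‖ₑ ≤ heatMaximalConst n α * maximalFunction volume G y := by
    intro t ht y z hz
    refine le_trans ?_ (lintegral_heat_le_maximalFunction hG ht hz)
    rw [solution]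
    refine (enorm_integral_le_lintegral_enorm _).trans ?_
    change ∫⁻ y, _ ∂(planeMeasure n) ≤ _
    rw [lintegral_planeMeasure]
    refine lintegral_mono fun w => ?_
    rw [kernel_heatCauchy_point, enorm_mul, Real.enorm_of_nonneg (by positivity)]
  calc hardyNorm n (.heatCauchy α) (solution g)
      ≤ (∫⁻ y : EuclideanSpace ℝ (Fin n),
          (heatMaximalConst n α * maximalFunction volume G y) ^ 2) ^ (1 / 2 : ℝ) := by
        refine ENNReal.rpow_le_rpow (lintegral_mono fun y => ?_) (by norm_num)
        refine pow_le_pow_left₀ zero_le ?_ 2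
        exact iSup_le fun t => iSup_le fun ht => iSup_le fun z => iSup_le fun hz => hu t ht y z hz
    _ ≤ ((heatMaximalConst n α ^ 2 * (8 * 5 ^ n)) * ‖g‖ₑ ^ 2) ^ (1 / 2 : ℝ) := by
        refine ENNReal.rpow_le_rpow ?_ (by norm_num)
        simp only [mul_pow]
        have hfin := (heatMaximalConst_lt_top n α).ne
        rw [lintegral_const_mul' _ _ (by finiteness), mul_assoc]
        gcongr
        have := lintegral_maximalFunction_sq_le
          (μ := (volume : Measure (EuclideanSpace ℝ (Fin n)))) hG
        rw [finrank_euclideanSpace_fin] at this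
        rw [enorm_boundaryL2_sq]
        change _ ≤ _ * ∫⁻ y, _ ∂(planeMeasure n)
        rwa [lintegral_planeMeasure]
    _ = K * ‖g‖ₑ := by
        rw [ENNReal.mul_rpow_of_nonneg _ _ (by norm_num), hK]
        congr 1
        rw [← ENNReal.rpow_natCast, ← ENNReal.rpow_mul]
        norm_num

end HeatMaximal

/-! ### Differentiation under the integral sign for holomorphic families -/

section Holomorphic

lemma hasFPowerSeriesOnBall_of_hasSum {f : ℝ → ℝ} {a : ℕ → ℝ} {ρ : ℝ} (hρ : 0 < ρ)
    (h : ∀ τ : ℝ, |τ| < ρ → HasSum (fun m => τ ^ m * a m) (f τ)) :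
    HasFPowerSeriesOnBall f (FormalMultilinearSeries.ofScalars ℝ a) 0 (ENNReal.ofReal ρ) := by
  refine ⟨?_, ENNReal.ofReal_pos.2 hρ, ?_⟩
  · refine ENNReal.le_of_forall_nnreal_lt fun r hr => ?_
    have hr' : |(r : ℝ)| < ρ := by
      rw [abs_of_nonneg (NNReal.coe_nonneg r)]
      exact (ENNReal.ofReal_lt_ofReal_iff hρ).1 (by simpa using hr)
    refine FormalMultilinearSeries.le_radius_of_tendsto _ (l := 0) ?_
    have := (h r hr').summable.tendsto_atTop_zero.norm
    rw [norm_zero] at this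
    refine this.congr fun m => ?_
    rw [FormalMultilinearSeries.ofScalars_norm, norm_mul, norm_pow, mul_comm]
    simp
  · intro y hy
    have hy' : |y| < ρ := by
      rw [Metric.mem_eball, edist_zero_right, ← ofReal_norm,
        ENNReal.ofReal_lt_ofReal_iff hρ] at hy
      exact hy
    rw [zero_add]
    have e : (fun m => FormalMultilinearSeries.ofScalars ℝ a m fun _ => y) =
        fun m => y ^ m * a m := by
      funext m
      rw [FormalMultilinearSeries.ofScalars_apply_eq, smul_eq_mul, mul_comm]
    rw [e]
    exact h y hy'

lemma iteratedDeriv_zero_of_hasSum {f : ℝ → ℝ} {a : ℕ → ℝ} {ρ : ℝ} (hρ : 0 < ρ)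
    (h : ∀ τ : ℝ, |τ| < ρ → HasSum (fun m => τ ^ m * a m) (f τ)) (m : ℕ) :
    iteratedDeriv m f 0 = m.factorial * a m := by
  have := (hasFPowerSeriesOnBall_of_hasSum hρ h).factorial_smul (1 : ℝ) m
  rw [← iteratedDeriv_eq_iteratedFDeriv] at this
  rw [← this]
  simp [FormalMultilinearSeries.ofScalars]

/-- The coefficients of a power series, recursively, as limits of difference quotients. -/
lemma tendsto_coeff_of_hasSum {f : ℝ → ℝ} {a : ℕ → ℝ} {ρ : ℝ} (hρ : 0 < ρ)
    (h : ∀ τ : ℝ, |τ| < ρ → HasSum (fun m => τ ^ m * a m) (f τ)) (m : ℕ) :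
    Tendsto (fun τ => (f τ - ∑ i ∈ Finset.range m, τ ^ i * a i) / τ ^ m) (𝓝[≠] 0) (𝓝 (a m)) := by
  have h1 := (hasFPowerSeriesOnBall_of_hasSum hρ h).hasFPowerSeriesAt.isBigO_sub_partialSum_pow
    (m + 1)
  have h2 : (fun τ : ℝ => f τ - ∑ i ∈ Finset.range (m + 1), τ ^ i * a i)
      =o[𝓝[≠] 0] fun τ => τ ^ m := by
    refine Asymptotics.IsBigO.trans_isLittleO (g := fun τ : ℝ => τ ^ (m + 1)) ?_ ?_
    · refine (Asymptotics.IsBigO.of_norm_right ?_).mono nhdsWithin_le_nhds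
      have e : ∀ τ, (FormalMultilinearSeries.ofScalars ℝ a).partialSum (m + 1) τ =
          ∑ i ∈ Finset.range (m + 1), τ ^ i * a i := fun τ => by
        simp only [FormalMultilinearSeries.partialSum, FormalMultilinearSeries.ofScalars_apply_eq,
          smul_eq_mul, mul_comm]
      simpa only [e, zero_add, norm_pow] using h1
    · exact (Asymptotics.isLittleO_pow_pow (Nat.lt_succ_self m)).mono nhdsWithin_le_nhds
  have h3 := h2.tendsto_div_nhds_zero.add_const (a m)
  rw [zero_add] at h3
  refine h3.congr' ?_
  filter_upwards [self_mem_nhdsWithin] with τ hτ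
  have : τ ^ m ≠ 0 := pow_ne_zero _ hτ
  rw [Finset.sum_range_succ]
  field_simp
  ring

/-- Let `k` be a family of functions on an interval that extend holomorphically to a disc, with
values there dominated by `B`, and let `h * B` be integrable. Then all derivatives of `∫ h k` at the
center are obtained by differentiation under the integral sign. By Cauchy's estimates the power
series of the family may be integrated term by term. -/
lemma iteratedDeriv_integral_of_differentiableOn {Y : Type*} [MeasurableSpace Y] {ν : Measure Y}
    {k : ℝ → Y → ℝ} {kc : ℂ → Y → ℂ} {B h : Y → ℝ} {r : ℝ} (hr : 0 < r)
    (hdiff : ∀ y, DifferentiableOn ℂ (fun z => kc z y) (Metric.ball 0 r))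
    (hbound : ∀ y, ∀ z ∈ Metric.ball (0 : ℂ) r, ‖kc z y‖ ≤ B y)
    (hreal : ∀ y, ∀ τ : ℝ, |τ| < r → kc τ y = k τ y)
    (hmeas : ∀ τ : ℝ, |τ| < r → AEStronglyMeasurable (k τ) ν)
    (hh : AEStronglyMeasurable h ν) (hint : Integrable (fun y => h y * B y) ν) (m : ℕ) :
    iteratedDeriv m (fun τ : ℝ => ∫ y, h y * k τ y ∂ν) 0 =
      ∫ y, h y * iteratedDeriv m (fun τ : ℝ => k τ y) 0 ∂ν := by
  set ρ : ℝ := r / 2 with hρdef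
  have hρ : 0 < ρ := by positivity
  have hρr : ρ < r := by linarith
  set a : ℕ → Y → ℝ := fun m y => (m.factorial : ℝ)⁻¹ * (iteratedDeriv m (fun z => kc z y) 0).re
    with ha
  have hsum : ∀ y, ∀ τ : ℝ, |τ| < r → HasSum (fun m => τ ^ m * a m y) (k τ y) := by
    intro y τ hτ
    have h1 := Complex.hasSum_taylorSeries_on_ball (hdiff y) (z := (τ : ℂ)) (by simpa using hτ)
    rw [hreal y τ hτ] at h1
    have h2 := Complex.hasSum_re h1
    simp only [Complex.ofReal_re] at h2
    convert h2 using 2 with m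
    rw [sub_zero, smul_eq_mul, smul_eq_mul, ← Complex.ofReal_pow]
    rw [show ((m.factorial : ℂ)⁻¹) = ((m.factorial : ℝ)⁻¹ : ℝ) by push_cast; rfl,
      Complex.re_ofReal_mul, Complex.re_ofReal_mul, ha]
    ring
  have hcoeff : ∀ y m, iteratedDeriv m (fun τ : ℝ => k τ y) 0 = m.factorial * a m y :=
    fun y m => iteratedDeriv_zero_of_hasSum hr (hsum y) m
  have hbd : ∀ y m, |a m y| ≤ B y / ρ ^ m := by
    intro y m
    have hd : DiffContOnCl ℂ (fun z => kc z y) (Metric.ball 0 ρ) := by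
      refine DifferentiableOn.diffContOnCl ((hdiff y).mono ?_)
      rw [closure_ball _ hρ.ne']
      exact Metric.closedBall_subset_ball hρr
    have h1 := Complex.norm_iteratedDeriv_le_of_forall_mem_sphere_norm_le m hρ hd (C := B y)
      fun z hz => hbound y z (Metric.sphere_subset_closedBall.trans
        (Metric.closedBall_subset_ball hρr) hz)
    have hm : (0 : ℝ) < m.factorial := by positivity
    rw [ha, abs_mul, abs_of_pos (inv_pos.2 hm), inv_mul_le_iff₀ hm, ← mul_div_assoc]
    exact (Complex.abs_re_le_norm _).trans h1
  -- each coefficient is a pointwise limit of measurable functions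
  have hameas : ∀ m, AEStronglyMeasurable (a m) ν := by
    intro m
    induction m using Nat.strong_induction_on with
    | _ m ih =>
    set t : ℕ → ℝ := fun j => ρ / (j + 1) with ht
    have ht0 : ∀ j, 0 < t j := fun j => by positivity
    have htr : ∀ j, |t j| < r := fun j => by
      rw [abs_of_pos (ht0 j)]
      exact (div_le_self hρ.le (by linarith [(Nat.cast_nonneg j : (0 : ℝ) ≤ j)])).trans_lt hρr
    have htlim : Tendsto t atTop (𝓝 0) := by
      simpa [ht, div_eq_mul_inv] using
        (tendsto_one_div_add_atTop_nhds_zero_nat (𝕜 := ℝ)).const_mul ρ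
    refine aestronglyMeasurable_of_tendsto_ae atTop
      (f := fun j y => (k (t j) y - ∑ i ∈ Finset.range m, t j ^ i * a i y) / t j ^ m) (fun j => ?_)
      (Eventually.of_forall fun y => ?_)
    · have h1 : AEStronglyMeasurable (fun y => ∑ i ∈ Finset.range m, t j ^ i * a i y) ν :=
        Finset.aestronglyMeasurable_fun_sum _ fun i hi =>
          (ih i (Finset.mem_range.1 hi)).const_mul _
      simpa only [div_eq_mul_inv, Pi.sub_apply] using
        ((hmeas _ (htr j)).sub h1).mul_const (t j ^ m)⁻¹
    · exact (tendsto_coeff_of_hasSum hr (hsum y) m).comp (tendsto_nhdsWithin_iff.2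
        ⟨htlim, Eventually.of_forall fun j => (ht0 j).ne'⟩)
  have hF : ∀ τ : ℝ, |τ| < ρ →
      HasSum (fun m => τ ^ m * ∫ y, h y * a m y ∂ν) (∫ y, h y * k τ y ∂ν) := by
    intro τ hτ
    have hq : |τ| / ρ < 1 := (div_lt_one hρ).2 hτ
    have h0 : 0 ≤ |τ| / ρ := by positivity
    have := hasSum_integral_of_dominated_convergence (μ := ν)
      (F := fun m y => h y * (τ ^ m * a m y)) (f := fun y => h y * k τ y)
      (fun m y => (|τ| / ρ) ^ m * |h y * B y|) (fun m => hh.mul ((hameas m).const_mul _))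
      (fun m => Eventually.of_forall fun y => ?_)
      (Eventually.of_forall fun y => (summable_geometric_of_lt_one h0 hq).mul_right _) ?_
      (Eventually.of_forall fun y => (hsum y τ (hτ.trans hρr)).mul_left _)
    · have e : (fun m => τ ^ m * ∫ y, h y * a m y ∂ν) =
          fun m => ∫ y, h y * (τ ^ m * a m y) ∂ν := by
        funext m
        rw [← integral_const_mul]
        congr 1
        ext y
        ring
      rw [e]
      exact this
    · have hB : 0 ≤ B y := (norm_nonneg _).trans (hbound y 0 (Metric.mem_ball_self hr))
      rw [Real.norm_eq_abs, abs_mul, abs_mul (τ ^ m), abs_pow, abs_mul (h y) (B y),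
        abs_of_nonneg hB, div_pow]
      calc |h y| * (|τ| ^ m * |a m y|) ≤ |h y| * (|τ| ^ m * (B y / ρ ^ m)) := by
            gcongr
            exact hbd y m
        _ = _ := by ring
    · simp only [tsum_mul_right]
      exact hint.abs.const_mul _
  rw [iteratedDeriv_zero_of_hasSum hρ hF m, ← integral_const_mul]
  refine integral_congr_ae (Eventually.of_forall fun y => ?_)
  simp only [hcoeff]
  ring

end Holomorphic

/-! ### The heat kernel -/

section HeatKernel

variable {n : ℕ}

lemma integrable_exp_neg_mul_norm_sub_sq (x : EuclideanSpace ℝ (Fin n)) {b : ℝ} (hb : 0 < b) :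
    Integrable fun w : EuclideanSpace ℝ (Fin n) => Real.exp (-b * ‖x - w‖ ^ 2) := by
  have h := (GaussianFourier.integrable_cexp_neg_mul_sq_norm_add (V := EuclideanSpace ℝ (Fin n))
    (b := (b : ℂ)) (by simpa using hb) 0 0).norm
  have e : (fun w : EuclideanSpace ℝ (Fin n) => ‖Complex.exp (-(b : ℂ) * (‖w‖ : ℂ) ^ 2 +
      0 * (inner ℝ (0 : EuclideanSpace ℝ (Fin n)) w : ℝ))‖) = fun w => Real.exp (-b * ‖w‖ ^ 2) := by
    funext w
    rw [Complex.norm_exp]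
    congr 1
    rw [zero_mul, add_zero, ← Complex.ofReal_pow, ← Complex.ofReal_neg, ← Complex.ofReal_mul,
      Complex.ofReal_re]
  rw [e] at h
  exact h.comp_sub_left x

lemma memLp_exp_neg_mul_norm_sub_tail_sq (x : EuclideanSpace ℝ (Fin n)) {b : ℝ} (hb : 0 < b) :
    MemLp (fun y : Space n => Real.exp (-b * ‖x - tail y‖ ^ 2)) 2 (planeMeasure n) := by
  rw [planeMeasure, (measurableEmbedding_point 0).memLp_map_measure_iff]
  have hm : Measurable fun w : EuclideanSpace ℝ (Fin n) => Real.exp (-b * ‖x - w‖ ^ 2) := by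
    fun_prop
  change MemLp (fun w : EuclideanSpace ℝ (Fin n) => Real.exp (-b * ‖x - w‖ ^ 2)) 2 volume
  rw [memLp_two_iff_integrable_sq hm.aestronglyMeasurable]
  have := integrable_exp_neg_mul_norm_sub_sq x (b := 2 * b) (by positivity)
  refine this.congr (Eventually.of_forall fun w => ?_)
  simp only
  rw [← Real.exp_nat_mul]
  ring_nf

lemma memLp_kernel_heatCauchy (α : ℝ≥0) {q : Space n} (hq : 0 < q 0) :
    MemLp (kernel n (.heatCauchy α) q) 2 (planeMeasure n) := by
  have := (memLp_exp_neg_mul_norm_sub_tail_sq (tail q) (b := 1 / (4 * q 0))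
    (by positivity)).const_mul ((1 / (4 * Real.pi * q 0)) ^ ((n : ℝ) / 2))
  convert this using 2 with y
  simp only [kernel]
  ring_nf

/-- The extension of the heat kernel to complex values of the parameter `τ` along the line
`q + τ v`. -/
def complexHeatKernel (q v : Space n) (z : ℂ) (y : Space n) : ℂ :=
  (4 * Real.pi * (q 0 + z * v 0)) ^ ((-((n : ℝ) / 2) : ℝ) : ℂ) *
    Complex.exp (-(‖tail q - tail y‖ ^ 2 + 2 * z * (inner ℝ (tail q - tail y) (tail v) : ℝ) +
      z ^ 2 * ‖tail v‖ ^ 2) / (4 * (q 0 + z * v 0)))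

lemma complexHeatKernel_ofReal (α : ℝ≥0) (q v : Space n) {τ : ℝ} (hτ : 0 < q 0 + τ * v 0)
    (y : Space n) :
    complexHeatKernel q v τ y = kernel n (.heatCauchy α) (q + τ • v) y := by
  have h0 : (q + τ • v) 0 = q 0 + τ * v 0 := rfl
  have h1 : ‖tail (q + τ • v) - tail y‖ ^ 2 = ‖tail q - tail y‖ ^ 2 +
      2 * τ * inner ℝ (tail q - tail y) (tail v) + τ ^ 2 * ‖tail v‖ ^ 2 := by
    rw [tail_add, tail_smul, add_sub_right_comm, norm_add_sq_real, inner_smul_right, norm_smul,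
      mul_pow, Real.norm_eq_abs, sq_abs]
    ring
  simp only [kernel, complexHeatKernel]
  rw [h0, h1, one_div, Real.inv_rpow (by positivity), ← Real.rpow_neg (by positivity)]
  push_cast [Complex.ofReal_cpow (show 0 ≤ 4 * Real.pi * (q 0 + τ * v 0) by positivity)]
  rfl

lemma norm_mul_apply_zero_le {v : Space n} (hv : ‖v‖ = 1) (z : ℂ) : ‖z * (v 0 : ℂ)‖ ≤ ‖z‖ := by
  have h : ‖(v 0 : ℂ)‖ ≤ 1 := by
    rw [Complex.norm_real]
    exact hv ▸ PiLp.norm_apply_le v 0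
  rw [norm_mul]
  exact mul_le_of_le_one_right (norm_nonneg _) h

lemma complexTime_bounds {q v : Space n} (hv : ‖v‖ = 1) {z : ℂ}
    (hz : ‖z‖ < q 0 / 4) :
    3 * q 0 / 4 ≤ ((q 0 : ℂ) + z * v 0).re ∧ 3 * q 0 / 4 ≤ ‖(q 0 : ℂ) + z * v 0‖ ∧
      ‖(q 0 : ℂ) + z * v 0‖ ≤ 5 * q 0 / 4 := by
  have h := norm_mul_apply_zero_le hv z
  have hq : 0 ≤ q 0 := by linarith [norm_nonneg z]
  have h1 : 3 * q 0 / 4 ≤ ((q 0 : ℂ) + z * v 0).re := by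
    have := (abs_le.1 (Complex.abs_re_le_norm (z * v 0))).1
    rw [Complex.add_re, Complex.ofReal_re]
    linarith
  refine ⟨h1, h1.trans (Complex.re_le_norm _), (norm_add_le _ _).trans ?_⟩
  rw [Complex.norm_real, Real.norm_of_nonneg hq]
  linarith

lemma differentiableOn_complexHeatKernel {q v : Space n} (hq : 0 < q 0) (hv : ‖v‖ = 1)
    (y : Space n) :
    DifferentiableOn ℂ (fun z => complexHeatKernel q v z y) (Metric.ball 0 (q 0 / 4)) := by
  intro z hz
  have hre := (complexTime_bounds hv (by simpa using hz)).1
  have hne : (4 : ℂ) * (q 0 + z * v 0) ≠ 0 := by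
    refine mul_ne_zero (by norm_num) fun h => ?_
    rw [h, Complex.zero_re] at hre
    linarith
  have hslit : (4 : ℂ) * Real.pi * (q 0 + z * v 0) ∈ Complex.slitPlane := by
    left
    have : (4 : ℂ) * Real.pi * (q 0 + z * v 0) = ((4 * Real.pi : ℝ) : ℂ) * (q 0 + z * v 0) := by
      push_cast
      ring
    rw [this, Complex.re_ofReal_mul]
    have := Real.pi_pos
    have : 0 < ((q 0 : ℂ) + z * v 0).re := by linarith
    positivity
  refine DifferentiableAt.differentiableWithinAt ?_
  unfold complexHeatKernel
  refine DifferentiableAt.mul (DifferentiableAt.cpow (by fun_prop) (by fun_prop) hslit) ?_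
  exact DifferentiableAt.cexp (DifferentiableAt.div (by fun_prop) (by fun_prop) hne)

/-- A Gaussian that dominates the heat kernel with pole in a complex neighbourhood. -/
lemma norm_complexHeatKernel_le {q v : Space n} (hq : 0 < q 0) (hv : ‖v‖ = 1) {z : ℂ}
    (hz : ‖z‖ < q 0 / 4) (y : Space n) :
    ‖complexHeatKernel q v z y‖ ≤ (3 * Real.pi * q 0) ^ (-((n : ℝ) / 2)) * Real.exp (q 0 / 4) *
      Real.exp (-(1 / (12 * q 0)) * ‖tail q - tail y‖ ^ 2) := by
  obtain ⟨hre, hlow, hup⟩ := complexTime_bounds hv hz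
  rw [complexHeatKernel, norm_mul, mul_assoc (_ ^ _) (Real.exp _)]
  set s : ℂ := (q 0 : ℂ) + z * v 0 with hs
  set t : ℝ := q 0 with ht
  set a : ℝ := ‖tail q - tail y‖ with ha
  have ha0 : 0 ≤ a := norm_nonneg _
  have hs0 : s ≠ 0 := fun h => by
    rw [h, norm_zero] at hlow
    linarith
  have hw : ‖tail v‖ ≤ 1 := by
    have := norm_sq_eq_tail v
    rw [hv] at this
    nlinarith [sq_nonneg (v 0), norm_nonneg (tail v)]
  refine mul_le_mul ?_ ?_ (norm_nonneg _) (by positivity)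
  · have hne : (4 : ℂ) * Real.pi * s ≠ 0 :=
      mul_ne_zero (mul_ne_zero (by norm_num) (by exact_mod_cast Real.pi_ne_zero)) hs0
    rw [Complex.norm_cpow_of_ne_zero hne, Complex.ofReal_im, mul_zero, Real.exp_zero, div_one,
      Complex.ofReal_re]
    refine Real.rpow_le_rpow_of_nonpos (by positivity) ?_
      (by linarith [(n.cast_nonneg : (0 : ℝ) ≤ n)])
    rw [norm_mul, norm_mul, Complex.norm_real, Real.norm_of_nonneg Real.pi_pos.le]
    norm_num
    nlinarith [Real.pi_pos]
  · rw [Complex.norm_exp, ← Real.exp_add]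
    refine Real.exp_le_exp.2 ?_
    -- split off the perturbation of the quadratic form, which is linear in `a`
    set E : ℂ := 2 * z * (inner ℝ (tail q - tail y) (tail v) : ℝ) + z ^ 2 * ‖tail v‖ ^ 2 with hE
    have hEn : ‖E‖ ≤ t * a / 2 + t ^ 2 / 16 := by
      have h1 : ‖(inner ℝ (tail q - tail y) (tail v) : ℝ)‖ ≤ a :=
        (norm_inner_le_norm _ _).trans (mul_le_of_le_one_right ha0 hw)
      have h2 : ‖tail v‖ ^ 2 ≤ 1 := pow_le_one₀ (norm_nonneg _) hw
      calc ‖E‖ ≤ 2 * ‖z‖ * ‖(inner ℝ (tail q - tail y) (tail v) : ℝ)‖ + ‖z‖ ^ 2 * ‖tail v‖ ^ 2 := by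
            refine (norm_add_le _ _).trans (le_of_eq ?_)
            simp
        _ ≤ 2 * (t / 4) * a + (t / 4) ^ 2 * 1 := by gcongr
        _ = _ := by ring
    have hsplit : -((a : ℂ) ^ 2 + 2 * z * (inner ℝ (tail q - tail y) (tail v) : ℝ) +
        z ^ 2 * ‖tail v‖ ^ 2) / (4 * s) = -((((a ^ 2 / 4 : ℝ) : ℂ) * s⁻¹) + E / (4 * s)) := by
      rw [hE]
      push_cast
      field_simp
      ring
    rw [hsplit, Complex.neg_re, Complex.add_re, Complex.re_ofReal_mul, Complex.inv_re,
      Complex.normSq_eq_norm_sq]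
    have hs1 : 0 < ‖s‖ := norm_pos_iff.2 hs0
    have h3 : 12 / (25 * t) ≤ s.re / ‖s‖ ^ 2 := by
      rw [div_le_div_iff₀ (by positivity) (pow_pos hs1 2)]
      nlinarith [norm_nonneg s]
    have h4 : -(E / (4 * s)).re ≤ a / 6 + t / 48 := by
      refine (neg_le_abs _).trans ((Complex.abs_re_le_norm _).trans ?_)
      rw [norm_div, norm_mul, div_le_iff₀ (mul_pos (by norm_num) hs1)]
      norm_num
      have : (a / 6 + t / 48) * (4 * (3 * t / 4)) ≤ (a / 6 + t / 48) * (4 * ‖s‖) := by gcongr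
      nlinarith
    have h5 : a ^ 2 / 4 * (12 / (25 * t)) ≤ a ^ 2 / 4 * (s.re / ‖s‖ ^ 2) := by gcongr
    have h6 : a / 6 + t / 48 - a ^ 2 / 4 * (12 / (25 * t)) ≤ t / 4 + -(1 / (12 * t)) * a ^ 2 := by
      have : t / 4 + -(1 / (12 * t)) * a ^ 2 - (a / 6 + t / 48 - a ^ 2 / 4 * (12 / (25 * t))) =
          (11 * a ^ 2 - 50 * (a * t) + 275 / 4 * t ^ 2) / (300 * t) := by
        field_simp
        ring
      have h7 : 0 ≤ (11 * a ^ 2 - 50 * (a * t) + 275 / 4 * t ^ 2) / (300 * t) := by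
        apply div_nonneg _ (by positivity)
        nlinarith [sq_nonneg (11 * a - 25 * t)]
      linarith
    linarith

lemma iteratedDeriv_integral_kernel_heatCauchy (α : ℝ≥0) {h : Space n → ℝ}
    (hh : MemLp h 2 (planeMeasure n)) {q v : Space n} (hq : 0 < q 0) (hv : ‖v‖ = 1) (m : ℕ) :
    iteratedDeriv m
        (fun τ : ℝ => ∫ y, h y * kernel n (.heatCauchy α) (q + τ • v) y ∂(planeMeasure n)) 0 =
      ∫ y, h y * iteratedDeriv m (fun τ : ℝ => kernel n (.heatCauchy α) (q + τ • v) y) 0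
        ∂(planeMeasure n) := by
  have hpos : ∀ τ : ℝ, |τ| < q 0 / 4 → 0 < q 0 + τ * v 0 := by
    intro τ hτ
    have := (complexTime_bounds hv (q := q) (z := (τ : ℂ)) (by simpa using hτ)).1
    rw [← Complex.ofReal_mul, ← Complex.ofReal_add, Complex.ofReal_re] at this
    linarith
  refine iteratedDeriv_integral_of_differentiableOn (kc := complexHeatKernel q v)
    (r := q 0 / 4) (by positivity) (differentiableOn_complexHeatKernel hq hv)
    (fun y z hz => norm_complexHeatKernel_le hq hv (by simpa using hz) y)
    (fun y τ hτ => complexHeatKernel_ofReal α q v (hpos τ hτ) y)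
    (fun τ hτ => (memLp_kernel_heatCauchy α (hpos τ hτ)).1) hh.1 ?_ m
  exact hh.integrable_mul
    ((memLp_exp_neg_mul_norm_sub_tail_sq (tail q) (by positivity)).const_mul _)

end HeatKernel

/-! ### Smooth dependence of the Poisson kernels on the pole -/

section Smooth

open scoped ContDiff BoundedContinuousFunction

/-- Near `1` a Banach algebra has a smooth square root, namely the local inverse of squaring. -/
lemma exists_contDiffAt_sqrt (A : Type*) [NormedCommRing A] [NormedAlgebra ℝ A] [CompleteSpace A] :
    ∃ S : A → A, ContDiffAt ℝ ∞ S 1 ∧ S 1 = 1 ∧ ∀ᶠ u in 𝓝 (1 : A), S u ^ 2 = u := by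
  have hf : ContDiffAt ℝ ∞ (fun u : A => u ^ 2) 1 := by fun_prop
  have hf' : HasFDerivAt (fun u : A => u ^ 2)
      ((ContinuousLinearEquiv.smulLeft (Units.mk0 (2 : ℝ) two_ne_zero) : A ≃L[ℝ] A) : A →L[ℝ] A)
      1 := by
    refine ((hasFDerivAt_id (𝕜 := ℝ) (1 : A)).pow 2).congr_fderiv ?_
    ext u
    simp [two_smul, add_mul]
  refine ⟨hf.localInverse hf' (by simp), ?_, ?_, ?_⟩
  · simpa using hf.to_localInverse hf' (by simp)
  · simpa using hf.localInverse_apply_image hf' (by simp)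
  · have := (hf.hasStrictFDerivAt' hf' (by simp)).eventually_right_inverse
    rw [one_pow] at this
    exact this

variable {Y : Type*} [TopologicalSpace Y] {E : Type*} [NormedAddCommGroup E] [InnerProductSpace ℝ E]

/-- The quotient `‖x - j y‖² / ‖q - j y‖²` is a quadratic polynomial in `x` with bounded continuous
coefficients, and equals `1` at `x = q`; hence any power of `‖q - j y‖ / ‖x - j y‖`, as a bounded
continuous function of `y`, depends smoothly on `x` near `q`. -/
lemma exists_contDiffAt_norm_div_norm {j : Y → E} (hj : Continuous j) {q : E} {δ : ℝ} (hδ : 0 < δ)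
    (hq : ∀ y, δ ≤ ‖q - j y‖) (N : ℕ) :
    ∃ Φ : E → (Y →ᵇ ℝ), ContDiffAt ℝ ∞ Φ q ∧
      ∀ᶠ x in 𝓝 q, ∀ y, Φ x y = ‖q - j y‖ ^ N / ‖x - j y‖ ^ N := by
  have hpos : ∀ y, 0 < ‖q - j y‖ := fun y => hδ.trans_le (hq y)
  have hne : ∀ y, ‖q - j y‖ ^ 2 ≠ 0 := fun y => (pow_pos (hpos y) 2).ne'
  have hn : ∀ y, ‖‖q - j y‖ ^ 2‖ = ‖q - j y‖ ^ 2 := fun y => by simp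
  set c : Y →ᵇ ℝ := BoundedContinuousFunction.ofNormedAddCommGroup (fun y => (‖q - j y‖ ^ 2)⁻¹)
    (Continuous.inv₀ (by fun_prop) hne) (δ ^ 2)⁻¹ (fun y => by
      rw [norm_inv, hn]
      have := hq y
      gcongr) with hc
  have hlb : ∀ w y, ‖2 * inner ℝ w (q - j y) / ‖q - j y‖ ^ 2‖ ≤ 2 / δ * ‖w‖ := by
    intro w y
    rw [norm_div, hn, div_le_iff₀ (pow_pos (hpos y) 2), norm_mul, Real.norm_ofNat]
    have h1 := norm_inner_le_norm (𝕜 := ℝ) w (q - j y)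
    have h2 : ‖q - j y‖ ≤ 1 / δ * ‖q - j y‖ ^ 2 := by
      rw [one_div, le_inv_mul_iff₀ hδ, sq]
      exact mul_le_mul_of_nonneg_right (hq y) (norm_nonneg _)
    calc 2 * ‖inner ℝ w (q - j y)‖ ≤ 2 * (‖w‖ * ‖q - j y‖) := by gcongr
      _ ≤ 2 * (‖w‖ * (1 / δ * ‖q - j y‖ ^ 2)) := by gcongr
      _ = _ := by ring
  let l : E → (Y →ᵇ ℝ) := fun w => BoundedContinuousFunction.ofNormedAddCommGroup
    (fun y => 2 * inner ℝ w (q - j y) / ‖q - j y‖ ^ 2)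
    (Continuous.div (by fun_prop) (by fun_prop) hne) (2 / δ * ‖w‖) (hlb w)
  have hladd : ∀ w₁ w₂, l (w₁ + w₂) = l w₁ + l w₂ := fun w₁ w₂ => by
    ext y
    simp [l, inner_add_left, mul_add, add_div]
  have hlsmul : ∀ (a : ℝ) w, l (a • w) = a • l w := fun a w => by
    ext y
    simp only [l, BoundedContinuousFunction.coe_ofNormedAddCommGroup, real_inner_smul_left,
      BoundedContinuousFunction.coe_smul, smul_eq_mul]
    ring
  let L : E →L[ℝ] (Y →ᵇ ℝ) := LinearMap.mkContinuous ⟨⟨l, hladd⟩, hlsmul⟩ (2 / δ) fun w =>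
    BoundedContinuousFunction.norm_ofNormedAddCommGroup_le _ (by positivity) (hlb w)
  set R : E → (Y →ᵇ ℝ) := fun x => 1 + L (x - q) + (‖x - q‖ ^ 2) • c with hR
  have hRq : R q = 1 := by simp [hR]
  have hRapp : ∀ x y, R x y = ‖x - j y‖ ^ 2 / ‖q - j y‖ ^ 2 := by
    intro x y
    have h1 : ‖x - j y‖ ^ 2 = ‖q - j y‖ ^ 2 + 2 * inner ℝ (x - q) (q - j y) + ‖x - q‖ ^ 2 := by
      rw [show x - j y = (x - q) + (q - j y) by abel, norm_add_sq_real]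
      ring
    have h2 : R x y = 1 + 2 * inner ℝ (x - q) (q - j y) / ‖q - j y‖ ^ 2 +
      ‖x - q‖ ^ 2 * (‖q - j y‖ ^ 2)⁻¹ := rfl
    rw [h1, h2]
    rw [add_div, add_div, div_self (hne y), div_eq_mul_inv (‖x - q‖ ^ 2)]
  have hRc : ContDiff ℝ ∞ R := by
    have : ContDiff ℝ ∞ fun x : E => ‖x - q‖ ^ 2 := (contDiff_id.sub contDiff_const).norm_sq ℝ
    fun_prop
  obtain ⟨S, hS, hS1, hSsq⟩ := exists_contDiffAt_sqrt (Y →ᵇ ℝ)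
  have hJ : ContDiffAt ℝ ∞ (fun x => S (R x)) q :=
    ContDiffAt.comp q (by rwa [hRq]) hRc.contDiffAt
  have hJq : S (R q) = 1 := by rw [hRq, hS1]
  refine ⟨fun x => Ring.inverse (S (R x)) ^ N, ?_, ?_⟩
  · refine ContDiffAt.pow ?_ N
    have h1 : ContDiffAt ℝ ∞ Ring.inverse (S (R q)) := by
      rw [hJq]
      exact contDiffAt_ringInverse ℝ (1 : (Y →ᵇ ℝ)ˣ)
    exact h1.comp q hJ
  · have e1 : ∀ᶠ x in 𝓝 q, S (R x) ^ 2 = R x :=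
      hRc.continuous.continuousAt.eventually (by rwa [hRq])
    have e2 : ∀ᶠ x in 𝓝 q, IsUnit (S (R x)) := by
      refine hJ.continuousAt.eventually ?_
      simp only [hJq]
      exact Units.isOpen.mem_nhds isUnit_one
    have e3 : ∀ᶠ x in 𝓝 q, ‖S (R x) - 1‖ < 1 := by
      have := hJ.continuousAt.eventually (Metric.ball_mem_nhds (S (R q)) one_pos)
      rw [hJq] at this
      filter_upwards [this] with x hx using by simpa [dist_eq_norm] using hx
    filter_upwards [e1, e2, e3] with x h1 h2 h3 y
    have hy1 : S (R x) y ^ 2 = ‖x - j y‖ ^ 2 / ‖q - j y‖ ^ 2 := by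
      rw [← hRapp]
      exact congrArg (fun F : Y →ᵇ ℝ => F y) h1
    have hy2 : 0 < S (R x) y := by
      have := (BoundedContinuousFunction.norm_coe_le_norm (S (R x) - 1) y).trans_lt h3
      have := (abs_lt.1 this).1
      simp only [BoundedContinuousFunction.coe_sub, BoundedContinuousFunction.coe_one,
        Pi.sub_apply, Pi.one_apply] at this
      linarith
    have hy3 : S (R x) y = ‖x - j y‖ / ‖q - j y‖ := by
      rw [← div_pow] at hy1
      exact (pow_left_inj₀ hy2.le (by positivity) two_ne_zero).1 hy1
    have hy4 : (Ring.inverse (S (R x))) y * S (R x) y = 1 := by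
      have := congrArg (fun F : Y →ᵇ ℝ => F y) (Ring.inverse_mul_cancel _ h2)
      simpa using this
    have hy5 : (Ring.inverse (S (R x))) y = ‖q - j y‖ / ‖x - j y‖ := by
      rw [eq_inv_of_mul_eq_one_left hy4, hy3, inv_div]
    rw [BoundedContinuousFunction.coe_pow, Pi.pow_apply, hy5, div_pow]

variable [MeasurableSpace Y] [OpensMeasurableSpace Y] {ν : Measure Y}

/-- Integration against an integrable density, on bounded continuous functions. -/
lemma exists_clm_integral_mul {G : Y → ℝ} (hG : Integrable G ν) :
    ∃ Λ : (Y →ᵇ ℝ) →L[ℝ] ℝ, ∀ φ, Λ φ = ∫ y, G y * φ y ∂ν := by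
  have hint : ∀ φ : Y →ᵇ ℝ, Integrable (fun y => G y * φ y) ν := fun φ =>
    hG.mul_bdd (c := ‖φ‖) φ.continuous.measurable.aestronglyMeasurable
      (Eventually.of_forall fun y => φ.norm_coe_le_norm y)
  refine ⟨LinearMap.mkContinuous ⟨⟨fun φ => ∫ y, G y * φ y ∂ν, fun φ ψ => ?_⟩, fun a φ => ?_⟩
    (∫ y, ‖G y‖ ∂ν) fun φ => ?_, fun φ => rfl⟩
  · rw [← integral_add (hint φ) (hint ψ)]
    simp [mul_add]
  · simp only [BoundedContinuousFunction.coe_smul, smul_eq_mul, RingHom.id_apply]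
    rw [← integral_const_mul]
    congr 1
    ext y
    ring
  · refine (norm_integral_le_integral_norm _).trans ?_
    rw [← integral_mul_const]
    refine integral_mono (hint φ).norm (hG.norm.mul_const _) fun y => ?_
    simp only [norm_mul]
    gcongr
    exact φ.norm_coe_le_norm y

/-- A kernel `k` that is, up to a weight `G`, a smooth map into the bounded continuous functions:
integrals against it are smooth in the pole and may be differentiated under the integral sign,
because integration and evaluation are continuous linear maps. -/
lemma contDiffAt_integral_of_contDiffAt {k : E → Y → ℝ} {h G : Y → ℝ} {Ψ : E → (Y →ᵇ ℝ)} {q : E}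
    (hG : Integrable (fun y => h y * G y) ν) (hΨ : ContDiffAt ℝ ∞ Ψ q)
    (hk : ∀ᶠ x in 𝓝 q, ∀ y, k x y = G y * Ψ x y) :
    ContDiffAt ℝ ∞ (fun x => ∫ y, h y * k x y ∂ν) q ∧ ∀ (v : E) (m : ℕ),
      Integrable (fun y => h y * iteratedDeriv m (fun τ : ℝ => k (q + τ • v) y) 0) ν ∧
      iteratedDeriv m (fun τ : ℝ => ∫ y, h y * k (q + τ • v) y ∂ν) 0 =
        ∫ y, h y * iteratedDeriv m (fun τ : ℝ => k (q + τ • v) y) 0 ∂ν := by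
  obtain ⟨Λ, hΛ⟩ := exists_clm_integral_mul hG
  have hu : (fun x => ∫ y, h y * k x y ∂ν) =ᶠ[𝓝 q] fun x => Λ (Ψ x) := by
    filter_upwards [hk] with x hx
    rw [hΛ]
    simp only [hx, mul_assoc]
  refine ⟨(Λ.contDiff.contDiffAt.comp q hΨ).congr_of_eventuallyEq hu, fun v m => ?_⟩
  have hline : Tendsto (fun τ : ℝ => q + τ • v) (𝓝 0) (𝓝 q) := by
    have : Continuous fun τ : ℝ => q + τ • v := by fun_prop
    simpa using this.tendsto 0
  set ψ : ℝ → (Y →ᵇ ℝ) := fun τ => Ψ (q + τ • v) with hψdef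
  have hψ : ContDiffAt ℝ ∞ ψ 0 := by
    refine ContDiffAt.comp (0 : ℝ) (by simpa using hΨ) ?_
    fun_prop
  have hclm : ∀ T : (Y →ᵇ ℝ) →L[ℝ] ℝ,
      iteratedDeriv m (fun τ => T (ψ τ)) 0 = T (iteratedDeriv m ψ 0) := by
    intro T
    have := T.iteratedFDeriv_comp_left hψ (i := m) (by exact_mod_cast le_top)
    rw [iteratedDeriv_eq_iteratedFDeriv, iteratedDeriv_eq_iteratedFDeriv]
    exact congrArg (fun M => M fun _ => (1 : ℝ)) this
  have hpt : ∀ y, iteratedDeriv m (fun τ : ℝ => k (q + τ • v) y) 0 =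
      G y * iteratedDeriv m ψ 0 y := by
    intro y
    have h1 : (fun τ : ℝ => k (q + τ • v) y) =ᶠ[𝓝 0]
        fun τ => (G y • BoundedContinuousFunction.evalCLM ℝ y) (ψ τ) := by
      filter_upwards [hline.eventually hk] with τ hτ
      rw [hτ y]
      rfl
    rw [h1.iteratedDeriv_eq, hclm]
    rfl
  have h2 : (fun τ : ℝ => ∫ y, h y * k (q + τ • v) y ∂ν) =ᶠ[𝓝 0] fun τ => Λ (ψ τ) :=
    hline.eventually hu
  rw [h2.iteratedDeriv_eq, hclm, hΛ]
  simp only [hpt, ← mul_assoc]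
  refine ⟨?_, trivial⟩
  exact hG.mul_bdd (c := ‖iteratedDeriv m ψ 0‖)
    (iteratedDeriv m ψ 0).continuous.measurable.aestronglyMeasurable
    (Eventually.of_forall fun y => (iteratedDeriv m ψ 0).norm_coe_le_norm y)

lemma iteratedDeriv_two_comp_line {u : E → ℝ} {x : E} (hu : ContDiffAt ℝ 2 u x) (e : E) :
    iteratedDeriv 2 (fun τ : ℝ => u (x + τ • e)) 0 = fderiv ℝ (fderiv ℝ u) x e e := by
  have hline : ∀ τ : ℝ, HasDerivAt (fun τ : ℝ => x + τ • e) e τ := fun τ => by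
    simpa using ((hasDerivAt_id τ).smul_const e).const_add x
  have hlim : Tendsto (fun τ : ℝ => x + τ • e) (𝓝 0) (𝓝 x) := by
    simpa using (hline 0).continuousAt.tendsto
  have h1 : deriv (fun τ : ℝ => u (x + τ • e)) =ᶠ[𝓝 0]
      fun τ => fderiv ℝ u (x + τ • e) e := by
    have := hlim.eventually (hu.eventually (by simp))
    filter_upwards [this] with τ hτ
    have h := (hτ.differentiableAt two_ne_zero).hasFDerivAt
    exact (h.comp_hasDerivAt τ (hline τ)).deriv
  have h2 : HasFDerivAt (fderiv ℝ u) (fderiv ℝ (fderiv ℝ u) x) (x + (0 : ℝ) • e) := by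
    rw [zero_smul, add_zero]
    exact ((hu.fderiv_right (m := 1) (by norm_num)).differentiableAt one_ne_zero).hasFDerivAt
  have h3 : HasDerivAt (fun τ : ℝ => fderiv ℝ u (x + τ • e)) (fderiv ℝ (fderiv ℝ u) x e) 0 :=
    h2.comp_hasDerivAt (0 : ℝ) (hline 0)
  have h4 := (ContinuousLinearMap.apply ℝ ℝ e).hasFDerivAt.comp_hasDerivAt (0 : ℝ) h3
  rw [iteratedDeriv_succ, iteratedDeriv_one, h1.deriv_eq]
  exact h4.deriv

/-- The Laplacian as a sum of second derivatives along the lines of an orthonormal basis. -/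
lemma laplacian_eq_sum_iteratedDeriv {ι : Type*} [Fintype ι] [FiniteDimensional ℝ E]
    (b : OrthonormalBasis ι ℝ E) {u : E → ℝ} {x : E} (hu : ContDiffAt ℝ 2 u x) :
    (Laplacian.laplacian u : E → ℝ) x =
      ∑ i, iteratedDeriv 2 (fun τ : ℝ => u (x + τ • b i)) 0 := by
  have h0 := congrFun (InnerProductSpace.laplacian_eq_iteratedFDeriv_orthonormalBasis u b) x
  rw [h0]
  refine Finset.sum_congr rfl fun i _ => ?_
  rw [iteratedFDeriv_two_apply, iteratedDeriv_two_comp_line hu]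
  rfl

end Smooth

/-! ### The common form of the Poisson kernels -/

section Poisson

open scoped ContDiff

variable {n : ℕ}

/-- The second derivative along a line of a quadratic polynomial times a power of a squared
distance. -/
lemma iteratedDeriv_two_quadratic_mul_rpow (a b c β s : ℝ) {ρ : ℝ} (hρ : 0 < ρ) :
    iteratedDeriv 2 (fun τ : ℝ => (a + b * τ + c * τ ^ 2) * (ρ + 2 * β * τ + τ ^ 2) ^ (-s)) 0 =
      2 * c * ρ ^ (-s) - 4 * s * b * β * ρ ^ (-s - 1) +
        a * (4 * s * (s + 1) * β ^ 2 * ρ ^ (-s - 2) - 2 * s * ρ ^ (-s - 1)) := by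
  have hA : ∀ τ : ℝ, HasDerivAt (fun τ : ℝ => a + b * τ + c * τ ^ 2) (b + 2 * c * τ) τ := by
    intro τ
    have := (((hasDerivAt_id τ).const_mul b).const_add a).add
      (((hasDerivAt_id τ).pow 2).const_mul c)
    refine this.congr_deriv ?_
    simp
    ring
  have hA' : HasDerivAt (fun τ : ℝ => b + 2 * c * τ) (2 * c) 0 := by
    simpa using ((hasDerivAt_id (0 : ℝ)).const_mul (2 * c)).const_add b
  have hB : ∀ τ : ℝ, HasDerivAt (fun τ : ℝ => ρ + 2 * β * τ + τ ^ 2) (2 * β + 2 * τ) τ := by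
    intro τ
    have := (((hasDerivAt_id τ).const_mul (2 * β)).const_add ρ).add ((hasDerivAt_id τ).pow 2)
    refine this.congr_deriv ?_
    simp
  have hB' : HasDerivAt (fun τ : ℝ => 2 * β + 2 * τ) 2 0 := by
    simpa using ((hasDerivAt_id (0 : ℝ)).const_mul 2).const_add (2 * β)
  have hpow : ∀ τ r : ℝ, 0 < ρ + 2 * β * τ + τ ^ 2 →
      HasDerivAt (fun τ : ℝ => (ρ + 2 * β * τ + τ ^ 2) ^ r)
        ((2 * β + 2 * τ) * r * (ρ + 2 * β * τ + τ ^ 2) ^ (r - 1)) τ :=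
    fun τ r h => (hB τ).rpow_const (Or.inl h.ne')
  have hpos : ∀ᶠ τ : ℝ in 𝓝 0, 0 < ρ + 2 * β * τ + τ ^ 2 := by
    have : ContinuousAt (fun τ : ℝ => ρ + 2 * β * τ + τ ^ 2) 0 := by fun_prop
    exact this.eventually (lt_mem_nhds (by simpa using hρ))
  have h1 : deriv (fun τ : ℝ => (a + b * τ + c * τ ^ 2) * (ρ + 2 * β * τ + τ ^ 2) ^ (-s)) =ᶠ[𝓝 0]
      fun τ => (b + 2 * c * τ) * (ρ + 2 * β * τ + τ ^ 2) ^ (-s) + (a + b * τ + c * τ ^ 2) *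
        ((2 * β + 2 * τ) * (-s) * (ρ + 2 * β * τ + τ ^ 2) ^ (-s - 1)) := by
    filter_upwards [hpos] with τ hτ
    exact ((hA τ).mul (hpow τ (-s) hτ)).deriv
  have h0 : 0 < ρ + 2 * β * 0 + (0 : ℝ) ^ 2 := by simpa using hρ
  have h2 := (hA'.mul (hpow 0 (-s) h0)).add
    ((hA 0).mul ((hB'.mul_const (-s)).mul (hpow 0 (-s - 1) h0)))
  rw [iteratedDeriv_succ, iteratedDeriv_one, h1.deriv_eq]
  refine h2.deriv.trans ?_
  simp only [Pi.mul_apply, mul_zero, add_zero, ne_eq, OfNat.ofNat_ne_zero,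
    not_false_eq_true, zero_pow]
  rw [show -s - 1 - 1 = -s - 2 by ring]
  ring

lemma one_div_norm_pow_eq_rpow {E : Type*} [SeminormedAddCommGroup E] (z : E) (N : ℕ) :
    1 / ‖z‖ ^ N = (‖z‖ ^ 2) ^ (-((N : ℝ) / 2)) := by
  rw [← Real.rpow_natCast ‖z‖ 2, ← Real.rpow_mul (norm_nonneg z), one_div, ← Real.rpow_natCast,
    ← Real.rpow_neg (norm_nonneg z)]
  congr 1
  push_cast
  ring

/-- The sum over a basis of the second derivatives of a quadratic polynomial times
`‖x - y‖ ^ (-(n + 1))`. -/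
lemma sum_iteratedDeriv_two_div_norm_pow {a : Space n → ℝ} {x y : Space n} (hxy : x ≠ y)
    {b : Fin (n + 1) → ℝ} {c : ℝ}
    (ha : ∀ i (τ : ℝ), a (x + τ • EuclideanSpace.basisFun (Fin (n + 1)) ℝ i) =
      a x + b i * τ + c * τ ^ 2) :
    ∃ r : ℝ, ∑ i, iteratedDeriv 2
        (fun τ : ℝ => a (x + τ • EuclideanSpace.basisFun (Fin (n + 1)) ℝ i) /
          ‖x + τ • EuclideanSpace.basisFun (Fin (n + 1)) ℝ i - y‖ ^ (n + 1)) 0 =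
      r * (c * ‖x - y‖ ^ 2 - ∑ i, b i * (x i - y i) + a x) := by
  set ρ : ℝ := ‖x - y‖ ^ 2 with hρdef
  have hρ : 0 < ρ := pow_pos (norm_pos_iff.2 (sub_ne_zero.2 hxy)) 2
  set s : ℝ := ((n + 1 : ℕ) : ℝ) / 2 with hs
  have hterm : ∀ i, iteratedDeriv 2
      (fun τ : ℝ => a (x + τ • EuclideanSpace.basisFun (Fin (n + 1)) ℝ i) /
        ‖x + τ • EuclideanSpace.basisFun (Fin (n + 1)) ℝ i - y‖ ^ (n + 1)) 0 =
      2 * c * ρ ^ (-s) - 4 * s * ρ ^ (-s - 1) * (b i * (x i - y i)) +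
        (4 * s * (s + 1) * a x * ρ ^ (-s - 2) * (x i - y i) ^ 2 -
          2 * s * a x * ρ ^ (-s - 1)) := by
    intro i
    refine Eq.trans ?_ (show 2 * c * ρ ^ (-s) - 4 * s * b i * (x i - y i) * ρ ^ (-s - 1) +
        a x * (4 * s * (s + 1) * (x i - y i) ^ 2 * ρ ^ (-s - 2) - 2 * s * ρ ^ (-s - 1)) = _ by ring)
    rw [← iteratedDeriv_two_quadratic_mul_rpow _ _ _ _ _ hρ]
    congr 1
    funext τ
    rw [ha, div_eq_mul_one_div, one_div_norm_pow_eq_rpow, ← hs, add_sub_right_comm,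
      norm_add_sq_real, inner_smul_right, norm_smul, mul_pow, OrthonormalBasis.norm_eq_one]
    congr 2
    simp only [EuclideanSpace.basisFun_apply, EuclideanSpace.inner_single_right]
    simp [hρdef]
    ring
  have hsum : ∑ i, (x i - y i) ^ 2 = ρ := by
    simp [hρdef, EuclideanSpace.norm_sq_eq]
  have e1 : ρ ^ (-s) = ρ ^ 2 * ρ ^ (-s - 2) := by
    rw [← Real.rpow_natCast ρ 2, ← Real.rpow_add hρ]
    congr 1
    push_cast
    ring
  have e2 : ρ ^ (-s - 1) = ρ * ρ ^ (-s - 2) := by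
    nth_rw 2 [← Real.rpow_one ρ]
    rw [← Real.rpow_add hρ]
    congr 1
    ring
  have e3 : ((n + 1 : ℕ) : ℝ) = 2 * s := by
    rw [hs]
    ring
  refine ⟨4 * s * ρ * ρ ^ (-s - 2), ?_⟩
  simp only [hterm, Finset.sum_add_distrib, Finset.sum_sub_distrib, ← Finset.mul_sum,
    Finset.sum_const, Finset.card_univ, Fintype.card_fin,
    nsmul_eq_mul, hsum]
  rw [e3, e1, e2]
  ring

/-! Both Poisson kernels have the form `a x / ‖x - y‖ ^ (n + 1)`, and both boundary measures are
images of a measure `ν` under a closed embedding `j`. -/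

section Family

variable {Y : Type*} [TopologicalSpace Y] [MeasurableSpace Y] [OpensMeasurableSpace Y]
  {ν : Measure Y} {j : Y → Space n} {a : Space n → ℝ} {h : Space n → ℝ}

lemma contDiffAt_integral_div_norm_pow (hj : Continuous j) (hj' : MeasurableEmbedding j)
    (ha : ContDiff ℝ ∞ a) {q : Space n} {δ : ℝ} (hδ : 0 < δ) (hq : ∀ y, δ ≤ ‖q - j y‖)
    (hh : MemLp h 2 (ν.map j)) (hG : MemLp (fun y => 1 / ‖q - y‖ ^ (n + 1)) 2 (ν.map j)) :
    ContDiffAt ℝ ∞ (fun x => ∫ y, h y * (a x / ‖x - y‖ ^ (n + 1)) ∂(ν.map j)) q ∧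
    ∀ (v : Space n) (m : ℕ),
      Integrable (fun y => h y * iteratedDeriv m (fun τ : ℝ => a (q + τ • v) /
        ‖q + τ • v - y‖ ^ (n + 1)) 0) (ν.map j) ∧
      iteratedDeriv m (fun τ : ℝ => ∫ y, h y * (a (q + τ • v) /
          ‖q + τ • v - y‖ ^ (n + 1)) ∂(ν.map j)) 0 =
        ∫ y, h y * iteratedDeriv m (fun τ : ℝ => a (q + τ • v) /
          ‖q + τ • v - y‖ ^ (n + 1)) 0 ∂(ν.map j) := by
  obtain ⟨Φ, hΦ, hΦq⟩ := exists_contDiffAt_norm_div_norm hj hδ hq (n + 1)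
  have hint : Integrable (fun y => h (j y) * (1 / ‖q - j y‖ ^ (n + 1))) ν :=
    hj'.integrable_map_iff.1 (hh.integrable_mul hG)
  have key := contDiffAt_integral_of_contDiffAt (k := fun x y => a x / ‖x - j y‖ ^ (n + 1))
    (Ψ := fun x => a x • Φ x) hint (ha.contDiffAt.smul hΦ) ?_
  · simp only [hj'.integral_map, hj'.integrable_map_iff]
    exact key
  · filter_upwards [hΦq] with x hx y
    have hne : ‖q - j y‖ ^ (n + 1) ≠ 0 := (pow_pos (hδ.trans_le (hq y)) _).ne'
    change _ = _ * (a x * Φ x y)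
    rw [hx y]
    field_simp

lemma harmonicOnNhd_integral_div_norm_pow (hj : Continuous j) (hj' : MeasurableEmbedding j)
    (ha : ContDiff ℝ ∞ a) {D : Set (Space n)} (hD : IsOpen D)
    (hdist : ∀ q ∈ D, ∃ δ > 0, ∀ y, δ ≤ ‖q - j y‖)
    (hh : MemLp h 2 (ν.map j))
    (hG : ∀ q ∈ D, MemLp (fun y => 1 / ‖q - y‖ ^ (n + 1)) 2 (ν.map j))
    (hlap : ∀ q ∈ D, ∀ y, ∑ i, iteratedDeriv 2 (fun τ : ℝ =>
      a (q + τ • EuclideanSpace.basisFun (Fin (n + 1)) ℝ i) /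
        ‖q + τ • EuclideanSpace.basisFun (Fin (n + 1)) ℝ i - j y‖ ^ (n + 1)) 0 = 0) :
    InnerProductSpace.HarmonicOnNhd
      (fun x => ∫ y, h y * (a x / ‖x - y‖ ^ (n + 1)) ∂(ν.map j)) D := by
  have key := fun q (hq : q ∈ D) => contDiffAt_integral_div_norm_pow hj hj' ha
    (hdist q hq).choose_spec.1 (hdist q hq).choose_spec.2 hh (hG q hq)
  intro x hx
  refine ⟨contDiffAt_infty.1 (key x hx).1 2, ?_⟩
  filter_upwards [hD.mem_nhds hx] with q hq
  rw [laplacian_eq_sum_iteratedDeriv (EuclideanSpace.basisFun (Fin (n + 1)) ℝ)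
    (contDiffAt_infty.1 (key q hq).1 2)]
  simp only [((key q hq).2 _ 2).2]
  rw [← integral_finsetSum _ fun i _ => ((key q hq).2 _ 2).1, hj'.integral_map]
  simp only [← Finset.mul_sum, hlap q hq, mul_zero, integral_zero, Pi.zero_apply]

end Family

end Poisson

/-! ### The Poisson kernel of the unit ball -/

section Ball

open scoped ContDiff

variable {n : ℕ}

/-- The normalized surface measure, on the unit sphere as a type. -/
def unitSphereMeasure (n : ℕ) : Measure (Metric.sphere (0 : Space n) 1) :=
  ((volume : Measure (Space n)).toSphere Set.univ)⁻¹ • (volume : Measure (Space n)).toSphere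

lemma sphereMeasure_eq_map (n : ℕ) :
    sphereMeasure n = (unitSphereMeasure n).map (Subtype.val : Metric.sphere (0 : Space n) 1 → _) :=
  rfl

instance (n : ℕ) : IsProbabilityMeasure (unitSphereMeasure n) := by
  refine ⟨?_⟩
  rw [unitSphereMeasure, Measure.smul_apply, smul_eq_mul]
  refine ENNReal.inv_mul_cancel ?_ (measure_ne_top _ _)
  rw [Measure.measure_univ_ne_zero]
  exact Measure.toSphere_ne_zero _

instance (n : ℕ) : IsProbabilityMeasure (sphereMeasure n) := by
  rw [sphereMeasure_eq_map]
  exact Measure.isProbabilityMeasure_map measurable_subtype_coe.aemeasurable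

lemma measurableEmbedding_sphere_val :
    MeasurableEmbedding (Subtype.val : Metric.sphere (0 : Space n) 1 → Space n) :=
  MeasurableEmbedding.subtype_coe Metric.isClosed_sphere.measurableSet

lemma one_sub_norm_le_norm_sub (q : Space n) (y : Metric.sphere (0 : Space n) 1) :
    1 - ‖q‖ ≤ ‖q - y‖ := by
  have h := norm_sub_norm_le (y : Space n) q
  rw [mem_sphere_zero_iff_norm.1 y.2, norm_sub_rev] at h
  exact h

lemma continuous_one_div_norm_sub_pow {q : Space n} (hq : ‖q‖ < 1) (N : ℕ) :
    Continuous fun y : Metric.sphere (0 : Space n) 1 => 1 / ‖q - y‖ ^ N := by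
  refine continuous_const.div (by fun_prop) fun y => ?_
  have := one_sub_norm_le_norm_sub q y
  exact pow_ne_zero _ (by linarith)

lemma memLp_one_div_norm_pow_sphereMeasure {q : Space n} (hq : ‖q‖ < 1) :
    MemLp (fun y => 1 / ‖q - y‖ ^ (n + 1)) 2 (sphereMeasure n) := by
  rw [sphereMeasure_eq_map, measurableEmbedding_sphere_val.memLp_map_measure_iff]
  have hc := continuous_one_div_norm_sub_pow hq (n + 1)
  refine MemLp.of_bound hc.measurable.aestronglyMeasurable (1 / (1 - ‖q‖) ^ (n + 1))
    (Eventually.of_forall fun y => ?_)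
  have := one_sub_norm_le_norm_sub q y
  have : 0 < 1 - ‖q‖ := by linarith
  rw [Function.comp_apply, Real.norm_of_nonneg (by positivity)]
  gcongr

lemma kernel_dirichletBall (x y : Space n) :
    kernel n .dirichletBall x y = (1 - ‖x‖ ^ 2) / ‖x - y‖ ^ (n + 1) := rfl

lemma contDiff_one_sub_norm_sq : ContDiff ℝ ∞ fun x : Space n => 1 - ‖x‖ ^ 2 :=
  contDiff_const.sub (contDiff_id.norm_sq ℝ)

lemma memLp_kernel_dirichletBall {q : Space n} (hq : ‖q‖ < 1) :
    MemLp (kernel n .dirichletBall q) 2 (sphereMeasure n) := by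
  have h := (memLp_one_div_norm_pow_sphereMeasure hq).const_mul (1 - ‖q‖ ^ 2)
  simp only [mul_one_div] at h
  exact h

lemma iteratedDeriv_integral_kernel_dirichletBall {h : Space n → ℝ}
    (hh : MemLp h 2 (sphereMeasure n)) {q : Space n} (hq : ‖q‖ < 1) (v : Space n) (m : ℕ) :
    iteratedDeriv m
        (fun τ : ℝ => ∫ y, h y * kernel n .dirichletBall (q + τ • v) y ∂(sphereMeasure n)) 0 =
      ∫ y, h y * iteratedDeriv m (fun τ : ℝ => kernel n .dirichletBall (q + τ • v) y) 0
        ∂(sphereMeasure n) :=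
  ((contDiffAt_integral_div_norm_pow continuous_subtype_val measurableEmbedding_sphere_val
    contDiff_one_sub_norm_sq (sub_pos.2 hq) (one_sub_norm_le_norm_sub q) hh
    (memLp_one_div_norm_pow_sphereMeasure hq)).2 v m).2

lemma harmonicOnNhd_integral_kernel_dirichletBall {h : Space n → ℝ}
    (hh : MemLp h 2 (sphereMeasure n)) :
    InnerProductSpace.HarmonicOnNhd
      (fun x => ∫ y, h y * kernel n .dirichletBall x y ∂(sphereMeasure n))
      (Metric.ball 0 1) := by
  refine harmonicOnNhd_integral_div_norm_pow (ν := unitSphereMeasure n) continuous_subtype_val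
    measurableEmbedding_sphere_val contDiff_one_sub_norm_sq Metric.isOpen_ball
    (fun q hq => ⟨1 - ‖q‖, sub_pos.2 (mem_ball_zero_iff.1 hq), one_sub_norm_le_norm_sub q⟩) hh
    (fun q hq => memLp_one_div_norm_pow_sphereMeasure (mem_ball_zero_iff.1 hq)) fun q hq y => ?_
  have hqy : q ≠ y := by
    rintro rfl
    have h1 := mem_sphere_zero_iff_norm.1 y.2
    have h2 := mem_ball_zero_iff.1 hq
    linarith
  obtain ⟨r, hr⟩ := sum_iteratedDeriv_two_div_norm_pow (a := fun x : Space n => 1 - ‖x‖ ^ 2) hqy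
    (b := fun i => -2 * q i) (c := -1) fun i τ => by
      simp only [EuclideanSpace.basisFun_apply]
      rw [norm_add_sq_real, inner_smul_right, norm_smul, mul_pow, EuclideanSpace.inner_single_right,
        PiLp.norm_single]
      simp
      ring
  rw [hr]
  -- with `‖y‖ = 1`, the bracket is `-‖q - y‖² + 2 ⟨q, q - y⟩ + 1 - ‖q‖² = 0`
  have h1 : ∑ i, -2 * q i * (q i - (y : Space n) i) = -2 * inner ℝ q (q - (y : Space n)) := by
    rw [PiLp.inner_apply, Finset.mul_sum]
    refine Finset.sum_congr rfl fun i _ => ?_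
    simp
    ring
  rw [h1, norm_sub_sq_real, inner_sub_right, real_inner_self_eq_norm_sq,
    mem_sphere_zero_iff_norm.1 y.2]
  ring

end Ball

/-! ### The Poisson kernel of the half-space -/

section PoissonHalfSpace

open scoped ContDiff

variable {n : ℕ}

/-- The constant in front of the Poisson kernel of the half-space. -/
def poissonConst (n : ℕ) : ℝ :=
  Real.Gamma (((n : ℝ) + 1) / 2) / Real.pi ^ (((n : ℝ) + 1) / 2)

lemma poissonConst_pos (n : ℕ) : 0 < poissonConst n := by
  have := Real.Gamma_pos_of_pos (show 0 < ((n : ℝ) + 1) / 2 by positivity)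
  unfold poissonConst
  positivity

lemma kernel_dirichletHalfSpace (x y : Space n) :
    kernel n .dirichletHalfSpace x y = poissonConst n * x 0 / ‖x - y‖ ^ (n + 1) := rfl

/-- The Poisson kernel of the half-space at height `1`. -/
def poissonProfile (w : EuclideanSpace ℝ (Fin n)) : ℝ :=
  poissonConst n * (1 + ‖w‖ ^ 2) ^ (-((n + 1 : ℕ) : ℝ) / 2)

lemma integrable_poissonProfile : Integrable (poissonProfile (n := n)) := by
  refine (integrable_rpow_neg_one_add_norm_sq ?_).const_mul _
  rw [finrank_euclideanSpace_fin]
  exact_mod_cast Nat.lt_succ_self n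

lemma continuous_poissonProfile : Continuous (poissonProfile (n := n)) := by
  unfold poissonProfile
  refine continuous_const.mul (Continuous.rpow_const (by fun_prop) fun w => Or.inl ?_)
  positivity

lemma poissonProfile_pos (w : EuclideanSpace ℝ (Fin n)) : 0 < poissonProfile w := by
  have := poissonConst_pos n
  unfold poissonProfile
  positivity

lemma poissonProfile_le (w : EuclideanSpace ℝ (Fin n)) : poissonProfile w ≤ poissonConst n := by
  refine mul_le_of_le_one_right (poissonConst_pos n).le ?_
  refine Real.rpow_le_one_of_one_le_of_nonpos (by nlinarith [sq_nonneg ‖w‖]) ?_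
  have : (0 : ℝ) ≤ ((n + 1 : ℕ) : ℝ) := Nat.cast_nonneg _
  linarith

lemma kernel_dirichletHalfSpace_point {t : ℝ} (ht : 0 < t) (z w : EuclideanSpace ℝ (Fin n)) :
    kernel n .dirichletHalfSpace (point t z) (point 0 w) =
      (t ^ n)⁻¹ * poissonProfile (t⁻¹ • (z - w)) := by
  have h1 : 1 / ‖point t z - point 0 w‖ ^ (n + 1) =
      (t ^ 2) ^ (-((n + 1 : ℕ) : ℝ) / 2) *
        (1 + ‖t⁻¹ • (z - w)‖ ^ 2) ^ (-((n + 1 : ℕ) : ℝ) / 2) := by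
    rw [one_div_norm_pow_eq_rpow, ← Real.mul_rpow (by positivity) (by positivity), neg_div,
      point_sub, norm_point_sq, norm_smul, mul_pow, norm_inv, Real.norm_of_nonneg ht.le]
    congr 1
    field_simp
    ring
  have h2 : (t ^ 2) ^ (-((n + 1 : ℕ) : ℝ) / 2) = (t ^ (n + 1))⁻¹ := by
    rw [← Real.rpow_natCast t 2, ← Real.rpow_mul ht.le, ← Real.rpow_natCast t (n + 1),
      ← Real.rpow_neg ht.le]
    congr 1
    push_cast
    ring
  rw [kernel_dirichletHalfSpace, div_eq_mul_one_div, h1, h2, poissonProfile, point_apply_zero,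
    pow_succ]
  field_simp

lemma memLp_kernel_dirichletHalfSpace {q : Space n} (hq : 0 < q 0) :
    MemLp (kernel n .dirichletHalfSpace q) 2 (planeMeasure n) := by
  rw [planeMeasure, (measurableEmbedding_point 0).memLp_map_measure_iff]
  have h1 : (kernel n .dirichletHalfSpace q) ∘ point 0 = fun w =>
      (q 0 ^ n)⁻¹ * poissonProfile ((q 0)⁻¹ • (tail q - w)) := by
    funext w
    rw [← kernel_dirichletHalfSpace_point hq, point_tail]
    rfl
  rw [h1]
  refine MemLp.const_mul ?_ _
  have hc : Continuous fun w : EuclideanSpace ℝ (Fin n) =>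
      poissonProfile ((q 0)⁻¹ • (tail q - w)) := continuous_poissonProfile.comp (by fun_prop)
  rw [memLp_two_iff_integrable_sq hc.aestronglyMeasurable]
  have h2 : Integrable fun w : EuclideanSpace ℝ (Fin n) =>
      poissonProfile ((q 0)⁻¹ • (tail q - w)) :=
    (integrable_poissonProfile.comp_smul (inv_ne_zero hq.ne')).comp_sub_left (tail q)
  refine (h2.const_mul (poissonConst n)).mono (hc.pow 2).aestronglyMeasurable
    (Eventually.of_forall fun w => ?_)
  have h3 := poissonProfile_pos ((q 0)⁻¹ • (tail q - w))
  rw [Real.norm_of_nonneg (sq_nonneg _),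
    Real.norm_of_nonneg (mul_nonneg (poissonConst_pos n).le h3.le), sq]
  exact mul_le_mul_of_nonneg_right (poissonProfile_le _) h3.le

lemma memLp_one_div_norm_pow_planeMeasure {q : Space n} (hq : 0 < q 0) :
    MemLp (fun y => 1 / ‖q - y‖ ^ (n + 1)) 2 (planeMeasure n) := by
  have h := (memLp_kernel_dirichletHalfSpace hq).const_mul (poissonConst n * q 0)⁻¹
  convert h using 2 with y
  rw [kernel_dirichletHalfSpace]
  have := (poissonConst_pos n).ne'
  field_simp

lemma apply_zero_le_norm_sub (q : Space n) (w : EuclideanSpace ℝ (Fin n)) :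
    q 0 ≤ ‖q - point 0 w‖ := by
  have := PiLp.norm_apply_le (q - point 0 w) 0
  simp only [PiLp.sub_apply, point_apply_zero, sub_zero] at this
  exact (le_abs_self _).trans this

lemma contDiff_const_mul_apply_zero : ContDiff ℝ ∞ fun x : Space n => poissonConst n * x 0 := by
  fun_prop

lemma iteratedDeriv_integral_kernel_dirichletHalfSpace {h : Space n → ℝ}
    (hh : MemLp h 2 (planeMeasure n)) {q : Space n} (hq : 0 < q 0) (v : Space n) (m : ℕ) :
    iteratedDeriv m
        (fun τ : ℝ => ∫ y, h y * kernel n .dirichletHalfSpace (q + τ • v) y ∂(planeMeasure n)) 0 =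
      ∫ y, h y * iteratedDeriv m (fun τ : ℝ => kernel n .dirichletHalfSpace (q + τ • v) y) 0
        ∂(planeMeasure n) :=
  ((contDiffAt_integral_div_norm_pow (continuous_point 0) (measurableEmbedding_point 0)
    contDiff_const_mul_apply_zero hq (apply_zero_le_norm_sub q) hh
    (memLp_one_div_norm_pow_planeMeasure hq)).2 v m).2

lemma isOpen_halfSpace : IsOpen {x : Space n | 0 < x 0} :=
  isOpen_lt continuous_const (by fun_prop)

lemma harmonicOnNhd_integral_kernel_dirichletHalfSpace {h : Space n → ℝ}
    (hh : MemLp h 2 (planeMeasure n)) :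
    InnerProductSpace.HarmonicOnNhd
      (fun x => ∫ y, h y * kernel n .dirichletHalfSpace x y ∂(planeMeasure n))
      {x | 0 < x 0} := by
  refine harmonicOnNhd_integral_div_norm_pow (ν := volume) (continuous_point 0)
    (measurableEmbedding_point 0) contDiff_const_mul_apply_zero isOpen_halfSpace
    (fun q hq => ⟨q 0, hq, apply_zero_le_norm_sub q⟩) hh
    (fun q hq => memLp_one_div_norm_pow_planeMeasure hq) fun q hq y => ?_
  have hq0 : 0 < q 0 := hq
  have hqy : q ≠ point 0 y := by
    rintro rfl
    exact lt_irrefl _ hq0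
  obtain ⟨r, hr⟩ := sum_iteratedDeriv_two_div_norm_pow
    (a := fun x : Space n => poissonConst n * x 0) hqy (b := fun i => if i = 0 then poissonConst n else 0) (c := 0) fun i τ => by
      rcases eq_or_ne i 0 with rfl | hi
      · simp
        ring
      · simp [hi, hi.symm]
  rw [hr]
  simp

end PoissonHalfSpace

/-! ### The Schur test -/

section Schur

variable {X Y : Type*} [MeasurableSpace X] [MeasurableSpace Y] {μ : Measure X} {ν : Measure Y}

/-- The Schur test: a kernel whose integrals in either variable are bounded by `C` defines an
operator of norm at most `C` from `L²(ν)` to `L²(μ)`. -/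
lemma lintegral_lintegral_mul_sq_le [SFinite μ] [SFinite ν] {k : X → Y → ℝ≥0∞} {C : ℝ≥0∞}
    (hC : C ≠ ∞) (hk : Measurable (Function.uncurry k)) (h1 : ∀ x, ∫⁻ y, k x y ∂ν ≤ C)
    (h2 : ∀ y, ∫⁻ x, k x y ∂μ ≤ C) {G : Y → ℝ≥0∞} (hG : Measurable G) :
    ∫⁻ x, (∫⁻ y, k x y * G y ∂ν) ^ 2 ∂μ ≤ C ^ 2 * ∫⁻ y, G y ^ 2 ∂ν := by
  have hkx : ∀ x, Measurable (k x) := fun x => hk.comp measurable_prodMk_left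
  have hsq : ∀ a : ℝ≥0∞, (a ^ (1 / 2 : ℝ)) ^ (2 : ℝ) = a := fun a => by
    rw [← ENNReal.rpow_mul]; norm_num
  have hcs : ∀ x, (∫⁻ y, k x y * G y ∂ν) ^ 2 ≤ C * ∫⁻ y, k x y * G y ^ 2 ∂ν := by
    intro x
    have h := ENNReal.lintegral_mul_le_Lp_mul_Lq ν Real.HolderConjugate.two_two
      ((hkx x).pow_const (1 / 2 : ℝ)).aemeasurable
      (((hkx x).pow_const (1 / 2 : ℝ)).mul hG).aemeasurable
    have e1 : ∀ y, ((fun y => k x y ^ (1 / 2 : ℝ)) *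
        ((fun y => k x y ^ (1 / 2 : ℝ)) * G)) y = k x y * G y := fun y => by
      simp only [Pi.mul_apply]
      rw [← mul_assoc, ← sq, ← ENNReal.rpow_natCast]
      push_cast
      rw [hsq]
    have e2 : ∀ y, (((fun y => k x y ^ (1 / 2 : ℝ)) * G) y) ^ (2 : ℝ) = k x y * G y ^ 2 :=
      fun y => by
        rw [Pi.mul_apply, ENNReal.mul_rpow_of_nonneg _ _ (by norm_num), hsq]
        norm_num
    simp only [e1, e2, hsq] at h
    calc (∫⁻ y, k x y * G y ∂ν) ^ 2
        ≤ ((∫⁻ y, k x y ∂ν) ^ (1 / 2 : ℝ) * (∫⁻ y, k x y * G y ^ 2 ∂ν) ^ (1 / 2 : ℝ)) ^ 2 := by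
          gcongr
      _ = (∫⁻ y, k x y ∂ν) * ∫⁻ y, k x y * G y ^ 2 ∂ν := by
          rw [mul_pow, ← ENNReal.rpow_natCast, ← ENNReal.rpow_natCast]
          push_cast
          rw [hsq, hsq]
      _ ≤ _ := by gcongr; exact h1 x
  calc ∫⁻ x, (∫⁻ y, k x y * G y ∂ν) ^ 2 ∂μ
      ≤ ∫⁻ x, C * ∫⁻ y, k x y * G y ^ 2 ∂ν ∂μ := lintegral_mono hcs
    _ = C * ∫⁻ y, ∫⁻ x, k x y * G y ^ 2 ∂μ ∂ν := by
        rw [lintegral_const_mul' _ _ hC]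
        congr 1
        exact lintegral_lintegral_swap
          (hk.mul ((hG.comp measurable_snd).pow_const 2)).aemeasurable
    _ ≤ C * ∫⁻ y, C * G y ^ 2 ∂ν := by
        gcongr with y
        have hky : Measurable fun x => k x y := hk.comp measurable_prodMk_right
        rw [lintegral_mul_const _ hky]
        gcongr
        exact h2 y
    _ = _ := by rw [lintegral_const_mul' _ _ hC]; ring

end Schur

/-! ### The Hardy norm in the half-space -/

section HardyHalfSpace

variable {n : ℕ}

lemma lintegral_comp_smul_sub {F : EuclideanSpace ℝ (Fin n) → ℝ≥0∞} (hF : Measurable F) {t : ℝ}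
    (ht : 0 < t) (z : EuclideanSpace ℝ (Fin n)) :
    ∫⁻ w, ENNReal.ofReal (t ^ n)⁻¹ * F (t⁻¹ • (z - w)) = ∫⁻ w, F w := by
  rw [lintegral_const_mul' _ _ ENNReal.ofReal_ne_top,
    lintegral_sub_left_eq_self (fun w => F (t⁻¹ • w)) z]
  have h : (∫⁻ w, F (t⁻¹ • w)) =
      ∫⁻ w, F w ∂((volume : Measure (EuclideanSpace ℝ (Fin n))).map (t⁻¹ • ·)) :=
    (lintegral_map hF (measurable_const_smul _)).symm
  rw [h, Measure.map_addHaar_smul _ (inv_ne_zero ht.ne'), lintegral_smul_measure,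
    finrank_euclideanSpace_fin, smul_eq_mul, ← mul_assoc, ← ENNReal.ofReal_mul (by positivity),
    inv_pow, inv_inv, abs_of_pos (by positivity), inv_mul_cancel₀ (by positivity)]
  simp

lemma exists_hardyNorm_solution_le_dirichletHalfSpace (n : ℕ) :
    ∃ C : ℝ≥0, ∀ g : BoundaryL2 n .dirichletHalfSpace,
      hardyNorm n .dirichletHalfSpace (solution g) ≤ C * ‖g‖ₑ := by
  set K : ℝ≥0∞ := ∫⁻ w : EuclideanSpace ℝ (Fin n), ENNReal.ofReal (poissonProfile w) with hK
  have hKtop : K ≠ ∞ := integrable_poissonProfile.lintegral_lt_top.ne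
  have hmeas : Measurable fun w : EuclideanSpace ℝ (Fin n) => ENNReal.ofReal (poissonProfile w) :=
    continuous_poissonProfile.measurable.ennreal_ofReal
  refine ⟨K.toNNReal, fun g => ?_⟩
  rw [ENNReal.coe_toNNReal hKtop]
  refine iSup₂_le fun t ht => ?_
  have ht : 0 < t := ht
  have hG : Measurable fun w : EuclideanSpace ℝ (Fin n) => ‖g (point 0 w)‖ₑ :=
    ((Lp.stronglyMeasurable g).measurable.comp (continuous_point 0).measurable).enorm
  set k : EuclideanSpace ℝ (Fin n) → EuclideanSpace ℝ (Fin n) → ℝ≥0∞ := fun z w =>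
    ENNReal.ofReal (t ^ n)⁻¹ * ENNReal.ofReal (poissonProfile (t⁻¹ • (z - w))) with hk
  have hsymm : ∀ z w, k z w = k w z := fun z w => by
    simp only [hk, poissonProfile, norm_smul, norm_sub_rev z w]
  have hschur := lintegral_lintegral_mul_sq_le (μ := volume) (ν := volume) (k := k) hKtop
    (by
      have : Continuous fun x : EuclideanSpace ℝ (Fin n) × EuclideanSpace ℝ (Fin n) =>
        poissonProfile (t⁻¹ • (x.1 - x.2)) := continuous_poissonProfile.comp (by fun_prop)
      exact this.measurable.ennreal_ofReal.const_mul _)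
    (fun z => (lintegral_comp_smul_sub hmeas ht z).le)
    (fun w => by
      simp only [hsymm _ w]
      exact (lintegral_comp_smul_sub hmeas ht w).le) hG
  have hu : ∀ z, ‖solution g (point t z)‖ₑ ≤ ∫⁻ w, k z w * ‖g (point 0 w)‖ₑ := by
    intro z
    rw [solution]
    refine (enorm_integral_le_lintegral_enorm _).trans ?_
    change ∫⁻ y, _ ∂(planeMeasure n) ≤ _
    rw [lintegral_planeMeasure]
    refine lintegral_mono fun w => ?_
    have := poissonProfile_pos (t⁻¹ • (z - w))
    rw [kernel_dirichletHalfSpace_point ht, enorm_mul, Real.enorm_of_nonneg (by positivity),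
      ENNReal.ofReal_mul (by positivity)]
  rw [eLpNorm_eq_lintegral_rpow_enorm_toReal (by norm_num) (by norm_num), lintegral_planeMeasure]
  simp only [point_add, zero_add, add_zero, ENNReal.toReal_ofNat, ENNReal.rpow_ofNat]
  calc (∫⁻ z, ‖solution g (point t z)‖ₑ ^ 2) ^ (1 / 2 : ℝ)
      ≤ (K ^ 2 * ‖g‖ₑ ^ 2) ^ (1 / 2 : ℝ) := by
        refine ENNReal.rpow_le_rpow ?_ (by norm_num)
        rw [enorm_boundaryL2_sq]
        change _ ≤ _ * ∫⁻ y, _ ∂(planeMeasure n)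
        rw [lintegral_planeMeasure]
        exact (lintegral_mono fun z => pow_le_pow_left₀ zero_le (hu z) 2).trans hschur
    _ = K * ‖g‖ₑ := by
        rw [← mul_pow, ← ENNReal.rpow_natCast, ← ENNReal.rpow_mul]
        norm_num

end HardyHalfSpace

/-! ### Totality of the kernels in the half-space -/

section TotalityHalfSpace

variable {n : ℕ}

local notation "V" => EuclideanSpace ℝ (Fin n)

open scoped ContDiff

/-- If all convolutions of `g` with the dilates of an integrable function of nonvanishing integral
vanish, then `g` vanishes: these convolutions approximate a multiple of `g` in the sense of
distributions. -/
lemma ae_eq_zero_of_forall_integral_dilate {φ g : V → ℝ} (hφ : Integrable φ)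
    (hφ0 : ∫ u, φ u ≠ 0) (hgm : StronglyMeasurable g) (hg : MemLp g 2 volume)
    (h : ∀ s : ℝ, 0 < s → ∀ z, ∫ w, φ (s⁻¹ • (z - w)) * g w = 0) : g =ᵐ[volume] 0 := by
  have hloc : LocallyIntegrable g := hg.locallyIntegrable (by norm_num)
  refine ae_eq_zero_of_integral_contDiff_smul_eq_zero hloc fun ψ hψ hψc => ?_
  have hψL : MemLp ψ 2 (volume : Measure V) := hψ.continuous.memLp_of_hasCompactSupport hψc
  -- the correlation of `ψ` and `g`, a bounded continuous function
  set G : V → ℝ := fun z => ∫ w, ψ (w - z) * g w with hG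
  have hGc : Continuous G := by
    have hψn : HasCompactSupport fun x => ψ (-x) := hψc.comp_homeomorph (Homeomorph.neg V)
    convert HasCompactSupport.continuous_convolution_right (ContinuousLinearMap.mul ℝ ℝ) hψn hloc
      (hψ.continuous.comp continuous_neg) using 1
    funext z
    simp only [hG, convolution, ContinuousLinearMap.mul_apply', neg_sub, mul_comm]
  have hgt : ∀ z, MemLp (fun x => g (x - z)) 2 (volume : Measure V) := fun z =>
    hg.comp_measurePreserving (measurePreserving_sub_right volume z)
  have hint : ∀ z, Integrable fun x => ψ x * g (x - z) := fun z => hψL.integrable_mul (hgt z)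
  have hGt : ∀ z, G (-z) = ∫ x, ψ x * g (x - z) := fun z => by
    simpa [hG] using (integral_sub_right_eq_self (fun w => ψ (w + z) * g w) z).symm
  set B : ℝ := ∫ x, (ψ x ^ 2 + g x ^ 2) with hB
  have habs : ∀ z, ∫ x, ‖ψ x * g (x - z)‖ ≤ B := by
    intro z
    have hi : Integrable fun x => g (x - z) ^ 2 := (hgt z).integrable_sq
    rw [hB, integral_add hψL.integrable_sq hg.integrable_sq,
      ← integral_sub_right_eq_self (fun x => g x ^ 2) z, ← integral_add hψL.integrable_sq hi]
    refine integral_mono (hint z).norm (hψL.integrable_sq.add hi) fun x => ?_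
    rw [Real.norm_eq_abs, abs_le]
    constructor <;> nlinarith [sq_nonneg (ψ x - g (x - z)), sq_nonneg (ψ x + g (x - z)),
      sq_nonneg (ψ x), sq_nonneg (g (x - z))]
  have hGB : ∀ z, ‖G z‖ ≤ B := fun z => by
    rw [← neg_neg z, hGt]
    exact (norm_integral_le_integral_norm _).trans (habs _)
  have hz : ∀ s : ℝ, 0 < s → ∫ u, φ u * G (-(s • u)) = 0 := by
    intro s hs
    have hm : AEStronglyMeasurable (Function.uncurry fun u x => φ u * (ψ x * g (x - s • u)))
        ((volume : Measure V).prod volume) := by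
      refine (hφ.aestronglyMeasurable.comp_fst).mul
        ((hψ.continuous.comp continuous_snd).aestronglyMeasurable.mul ?_)
      have hc : Continuous fun p : V × V => p.2 - s • p.1 := by fun_prop
      exact (hgm.comp_measurable hc.measurable).aestronglyMeasurable
    have hprod : Integrable (Function.uncurry fun u x => φ u * (ψ x * g (x - s • u)))
        ((volume : Measure V).prod volume) := by
      rw [integrable_prod_iff hm]
      refine ⟨Eventually.of_forall fun u => (hint (s • u)).const_mul (φ u), ?_⟩
      refine (hφ.norm.mul_const B).mono hm.norm.integral_prod_right'
        (Eventually.of_forall fun u => ?_)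
      simp only [Function.uncurry_apply_pair, norm_mul (φ u), integral_const_mul]
      rw [norm_mul, norm_mul, norm_norm,
        Real.norm_of_nonneg (integral_nonneg fun _ => norm_nonneg _)]
      exact mul_le_mul_of_nonneg_left ((habs _).trans (le_abs_self B)) (norm_nonneg _)
    simp only [hGt, ← integral_const_mul]
    rw [integral_integral_swap hprod]
    refine integral_eq_zero_of_ae (Eventually.of_forall fun x => ?_)
    have h1 : ∫ u, φ u * g (x - s • u) = 0 := by
      have h2 := h s hs x
      rw [← integral_sub_left_eq_self _ _ x] at h2
      simp only [sub_sub_cancel] at h2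
      have h3 := Measure.integral_comp_smul (volume : Measure V)
        (fun w => φ (s⁻¹ • w) * g (x - w)) s
      simpa [h2, inv_smul_smul₀ hs.ne'] using h3
    calc ∫ u, φ u * (ψ x * g (x - s • u)) = ∫ u, ψ x * (φ u * g (x - s • u)) := by
          congr 1; funext u; ring
      _ = 0 := by rw [integral_const_mul, h1, mul_zero]
  have hlim : Tendsto (fun s : ℝ => ∫ u, φ u * G (-(s • u))) (𝓝[>] 0) (𝓝 (∫ u, φ u * G 0)) := by
    refine tendsto_integral_filter_of_dominated_convergence (fun u => ‖φ u‖ * B)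
      (Eventually.of_forall fun s => ?_)
      (Eventually.of_forall fun s => Eventually.of_forall fun u => ?_)
      (hφ.norm.mul_const B) (Eventually.of_forall fun u => ?_)
    · exact hφ.aestronglyMeasurable.mul (hGc.comp (by fun_prop)).aestronglyMeasurable
    · rw [norm_mul]
      exact mul_le_mul_of_nonneg_left (hGB _) (norm_nonneg _)
    · have hc : Continuous fun s : ℝ => φ u * G (-(s • u)) :=
        continuous_const.mul (hGc.comp (by fun_prop))
      have := (hc.tendsto 0).mono_left (nhdsWithin_le_nhds (s := Set.Ioi 0))
      simpa using this
  have h0 : ∫ u, φ u * G 0 = 0 := by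
    refine tendsto_nhds_unique hlim ((tendsto_congr' ?_).2 tendsto_const_nhds)
    filter_upwards [self_mem_nhdsWithin] with s hs using hz s hs
  rw [integral_mul_const, mul_eq_zero] at h0
  simpa [hG] using h0.resolve_left hφ0

lemma memLp_comp_point {g : Space n → ℝ} (hg : MemLp g 2 (planeMeasure n)) :
    MemLp (fun w => g (point 0 w)) 2 volume :=
  (measurableEmbedding_point 0).memLp_map_measure_iff.1 hg

lemma eq_zero_of_solution_eq_zero_dirichletHalfSpace (g : BoundaryL2 n .dirichletHalfSpace)
    (h : ∀ x ∈ domain n .dirichletHalfSpace, solution g x = 0) : g = 0 := by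
  have hpos : 0 < ∫ w : V, poissonProfile w :=
    (integral_pos_iff_support_of_nonneg (fun w => (poissonProfile_pos w).le)
      integrable_poissonProfile).2 (by
        rw [Set.eq_univ_of_forall (s := Function.support _) fun w => (poissonProfile_pos w).ne']
        simp [NeZero.pos])
  have h1 := ae_eq_zero_of_forall_integral_dilate integrable_poissonProfile hpos.ne'
    ((Lp.stronglyMeasurable g).comp_measurable (continuous_point 0).measurable)
    (memLp_comp_point (Lp.memLp g)) fun s hs z => by
      have h2 := h (point s z) hs
      rw [solution] at h2
      change ∫ y, _ ∂(planeMeasure n) = 0 at h2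
      simp only [integral_planeMeasure, kernel_dirichletHalfSpace_point hs, mul_assoc,
        integral_const_mul] at h2
      exact (mul_eq_zero.1 h2).resolve_left (by positivity)
  refine Lp.eq_zero_iff_ae_eq_zero.2 ?_
  exact (measurableEmbedding_point 0).ae_map_iff.2 h1

lemma eq_zero_of_solution_eq_zero_heatCauchy {α : ℝ≥0} (g : BoundaryL2 n (.heatCauchy α))
    (h : ∀ x ∈ domain n (.heatCauchy α), solution g x = 0) : g = 0 := by
  have hint : Integrable fun w : V => Real.exp (-(1 / 4) * ‖w‖ ^ 2) := by
    simpa using integrable_exp_neg_mul_norm_sub_sq (0 : V) (b := 1 / 4) (by norm_num)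
  have hpos : 0 < ∫ w : V, Real.exp (-(1 / 4) * ‖w‖ ^ 2) :=
    (integral_pos_iff_support_of_nonneg (fun w => (Real.exp_pos _).le) hint).2 (by
        rw [Set.eq_univ_of_forall (s := Function.support _) fun w => (Real.exp_pos _).ne']
        simp [NeZero.pos])
  have h1 := ae_eq_zero_of_forall_integral_dilate hint hpos.ne'
    ((Lp.stronglyMeasurable g).comp_measurable (continuous_point 0).measurable)
    (memLp_comp_point (Lp.memLp g)) fun s hs z => by
      have h2 := h (point (s ^ 2) z) (by exact pow_pos hs 2)
      rw [solution] at h2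
      change ∫ y, _ ∂(planeMeasure n) = 0 at h2
      simp only [integral_planeMeasure, kernel_heatCauchy_point, mul_assoc,
        integral_const_mul] at h2
      refine (integral_congr_ae (Eventually.of_forall fun w => ?_)).trans
        ((mul_eq_zero.1 h2).resolve_left (by positivity))
      simp only [norm_smul, norm_inv, Real.norm_of_nonneg hs.le, mul_pow]
      congr 2
      field_simp
  refine Lp.eq_zero_iff_ae_eq_zero.2 ?_
  exact (measurableEmbedding_point 0).ae_map_iff.2 h1

end TotalityHalfSpace

/-! ### The maximum principle for harmonic functions -/

section MaximumPrinciple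

lemma iteratedDeriv_two_nonpos_of_isLocalMax {G : ℝ → ℝ} {a : ℝ} (h : IsLocalMax G a)
    (hc : ContinuousAt G a) : iteratedDeriv 2 G a ≤ 0 := by
  rw [iteratedDeriv_succ, iteratedDeriv_one]
  by_contra! hpos
  -- otherwise `a` is also a local minimum, and `G` is constant near `a`
  have hmin : IsLocalMin G a := isLocalMin_of_deriv_deriv_pos hpos h.deriv_eq_zero hc
  have hconst : G =ᶠ[𝓝 a] fun _ => G a := by
    filter_upwards [h, hmin] with x h1 h2 using le_antisymm h1 h2
  have h0 : deriv (deriv G) a = 0 := by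
    rw [hconst.deriv.deriv_eq]
    simp
  exact hpos.ne' h0

/-- The weak maximum principle on balls, by perturbation of `u` to a function of positive
Laplacian. -/
lemma le_of_harmonicOnNhd_of_le_on_sphere {n : ℕ} {u : Space n → ℝ} {r M : ℝ}
    (hu : InnerProductSpace.HarmonicOnNhd u (Metric.closedBall 0 r))
    (h : ∀ x : Space n, ‖x‖ = r → u x ≤ M) {x : Space n} (hx : ‖x‖ ≤ r) : u x ≤ M := by
  have hr : 0 ≤ r := (norm_nonneg x).trans hx
  refine le_of_forall_pos_le_add fun ε hε => ?_
  obtain ⟨δ, hδ, hδε⟩ : ∃ δ > 0, δ * r ^ 2 ≤ ε := by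
    refine ⟨ε / (r ^ 2 + 1), by positivity, ?_⟩
    rw [div_mul_eq_mul_div, div_le_iff₀ (by positivity)]
    nlinarith
  set w : Space n → ℝ := fun x => u x + δ * ‖x‖ ^ 2 with hw
  have hwc : ContinuousOn w (Metric.closedBall 0 r) :=
    hu.continuousOn.add (by fun_prop)
  obtain ⟨x₀, hx₀, hmax⟩ := (isCompact_closedBall (0 : Space n) r).exists_isMaxOn
    ⟨x, mem_closedBall_zero_iff.2 hx⟩ hwc
  have hxw : u x ≤ w x₀ := by
    have h1 : w x ≤ w x₀ := hmax (mem_closedBall_zero_iff.2 hx)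
    have h2 : u x ≤ w x := le_add_of_nonneg_right (by positivity)
    exact h2.trans h1
  rcases (mem_closedBall_zero_iff.1 hx₀).eq_or_lt with hx₀r | hx₀r
  · have h1 := h x₀ hx₀r
    simp only [hw, hx₀r] at hxw
    linarith
  exfalso
  have hlocal : IsLocalMax w x₀ := hmax.isLocalMax
    (mem_of_superset (Metric.isOpen_ball.mem_nhds (mem_ball_zero_iff.2 hx₀r))
      Metric.ball_subset_closedBall)
  have hux : ContDiffAt ℝ 2 u x₀ := (hu x₀ hx₀).1
  set b := EuclideanSpace.basisFun (Fin (n + 1)) ℝ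
  have hsum : ∑ i, iteratedDeriv 2 (fun τ : ℝ => u (x₀ + τ • b i)) 0 = 0 := by
    rw [← laplacian_eq_sum_iteratedDeriv b hux]
    exact (hu x₀ hx₀).2.eq_of_nhds
  have hi : ∀ i, iteratedDeriv 2 (fun τ : ℝ => u (x₀ + τ • b i)) 0 ≤ -(2 * δ) := by
    intro i
    have hline : ContDiff ℝ 2 fun τ : ℝ => x₀ + τ • b i := by fun_prop
    have h0 : x₀ + (0 : ℝ) • b i = x₀ := by simp
    have hul : ContDiffAt ℝ 2 (fun τ : ℝ => u (x₀ + τ • b i)) 0 := by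
      refine ContDiffAt.comp (g := u) (0 : ℝ) ?_ hline.contDiffAt
      rwa [h0]
    have hq : ∀ τ : ℝ, δ * ‖x₀ + τ • b i‖ ^ 2 =
        δ * ‖x₀‖ ^ 2 + 2 * δ * inner ℝ x₀ (b i) * τ + δ * τ ^ 2 := fun τ => by
      rw [norm_add_sq_real, inner_smul_right, norm_smul, mul_pow, b.norm_eq_one,
        Real.norm_eq_abs, sq_abs]
      ring
    have hder : iteratedDeriv 2 (fun τ : ℝ => δ * ‖x₀ + τ • b i‖ ^ 2) 0 = 2 * δ := by
      simp only [hq]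
      rw [iteratedDeriv_succ, iteratedDeriv_one]
      have h1 : deriv (fun τ : ℝ => δ * ‖x₀‖ ^ 2 + 2 * δ * inner ℝ x₀ (b i) * τ + δ * τ ^ 2) =
          fun τ => 2 * δ * inner ℝ x₀ (b i) + 2 * δ * τ := by
        funext τ
        refine HasDerivAt.deriv ?_
        refine ((((hasDerivAt_id τ).const_mul (2 * δ * inner ℝ x₀ (b i))).const_add _).add
          (((hasDerivAt_id τ).pow 2).const_mul δ)).congr_deriv ?_
        simp
        ring
      rw [h1]
      refine HasDerivAt.deriv ?_
      simpa using ((hasDerivAt_id (0 : ℝ)).const_mul (2 * δ)).const_add (2 * δ * inner ℝ x₀ (b i))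
    have hql : ContDiffAt ℝ 2 (fun τ : ℝ => δ * ‖x₀ + τ • b i‖ ^ 2) 0 :=
      (contDiff_const.mul (hline.norm_sq ℝ)).contDiffAt
    have hadd : iteratedDeriv 2 (fun τ : ℝ => w (x₀ + τ • b i)) 0 =
        iteratedDeriv 2 (fun τ : ℝ => u (x₀ + τ • b i)) 0 + 2 * δ := by
      rw [← hder]
      exact iteratedDeriv_add hul hql
    have hlm : IsLocalMax (fun τ : ℝ => w (x₀ + τ • b i)) 0 := by
      have ht : Tendsto (fun τ : ℝ => x₀ + τ • b i) (𝓝 0) (𝓝 x₀) := by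
        simpa using hline.continuous.tendsto 0
      have := ht.eventually hlocal
      simpa [IsLocalMax, IsMaxFilter] using this
    have := iteratedDeriv_two_nonpos_of_isLocalMax hlm (hul.continuousAt.add hql.continuousAt)
    linarith
  have h1 := Finset.sum_le_sum fun i (_ : i ∈ Finset.univ) => hi i
  rw [hsum, Finset.sum_const, Finset.card_univ, Fintype.card_fin, nsmul_eq_mul] at h1
  have h2 : (0 : ℝ) < ((n + 1 : ℕ) : ℝ) * (2 * δ) := by positivity
  linarith

end MaximumPrinciple

/-! ### The Poisson integral in the ball -/

section PoissonBall

variable {n : ℕ}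

open scoped Pointwise in
lemma measurePreserving_sphereMeasure (e : Space n ≃ₗᵢ[ℝ] Space n) :
    MeasurePreserving e (sphereMeasure n) (sphereMeasure n) := by
  have happly : ∀ s : Set (Space n), MeasurableSet s → sphereMeasure n s =
      ((volume : Measure (Space n)).toSphere Set.univ)⁻¹ * (Module.finrank ℝ (Space n) *
        volume (Set.Ioo (0 : ℝ) 1 • (s ∩ Metric.sphere (0 : Space n) 1))) := by
    intro s hs
    rw [sphereMeasure, Measure.map_apply measurable_subtype_coe hs, Measure.smul_apply,
      Measure.toSphere_apply' _ (measurable_subtype_coe hs), smul_eq_mul,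
      Subtype.image_preimage_coe, Set.inter_comm]
  refine ⟨e.continuous.measurable, Measure.ext fun s hs => ?_⟩
  rw [Measure.map_apply e.continuous.measurable hs, happly _ hs,
    happly _ (e.continuous.measurable hs)]
  congr 2
  have hset : Set.Ioo (0 : ℝ) 1 • (e ⁻¹' s ∩ Metric.sphere (0 : Space n) 1) =
      e ⁻¹' (Set.Ioo (0 : ℝ) 1 • (s ∩ Metric.sphere (0 : Space n) 1)) := by
    ext x
    simp only [Set.mem_smul, Set.mem_preimage, Set.mem_inter_iff, mem_sphere_zero_iff_norm]
    constructor
    · rintro ⟨t, ht, y, ⟨hy, hy1⟩, rfl⟩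
      exact ⟨t, ht, e y, ⟨hy, by rwa [e.norm_map]⟩, by rw [map_smul]⟩
    · rintro ⟨t, ht, y, ⟨hy, hy1⟩, hxy⟩
      refine ⟨t, ht, e.symm y, ⟨by rwa [e.apply_symm_apply], by rwa [e.symm.norm_map]⟩, ?_⟩
      rw [← map_smul, hxy, e.symm_apply_apply]
  rw [hset]
  exact e.measurePreserving.measure_preimage_emb e.toMeasurableEquiv.measurableEmbedding _

/-- The Poisson kernel of the ball has integral `1`: the Poisson integral of the constant `1` is
harmonic and rotation invariant, hence constant by the maximum principle. -/
lemma integral_kernel_dirichletBall {x : Space n} (hx : ‖x‖ < 1) :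
    ∫ y, kernel n .dirichletBall x y ∂(sphereMeasure n) = 1 := by
  set I : Space n → ℝ := fun x => ∫ y, kernel n .dirichletBall x y ∂(sphereMeasure n) with hI
  have hharm : InnerProductSpace.HarmonicOnNhd I (Metric.ball 0 1) := by
    simpa [hI] using harmonicOnNhd_integral_kernel_dirichletBall (n := n)
      (memLp_const (1 : ℝ) (p := 2) (μ := sphereMeasure n))
  have hrad : ∀ x z : Space n, ‖x‖ = ‖z‖ → I x = I z := by
    intro x z hxz
    set e : Space n ≃ₗᵢ[ℝ] Space n := (Submodule.span ℝ {x - z})ᗮ.reflection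
    have he : e x = z := Submodule.reflection_sub hxz
    rw [← he, hI]
    have h := (measurePreserving_sphereMeasure e).integral_comp
      e.toMeasurableEquiv.measurableEmbedding (fun y => kernel n .dirichletBall (e x) y)
    change _ = ∫ y, kernel n .dirichletBall (e x) y ∂(sphereMeasure n)
    rw [← h]
    simp only [kernel_dirichletBall, e.norm_map, ← map_sub]
  have h0 : I 0 = 1 := by
    rw [hI, sphereMeasure_eq_map]
    simp only [measurableEmbedding_sphere_val.integral_map, kernel_dirichletBall]
    simp
  have hsub : Metric.closedBall (0 : Space n) ‖x‖ ⊆ Metric.ball 0 1 := fun y hy =>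
    mem_ball_zero_iff.2 ((mem_closedBall_zero_iff.1 hy).trans_lt hx)
  have h1 : I 0 ≤ I x := le_of_harmonicOnNhd_of_le_on_sphere (hharm.mono hsub)
    (fun z hz => (hrad z x hz).le) (by simp)
  have h2 : -I 0 ≤ -I x := le_of_harmonicOnNhd_of_le_on_sphere (u := -I) (hharm.mono hsub).neg
    (fun z hz => (neg_le_neg (hrad z x hz).ge)) (by simp)
  linarith

end PoissonBall

/-! ### The Hardy norm in the ball and totality of the kernels -/

section HardyBall

variable {n : ℕ}

local notation "𝕊" => Metric.sphere (0 : Space n) 1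

/-- The Poisson kernel `P(r s, y)` of the ball, for unit vectors `s` and `y`. -/
def ballProfile (r : ℝ) (s y : Metric.sphere (0 : Space n) 1) : ℝ :=
  kernel n .dirichletBall (r • (s : Space n)) y

lemma norm_smul_sphere {r : ℝ} (hr : 0 < r) (s : 𝕊) : ‖r • (s : Space n)‖ = r := by
  rw [norm_smul, mem_sphere_zero_iff_norm.1 s.2, mul_one, Real.norm_of_nonneg hr.le]

lemma ballProfile_comm {r : ℝ} (s y : 𝕊) : ballProfile r s y = ballProfile r y s := by
  have hs := mem_sphere_zero_iff_norm.1 s.2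
  have hy := mem_sphere_zero_iff_norm.1 y.2
  have h : ‖r • (s : Space n) - y‖ = ‖r • (y : Space n) - s‖ := by
    rw [← sq_eq_sq₀ (norm_nonneg _) (norm_nonneg _), norm_sub_sq_real, norm_sub_sq_real,
      norm_smul, norm_smul, hs, hy, real_inner_smul_left, real_inner_smul_left, real_inner_comm]
  rw [ballProfile, ballProfile, kernel_dirichletBall, kernel_dirichletBall, h, norm_smul,
    norm_smul, hs, hy]

lemma continuous_ballProfile {r : ℝ} (hr : r ∈ Set.Ioo (0 : ℝ) 1) :
    Continuous (Function.uncurry (ballProfile (n := n) r)) := by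
  change Continuous fun x : 𝕊 × 𝕊 =>
    (1 - ‖r • (x.1 : Space n)‖ ^ 2) / ‖r • (x.1 : Space n) - x.2‖ ^ (n + 1)
  refine Continuous.div (by fun_prop) (by fun_prop) fun x => ?_
  have := one_sub_norm_le_norm_sub (r • (x.1 : Space n)) x.2
  rw [norm_smul_sphere hr.1] at this
  have := hr.2
  exact pow_ne_zero _ (by linarith)

lemma continuous_ballProfile_right {r : ℝ} (hr : r ∈ Set.Ioo (0 : ℝ) 1) (s : 𝕊) :
    Continuous fun y => ballProfile r s y :=
  (continuous_ballProfile hr).uncurry_left s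

lemma ballProfile_nonneg {r : ℝ} (hr : r ∈ Set.Ioo (0 : ℝ) 1) (s y : 𝕊) :
    0 ≤ ballProfile r s y := by
  rw [ballProfile, kernel_dirichletBall, norm_smul_sphere hr.1]
  have : 0 ≤ 1 - r ^ 2 := by nlinarith [hr.1, hr.2]
  positivity

lemma integral_ballProfile {r : ℝ} (hr : r ∈ Set.Ioo (0 : ℝ) 1) (s : 𝕊) :
    ∫ y, ballProfile r s y ∂(unitSphereMeasure n) = 1 := by
  have h := integral_kernel_dirichletBall (x := r • (s : Space n))
    (by rw [norm_smul_sphere hr.1]; exact hr.2)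
  rwa [sphereMeasure_eq_map, measurableEmbedding_sphere_val.integral_map] at h

lemma integrable_of_continuous_sphere {f : 𝕊 → ℝ} (hf : Continuous f) :
    Integrable f (unitSphereMeasure n) := by
  obtain ⟨B, hB⟩ := isCompact_univ.exists_bound_of_continuousOn hf.continuousOn
  exact Integrable.of_bound hf.aestronglyMeasurable B (Eventually.of_forall fun x => hB x trivial)

lemma lintegral_ballProfile {r : ℝ} (hr : r ∈ Set.Ioo (0 : ℝ) 1) (s : 𝕊) :
    ∫⁻ y, ENNReal.ofReal (ballProfile r s y) ∂(unitSphereMeasure n) = 1 := by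
  have h := ofReal_integral_eq_lintegral_ofReal
    (integrable_of_continuous_sphere (continuous_ballProfile_right hr s))
    (Eventually.of_forall fun y => ballProfile_nonneg hr s y)
  rw [← h, integral_ballProfile hr, ENNReal.ofReal_one]

lemma solution_dirichletBall_smul (g : BoundaryL2 n .dirichletBall) (r : ℝ) (s : 𝕊) :
    solution g (r • (s : Space n)) =
      ∫ y, ballProfile r s y * g (y : Space n) ∂(unitSphereMeasure n) := by
  rw [solution]
  change ∫ y, _ ∂(sphereMeasure n) = _
  rw [sphereMeasure_eq_map, measurableEmbedding_sphere_val.integral_map]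
  rfl

lemma hardyNorm_solution_le_dirichletBall (g : BoundaryL2 n .dirichletBall) :
    hardyNorm n .dirichletBall (solution g) ≤ ‖g‖ₑ := by
  refine iSup₂_le fun r hr => ?_
  have hG : Measurable fun y : 𝕊 => ‖g (y : Space n)‖ₑ :=
    ((Lp.stronglyMeasurable g).measurable.comp measurable_subtype_coe).enorm
  have hschur := lintegral_lintegral_mul_sq_le (μ := unitSphereMeasure n)
    (ν := unitSphereMeasure n) (k := fun s y => ENNReal.ofReal (ballProfile r s y))
    ENNReal.one_ne_top
    (continuous_ballProfile hr).measurable.ennreal_ofReal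
    (fun s => (lintegral_ballProfile hr s).le)
    (fun y => by
      simp only [ballProfile_comm _ y]
      exact (lintegral_ballProfile hr y).le) hG
  have hu : ∀ s : 𝕊, ‖solution g (r • (s : Space n))‖ₑ ≤
      ∫⁻ y, ENNReal.ofReal (ballProfile r s y) * ‖g (y : Space n)‖ₑ ∂(unitSphereMeasure n) := by
    intro s
    rw [solution_dirichletBall_smul]
    refine (enorm_integral_le_lintegral_enorm _).trans (lintegral_mono fun y => ?_)
    rw [enorm_mul, Real.enorm_of_nonneg (ballProfile_nonneg hr s y)]
  rw [eLpNorm_eq_lintegral_rpow_enorm_toReal (by norm_num) (by norm_num), enorm_boundaryL2]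
  change _ ≤ (∫⁻ y, ‖g y‖ₑ ^ 2 ∂(sphereMeasure n)) ^ (1 / 2 : ℝ)
  rw [sphereMeasure_eq_map, measurableEmbedding_sphere_val.lintegral_map,
    measurableEmbedding_sphere_val.lintegral_map]
  simp only [ENNReal.toReal_ofNat, ENNReal.rpow_ofNat]
  refine ENNReal.rpow_le_rpow ?_ (by norm_num)
  rw [one_pow, one_mul] at hschur
  exact (lintegral_mono fun s => pow_le_pow_left₀ zero_le (hu s) 2).trans hschur

/-- The Poisson kernels `P(r s, ·)` form an approximate identity as `r → 1`. -/
lemma tendsto_integral_ballProfile_mul {φ : 𝕊 → ℝ} (hφ : Continuous φ) (s : 𝕊) :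
    Tendsto (fun r => ∫ y, ballProfile r s y * φ y ∂(unitSphereMeasure n)) (𝓝[<] 1)
      (𝓝 (φ s)) := by
  have hev : ∀ᶠ r : ℝ in 𝓝[<] 1, r ∈ Set.Ioo (0 : ℝ) 1 := Ioo_mem_nhdsLT zero_lt_one
  refine tendsto_integral_peak_smul_of_integrable_of_tendsto (t := Set.univ) (x₀ := s)
    MeasurableSet.univ univ_mem (measure_ne_top _ _) ?_ ?_ ?_ ?_
    (integrable_of_continuous_sphere hφ) (hφ.tendsto s)
  · filter_upwards [hev] with r hr y using ballProfile_nonneg hr s y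
  · intro u hu hsu
    obtain ⟨δ, hδ, hball⟩ := Metric.isOpen_iff.1 hu s hsu
    rw [Metric.tendstoUniformlyOn_iff]
    intro ε hε
    have hlim : Tendsto (fun r : ℝ => (1 - r ^ 2) / (δ / 2) ^ (n + 1)) (𝓝[<] 1) (𝓝 0) := by
      have hc : Continuous fun r : ℝ => (1 - r ^ 2) / (δ / 2) ^ (n + 1) := by fun_prop
      have := (hc.tendsto 1).mono_left (nhdsWithin_le_nhds (s := Set.Iio 1))
      simpa using this
    have hnear : ∀ᶠ r : ℝ in 𝓝[<] 1, 1 - δ / 2 < r :=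
      nhdsWithin_le_nhds (Ioi_mem_nhds (by linarith))
    filter_upwards [hev, hnear, hlim.eventually (gt_mem_nhds hε)] with r hr hr' hε' y hy
    have hsy : δ ≤ ‖(s : Space n) - y‖ := by
      by_contra! hlt
      refine hy (hball ?_)
      rwa [Metric.mem_ball, dist_comm, Subtype.dist_eq, dist_eq_norm]
    have hfar : δ / 2 ≤ ‖r • (s : Space n) - y‖ := by
      have h1 : ‖(s : Space n) - r • (s : Space n)‖ = 1 - r := by
        rw [show (s : Space n) - r • (s : Space n) = (1 - r) • (s : Space n) by
          rw [sub_smul, one_smul], norm_smul, mem_sphere_zero_iff_norm.1 s.2, mul_one,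
          Real.norm_of_nonneg (by linarith [hr.2])]
      have h2 := norm_sub_le_norm_sub_add_norm_sub (s : Space n) (r • (s : Space n)) y
      linarith
    rw [Pi.zero_apply, dist_zero_left, Real.norm_of_nonneg (ballProfile_nonneg hr s y)]
    refine lt_of_le_of_lt ?_ hε'
    have : 0 ≤ 1 - r ^ 2 := by nlinarith [hr.1, hr.2]
    rw [ballProfile, kernel_dirichletBall, norm_smul_sphere hr.1]
    gcongr
  · refine (tendsto_congr' ?_).2 tendsto_const_nhds
    filter_upwards [hev] with r hr
    rw [setIntegral_univ, integral_ballProfile hr]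
  · filter_upwards [hev] with r hr
    exact (continuous_ballProfile_right hr s).aestronglyMeasurable

lemma eq_zero_of_solution_eq_zero_dirichletBall (g : BoundaryL2 n .dirichletBall)
    (h : ∀ x ∈ domain n .dirichletBall, solution g x = 0) : g = 0 := by
  have hgL : MemLp (fun x => g x) 2 (sphereMeasure n) := Lp.memLp g
  have hgi : Integrable (fun x => g x) (sphereMeasure n) := hgL.integrable (by norm_num)
  have hgs : Integrable (fun y : 𝕊 => g (y : Space n)) (unitSphereMeasure n) :=
    measurableEmbedding_sphere_val.integrable_map_iff.1 hgi
  refine Lp.eq_zero_iff_ae_eq_zero.2 ?_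
  refine ae_eq_zero_of_integral_contDiff_smul_eq_zero (μ := sphereMeasure n)
    hgi.locallyIntegrable fun φ hφ _ => ?_
  rw [sphereMeasure_eq_map, measurableEmbedding_sphere_val.integral_map]
  have hφc : Continuous fun y : 𝕊 => φ y := hφ.continuous.comp continuous_subtype_val
  obtain ⟨B, hB⟩ := isCompact_univ.exists_bound_of_continuousOn hφc.continuousOn
  have hev : ∀ᶠ r : ℝ in 𝓝[<] 1, r ∈ Set.Ioo (0 : ℝ) 1 := Ioo_mem_nhdsLT zero_lt_one
  -- the Poisson operator is symmetric, so that the Poisson integral of `φ` is orthogonal to `g`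
  have hzero : ∀ r ∈ Set.Ioo (0 : ℝ) 1, ∫ y : 𝕊,
      (∫ s : 𝕊, ballProfile r y s * φ s ∂(unitSphereMeasure n)) * g (y : Space n)
        ∂(unitSphereMeasure n) = 0 := by
    intro r hr
    have hint : Integrable
        (Function.uncurry fun (y s : 𝕊) => ballProfile r y s * φ s * g (y : Space n))
        ((unitSphereMeasure n).prod (unitSphereMeasure n)) := by
      have hc : Continuous fun x : 𝕊 × 𝕊 => ballProfile r x.1 x.2 * φ x.2 :=
        (continuous_ballProfile hr).mul (hφc.comp continuous_snd)
      obtain ⟨A, hA⟩ := isCompact_univ.exists_bound_of_continuousOn hc.continuousOn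
      exact (hgs.comp_fst _).bdd_mul hc.aestronglyMeasurable (c := A)
        (Eventually.of_forall fun x => hA x trivial)
    simp only [← integral_mul_const]
    rw [integral_integral_swap hint]
    refine integral_eq_zero_of_ae (Eventually.of_forall fun s => ?_)
    have h1 := h (r • (s : Space n)) (mem_ball_zero_iff.2 (by
      rw [norm_smul_sphere hr.1]
      exact hr.2))
    rw [solution_dirichletBall_smul] at h1
    calc ∫ y : 𝕊, ballProfile r y s * φ s * g (y : Space n) ∂(unitSphereMeasure n)
        = ∫ y : 𝕊, φ s * (ballProfile r s y * g (y : Space n)) ∂(unitSphereMeasure n) := by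
          refine integral_congr_ae (Eventually.of_forall fun y => ?_)
          simp only [ballProfile_comm y s]
          ring
      _ = 0 := by rw [integral_const_mul, h1, mul_zero]
  refine tendsto_nhds_unique (f := fun r : ℝ => ∫ y : 𝕊,
      (∫ s : 𝕊, ballProfile r y s * φ s ∂(unitSphereMeasure n)) * g (y : Space n)
        ∂(unitSphereMeasure n)) (l := 𝓝[<] 1) ?_
    ((tendsto_congr' (hev.mono hzero)).2 tendsto_const_nhds)
  refine tendsto_integral_filter_of_dominated_convergence (fun y => B * ‖g (y : Space n)‖) ?_ ?_
    (hgs.norm.const_mul B)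
    (Eventually.of_forall fun y => (tendsto_integral_ballProfile_mul hφc y).mul_const _)
  · filter_upwards [hev] with r hr
    refine AEStronglyMeasurable.mul ?_ hgs.aestronglyMeasurable
    exact ((continuous_ballProfile hr).mul
      (hφc.comp continuous_snd)).aestronglyMeasurable.integral_prod_right'
  · filter_upwards [hev] with r hr
    refine Eventually.of_forall fun y => ?_
    rw [norm_mul]
    refine mul_le_mul_of_nonneg_right ?_ (norm_nonneg _)
    calc ‖∫ s : 𝕊, ballProfile r y s * φ s ∂(unitSphereMeasure n)‖
        ≤ ∫ s : 𝕊, ballProfile r y s * B ∂(unitSphereMeasure n) := by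
          refine norm_integral_le_of_norm_le
            ((integrable_of_continuous_sphere (continuous_ballProfile_right hr y)).mul_const B)
            (Eventually.of_forall fun s => ?_)
          rw [norm_mul, Real.norm_of_nonneg (ballProfile_nonneg hr y s)]
          exact mul_le_mul_of_nonneg_left (hB s trivial) (ballProfile_nonneg hr y s)
      _ = B := by rw [integral_mul_const, integral_ballProfile hr, one_mul]

end HardyBall

/-! ### The three problems together -/

variable {n : ℕ} {p : Problem}

lemma memLp_kernel {q : Space n} (hq : q ∈ domain n p) :
    MemLp (kernel n p q) 2 (boundaryMeasure n p) := by
  cases p with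
  | dirichletBall => exact memLp_kernel_dirichletBall (mem_ball_zero_iff.1 hq)
  | dirichletHalfSpace => exact memLp_kernel_dirichletHalfSpace hq
  | heatCauchy α => exact memLp_kernel_heatCauchy α hq

/-- The kernels are total in `L²(∂D)`. -/
lemma eq_zero_of_solution_eq_zero (g : BoundaryL2 n p)
    (h : ∀ x ∈ domain n p, solution g x = 0) : g = 0 := by
  cases p with
  | dirichletBall => exact eq_zero_of_solution_eq_zero_dirichletBall g h
  | dirichletHalfSpace => exact eq_zero_of_solution_eq_zero_dirichletHalfSpace g h
  | heatCauchy α => exact eq_zero_of_solution_eq_zero_heatCauchy g h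

/-- Directional derivatives in the pole of the kernel commute with the pairing in `L²(∂D)`. -/
lemma iteratedDeriv_integral_kernel {h : Space n → ℝ} (hh : MemLp h 2 (boundaryMeasure n p))
    {q v : Space n} (hq : q ∈ domain n p) (hv : ‖v‖ = 1) (m : ℕ) :
    iteratedDeriv m (fun τ : ℝ => ∫ y, h y * kernel n p (q + τ • v) y ∂(boundaryMeasure n p)) 0 =
      ∫ y, h y * iteratedDeriv m (fun τ : ℝ => kernel n p (q + τ • v) y) 0
        ∂(boundaryMeasure n p) := by
  cases p with
  | dirichletBall =>
    exact iteratedDeriv_integral_kernel_dirichletBall hh (mem_ball_zero_iff.1 hq) v m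
  | dirichletHalfSpace => exact iteratedDeriv_integral_kernel_dirichletHalfSpace hh hq v m
  | heatCauchy α => exact iteratedDeriv_integral_kernel_heatCauchy α hh hq hv m

/-- The boundedness of the solution operator from `L²(∂D)` to `H²`. -/
lemma exists_hardyNorm_solution_le (n : ℕ) (p : Problem) : ∃ C : ℝ≥0, ∀ g : BoundaryL2 n p,
    hardyNorm n p (solution g) ≤ C * ‖g‖ₑ := by
  cases p with
  | dirichletBall => exact ⟨1, fun g => by simpa using hardyNorm_solution_le_dirichletBall g⟩
  | dirichletHalfSpace => exact exists_hardyNorm_solution_le_dirichletHalfSpace n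
  | heatCauchy α => exact exists_hardyNorm_solution_le_heatCauchy n α

lemma isSolutionIn_solution (g : BoundaryL2 n p) : IsSolutionIn n p (solution g) := by
  cases p with
  | dirichletBall =>
    have h : solution g =
        fun x => ∫ y, g y * kernel n .dirichletBall x y ∂(sphereMeasure n) :=
      funext fun x => integral_congr_ae (Eventually.of_forall fun y => mul_comm _ _)
    rw [h]
    exact harmonicOnNhd_integral_kernel_dirichletBall (Lp.memLp g)
  | dirichletHalfSpace =>
    have h : solution g =
        fun x => ∫ y, g y * kernel n .dirichletHalfSpace x y ∂(planeMeasure n) :=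
      funext fun x => integral_congr_ae (Eventually.of_forall fun y => mul_comm _ _)
    rw [h]
    exact harmonicOnNhd_integral_kernel_dirichletHalfSpace (Lp.memLp g)
  | heatCauchy α => exact ⟨g, fun _ _ => rfl⟩

lemma hardyNorm_congr {u w : Space n → ℝ} (h : ∀ x ∈ domain n p, u x = w x) :
    hardyNorm n p u = hardyNorm n p w := by
  cases p with
  | dirichletBall =>
    refine iSup_congr fun r => iSup_congr fun hr => eLpNorm_congr_ae ?_
    change ∀ᵐ s ∂(sphereMeasure n), _
    rw [sphereMeasure_eq_map, measurableEmbedding_sphere_val.ae_map_iff]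
    refine Eventually.of_forall fun s => h _ (mem_ball_zero_iff.2 ?_)
    rw [norm_smul_sphere hr.1]
    exact hr.2
  | dirichletHalfSpace =>
    refine iSup_congr fun t => iSup_congr fun ht => eLpNorm_congr_ae ?_
    change ∀ᵐ s ∂(planeMeasure n), _
    rw [planeMeasure, (measurableEmbedding_point 0).ae_map_iff]
    refine Eventually.of_forall fun w => h _ ?_
    have ht' : 0 < t := ht
    simpa [domain, point_add] using ht'
  | heatCauchy α =>
    simp only [hardyNorm]
    congr 1
    refine lintegral_congr fun y => ?_
    congr 1
    refine iSup_congr fun t => iSup_congr fun ht => iSup_congr fun z => iSup_congr fun _ => ?_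
    rw [h (point t z) ht]

lemma IsSolutionIn.congr {u w : Space n → ℝ} (hu : IsSolutionIn n p u)
    (h : ∀ x ∈ domain n p, w x = u x) : IsSolutionIn n p w := by
  cases p with
  | dirichletBall =>
    exact fun x hx => (InnerProductSpace.harmonicAt_congr_nhds
      (eventually_of_mem (Metric.isOpen_ball.mem_nhds hx) h)).2 (hu x hx)
  | dirichletHalfSpace =>
    exact fun x hx => (InnerProductSpace.harmonicAt_congr_nhds
      (eventually_of_mem (isOpen_halfSpace.mem_nhds hx) h)).2 (hu x hx)
  | heatCauchy α =>
    obtain ⟨g, hg⟩ := hu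
    exact ⟨g, fun x hx => (h x hx).trans (hg x hx)⟩

/-! ### The maximal selection principle -/

lemma toL2_eq_toLp {g : Space n → ℝ} (hg : MemLp g 2 (boundaryMeasure n p)) :
    toL2 (p := p) g = hg.toLp g := by
  rw [toL2, dif_pos hg]

/-- Testing against the dictionary element `K_x` evaluates the solution at `x`. -/
lemma inner_boundaryKernel {x : Space n} (hx : x ∈ domain n p) (g : BoundaryL2 n p) :
    inner ℝ g (boundaryKernel n p x) = solution g x := by
  rw [boundaryKernel, toL2_eq_toLp (memLp_kernel hx), L2.inner_def, solution]
  refine integral_congr_ae ?_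
  filter_upwards [(memLp_kernel hx).coeFn_toLp] with y hy
  rw [hy]
  rfl

lemma solution_sub {x : Space n} (hx : x ∈ domain n p) (g₁ g₂ : BoundaryL2 n p) :
    solution (g₁ - g₂) x = solution g₁ x - solution g₂ x := by
  simp only [← inner_boundaryKernel hx, inner_sub_left]

lemma solution_sum_smul {ι : Type*} {x : Space n} (hx : x ∈ domain n p) (s : Finset ι) (c : ι → ℝ)
    (g : ι → BoundaryL2 n p) :
    solution (∑ k ∈ s, c k • g k) x = ∑ k ∈ s, c k * solution (g k) x := by
  simp only [← inner_boundaryKernel hx, sum_inner, real_inner_smul_left]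

/-- The dictionary is total: an element of `L²(∂D)` orthogonal to every `K_x` has vanishing
solution. -/
lemma orthogonal_span_boundaryKernel (p : Problem) :
    (Submodule.span ℝ (boundaryKernel n p '' domain n p))ᗮ = ⊥ := by
  refine (Submodule.eq_bot_iff _).2 fun g hg => eq_zero_of_solution_eq_zero g fun x hx => ?_
  rw [← inner_boundaryKernel hx, real_inner_comm]
  exact (Submodule.mem_orthogonal _ _).1 hg _ (Submodule.subset_span ⟨x, hx, rfl⟩)

lemma span_orthoSystem (q v : ℕ → Space n) (k : ℕ) :
    Submodule.span ℝ (orthoSystem p q v '' Set.Iic k) =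
      Submodule.span ℝ (multipleKernel p q v '' Set.Iic k) := by
  have h : orthoSystem p q v =
      InnerProductSpace.gramSchmidtNormed ℝ (multipleKernel p q v) := rfl
  rw [h, InnerProductSpace.span_gramSchmidtNormed, InnerProductSpace.span_gramSchmidt_Iic]

lemma multipleKernel_eq_boundaryKernel {q v : ℕ → Space n} {k : ℕ} (h : ∀ j < k, q j ≠ q k) :
    multipleKernel p q v k = boundaryKernel n p (q k) := by
  have h0 : order q k = 0 := by
    simpa [order, Finset.filter_eq_empty_iff] using h
  simp [multipleKernel, boundaryKernel, h0]

lemma candidate_eq (q v : ℕ → Space n) (k : ℕ) (b : Space n) :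
    candidate p q v k b = (‖remainder (orthoSystem p q v) k (boundaryKernel n p b)‖)⁻¹ •
      remainder (orthoSystem p q v) k (boundaryKernel n p b) := rfl

variable {Ω : Type*} [MeasurableSpace Ω] {ℙ : Measure Ω} {f : Ω → BoundaryL2 n p}
  {q v : ℕ → Space n}

lemma IsMaximalSelection.orthonormal (hq : IsMaximalSelection p ℙ f q v) :
    Orthonormal ℝ (orthoSystem p q v) :=
  InnerProductSpace.gramSchmidtNormed_orthonormal hq.linearIndependent

/-- Convergence of the adaptive expansion in `L²(Ω, L²(∂D))`. At a point `b` that is never selected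
the remainders tend to zero against `K_b` by the selection principle; at a selected point they
eventually vanish against it, because `K_b` is then one of the multiple kernels. -/
lemma IsMaximalSelection.tendsto_remainder (hf : MemLp f 2 ℙ)
    (hq : IsMaximalSelection p ℙ f q v) :
    Tendsto (fun N => eLpNorm (fun ω => remainder (orthoSystem p q v) N (f ω)) 2 ℙ)
      atTop (𝓝 0) := by
  classical
  have hE := hq.orthonormal
  refine tendsto_eLpNorm_remainder hE (orthogonal_span_boundaryKernel p) hf ?_
  rintro _ ⟨b, hb, rfl⟩
  by_cases hex : ∃ j, q j = b
  · have hj := Nat.find_spec hex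
    set j := Nat.find hex with hjdef
    have hker : multipleKernel p q v j = boundaryKernel n p b := by
      rw [multipleKernel_eq_boundaryKernel, hj]
      intro i hi hqi
      exact Nat.find_min hex hi (hqi.trans hj)
    have hmem : boundaryKernel n p b ∈ Submodule.span ℝ (orthoSystem p q v '' Set.Iic j) := by
      rw [span_orthoSystem, ← hker]
      exact Submodule.subset_span ⟨j, Set.mem_Iic.2 le_rfl, rfl⟩
    refine tendsto_const_nhds.congr' ?_
    filter_upwards [eventually_gt_atTop j] with N hN
    have hzero : ∀ ω, inner ℝ (remainder (orthoSystem p q v) N (f ω)) (boundaryKernel n p b)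
        = 0 := by
      intro ω
      generalize boundaryKernel n p b = d at hmem
      induction hmem using Submodule.span_induction with
      | mem d hd =>
        obtain ⟨i, hi, rfl⟩ := hd
        exact inner_remainder_self_right hE (lt_of_le_of_lt hi hN) _
      | zero => exact inner_zero_right _
      | add x y _ _ hx hy => rw [inner_add_right, hx, hy, add_zero]
      | smul a x _ hx => rw [inner_smul_right, hx, mul_zero]
    simp [hzero]
  · have hle : ∀ k, ∫ ω, inner ℝ (remainder (orthoSystem p q v) k (f ω)) (boundaryKernel n p b) ^ 2
        ∂ℙ ≤ ‖boundaryKernel n p b‖ ^ 2 * ∫ ω, inner ℝ (f ω) (orthoSystem p q v k) ^ 2 ∂ℙ := by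
      intro k
      refine (integral_inner_remainder_sq_le hE f k _).trans ?_
      refine mul_le_mul_of_nonneg_left ?_ (sq_nonneg _)
      rw [← candidate_eq]
      exact (hq.isLUB k).1 ⟨b, ⟨hb, fun j _ h => hex ⟨j, h.symm⟩⟩, rfl⟩
    refine squeeze_zero (fun k => integral_nonneg fun ω => sq_nonneg _) hle ?_
    simpa using (tendsto_integral_inner_orthonormal_sq hE hf).const_mul
      (‖boundaryKernel n p b‖ ^ 2)

/-! ### The change of basis between the orthonormal system and the multiple kernels -/

lemma IsMaximalSelection.kernelMatrix_eq_zero (N : ℕ) {i j : Fin N} (hij : i < j) :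
    kernelMatrix p q v N i j = 0 := by
  simp only [kernelMatrix, Matrix.of_apply, orthoSystem, InnerProductSpace.gramSchmidtNormed]
  rw [real_inner_comm, inner_smul_left, InnerProductSpace.gramSchmidt_inv_triangular ℝ
    (i := (i : ℕ)) (j := (j : ℕ)) _ hij, mul_zero]

lemma IsMaximalSelection.multipleKernel_eq_sum (hq : IsMaximalSelection p ℙ f q v) (N : ℕ)
    (i : Fin N) :
    multipleKernel p q v i = ∑ j : Fin N, kernelMatrix p q v N i j • orthoSystem p q v j := by
  have hE := hq.orthonormal
  have hmem : multipleKernel p q v i ∈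
      Submodule.span ℝ (Set.range fun j : Fin N => orthoSystem p q v j) := by
    have h1 : multipleKernel p q v i ∈ Submodule.span ℝ (orthoSystem p q v '' Set.Iic (i : ℕ)) := by
      rw [span_orthoSystem]
      exact Submodule.subset_span ⟨i, Set.mem_Iic.2 le_rfl, rfl⟩
    refine Submodule.span_mono ?_ h1
    rintro _ ⟨j, hj, rfl⟩
    exact ⟨⟨j, lt_of_le_of_lt hj i.2⟩, rfl⟩
  obtain ⟨c, hc⟩ := (Submodule.mem_span_range_iff_exists_fun ℝ).1 hmem
  have hEN : Orthonormal ℝ fun j : Fin N => orthoSystem p q v j := hE.comp _ Fin.val_injective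
  rw [← hc]
  refine Finset.sum_congr rfl fun j _ => ?_
  congr 1
  rw [kernelMatrix, Matrix.of_apply, ← hc, real_inner_comm, hEN.inner_right_fintype]

lemma IsMaximalSelection.isUnit_det_kernelMatrix (hq : IsMaximalSelection p ℙ f q v) (N : ℕ) :
    IsUnit (kernelMatrix p q v N).det := by
  rw [Matrix.det_of_isLowerTriangular _ fun i j hij =>
    IsMaximalSelection.kernelMatrix_eq_zero N (OrderDual.toDual_lt_toDual.1 hij)]
  refine isUnit_iff_ne_zero.2 (Finset.prod_ne_zero_iff.2 fun i _ h0 => ?_)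
  have hne := InnerProductSpace.gramSchmidt_ne_zero (𝕜 := ℝ) (i : ℕ) hq.linearIndependent
  simp only [kernelMatrix, Matrix.of_apply, orthoSystem, InnerProductSpace.gramSchmidtNormed] at h0
  rw [inner_smul_right, InnerProductSpace.gramSchmidt_def'' ℝ (multipleKernel p q v) i,
    inner_add_left, sum_inner, Finset.sum_eq_zero, add_zero] at h0
  · simp [hne] at h0
  · intro j hj
    rw [inner_smul_left, InnerProductSpace.gramSchmidt_orthogonal _ _ (Finset.mem_Iio.1 hj).ne,
      mul_zero]

/-- The lifted multiple kernel is the solution with boundary value the multiple kernel: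
differentiation in the pole commutes with the pairing in `L²(∂D)`. The derivative of the kernel is
square integrable, because otherwise `toL2` would send it to `0`, which is not a member of a
linearly independent family. -/
lemma IsMaximalSelection.liftedMultipleKernel_eq (hq : IsMaximalSelection p ℙ f q v) (k : ℕ)
    {x : Space n} (hx : x ∈ domain n p) :
    liftedMultipleKernel p q v k x = solution (multipleKernel p q v k) x := by
  have hne := hq.linearIndependent.ne_zero k
  unfold multipleKernel at hne ⊢
  set D : Space n → ℝ :=
    fun y => iteratedDeriv (order q k) (fun τ : ℝ => kernel n p (q k + τ • v k) y) 0 with hD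
  have hmem : MemLp D 2 (boundaryMeasure n p) := by
    by_contra h
    exact hne (by rw [toL2, dif_neg h])
  rw [toL2_eq_toLp hmem, liftedMultipleKernel]
  unfold reproducingKernel solution
  rw [iteratedDeriv_integral_kernel (memLp_kernel hx) (hq.mem_domain k) (hq.norm_direction k)]
  refine integral_congr_ae ?_
  filter_upwards [hmem.coeFn_toLp] with y hy
  rw [hy]

lemma IsMaximalSelection.sum_solution_eq (hq : IsMaximalSelection p ℙ f q v) (N : ℕ)
    (g : BoundaryL2 n p) {x : Space n} (hx : x ∈ domain n p) :
    ∑ k ∈ Finset.range N, inner ℝ g (orthoSystem p q v k) * solution (orthoSystem p q v k) x =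
      ∑ k : Fin N, kernelCoeffs p q v N g k * liftedMultipleKernel p q v k x := by
  have hlift : (fun k : Fin N => liftedMultipleKernel p q v k x) =
      (kernelMatrix p q v N).mulVec fun j : Fin N => solution (orthoSystem p q v j) x := by
    funext i
    rw [hq.liftedMultipleKernel_eq i hx, hq.multipleKernel_eq_sum N i, solution_sum_smul hx]
    rfl
  change _ = kernelCoeffs p q v N g ⬝ᵥ (fun k : Fin N => liftedMultipleKernel p q v k x)
  rw [hlift, Matrix.dotProduct_mulVec, kernelCoeffs, Matrix.vecMul_vecMul,
    Matrix.nonsing_inv_mul _ (hq.isUnit_det_kernelMatrix N), Matrix.vecMul_one,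
    Finset.sum_range fun k => inner ℝ g (orthoSystem p q v k) * solution (orthoSystem p q v k) x]
  rfl

/-! ### The stochastic Hardy space -/

lemma stochasticHardyNorm_congr {u w : Ω → Space n → ℝ}
    (h : ∀ ω, ∀ x ∈ domain n p, u ω x = w ω x) :
    stochasticHardyNorm n p ℙ u = stochasticHardyNorm n p ℙ w := by
  unfold stochasticHardyNorm
  simp only [fun ω => hardyNorm_congr (h ω)]

/-- The solution operator is bounded from `L²(Ω, L²(∂D))` to `L²(Ω, H²)`. -/
lemma exists_stochasticHardyNorm_solution_le (p : Problem) : ∃ C : ℝ≥0,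
    ∀ g : Ω → BoundaryL2 n p,
      stochasticHardyNorm n p ℙ (fun ω => solution (g ω)) ≤ C * eLpNorm g 2 ℙ := by
  obtain ⟨C, hC⟩ := exists_hardyNorm_solution_le n p
  refine ⟨C, fun g => ?_⟩
  rw [eLpNorm_eq_lintegral_rpow_enorm_toReal (by norm_num) (by norm_num), stochasticHardyNorm]
  calc (∫⁻ ω, hardyNorm n p (solution (g ω)) ^ 2 ∂ℙ) ^ (1 / 2 : ℝ)
      ≤ (∫⁻ ω, (C : ℝ≥0∞) ^ 2 * ‖g ω‖ₑ ^ 2 ∂ℙ) ^ (1 / 2 : ℝ) := by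
        gcongr with ω
        rw [← mul_pow]
        gcongr
        exact hC _
    _ = _ := by
        rw [lintegral_const_mul' _ _ (by finiteness), ENNReal.mul_rpow_of_nonneg _ _ (by norm_num)]
        congr 1
        · rw [← ENNReal.rpow_natCast, ← ENNReal.rpow_mul]
          norm_num
        · simp

lemma memStochasticHardy_solution {g : Ω → BoundaryL2 n p} (hg : MemLp g 2 ℙ) :
    MemStochasticHardy n p ℙ (fun ω => solution (g ω)) where
  aemeasurable x hx := by
    simp only [← inner_boundaryKernel hx]
    exact (hg.1.inner aestronglyMeasurable_const).aemeasurable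
  memHardy := by
    obtain ⟨C, hC⟩ := exists_hardyNorm_solution_le n p
    exact Eventually.of_forall fun ω => ⟨isSolutionIn_solution _,
      (hC _).trans_lt (ENNReal.mul_lt_top ENNReal.coe_lt_top enorm_lt_top)⟩
  norm_lt_top := by
    obtain ⟨C, hC⟩ := exists_stochasticHardyNorm_solution_le (ℙ := ℙ) p
    exact (hC g).trans_lt (ENNReal.mul_lt_top ENNReal.coe_lt_top hg.2)

lemma MemStochasticHardy.congr {u w : Ω → Space n → ℝ} (hu : MemStochasticHardy n p ℙ u)
    (h : ∀ ω, ∀ x ∈ domain n p, w ω x = u ω x) : MemStochasticHardy n p ℙ w where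
  aemeasurable x hx := by
    simpa only [fun ω => h ω x hx] using hu.aemeasurable x hx
  memHardy := hu.memHardy.mono fun ω hω => ⟨hω.1.congr (h ω), by
    rw [hardyNorm_congr (h ω)]
    exact hω.2⟩
  norm_lt_top := by
    rw [stochasticHardyNorm_congr h]
    exact hu.norm_lt_top

end SPOAFD

end

theorem theorem5 (n : ℕ) (hn : 1 ≤ n) (p : Problem)
    {Ω : Type*} [MeasurableSpace Ω] (ℙ : Measure Ω) [IsProbabilityMeasure ℙ]
    (f : Ω → BoundaryL2 n p) (hf : MemLp f 2 ℙ)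
    (q v : ℕ → Space n) (hq : IsMaximalSelection p ℙ f q v) :
    -- the expansion of the boundary data in `L²(Ω, L²(∂D))`
    Tendsto (fun N : ℕ => eLpNorm (fun ω => f ω - ∑ k ∈ Finset.range N,
        inner ℝ (f ω) (orthoSystem p q v k) • orthoSystem p q v k) 2 ℙ) atTop (𝓝 0) ∧
    -- the solution and the partial sums belong to the stochastic Hardy space
    MemStochasticHardy n p ℙ (fun ω => solution (f ω)) ∧
    (∀ N : ℕ, MemStochasticHardy n p ℙ (fun ω x => ∑ k ∈ Finset.range N,
        inner ℝ (f ω) (orthoSystem p q v k) * solution (orthoSystem p q v k) x)) ∧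
    -- the expansion of the solution
    Tendsto (fun N : ℕ => stochasticHardyNorm n p ℙ (fun ω x =>
        solution (f ω) x - ∑ k ∈ Finset.range N,
          inner ℝ (f ω) (orthoSystem p q v k) * solution (orthoSystem p q v k) x))
      atTop (𝓝 0) ∧
    -- the matrices `A_N` are lower triangular and invertible, and transform `E` into `K̃`
    (∀ N : ℕ, (∀ i j : Fin N, i < j → kernelMatrix p q v N i j = 0) ∧
      IsUnit (kernelMatrix p q v N).det ∧
      ∀ i : Fin N, multipleKernel p q v i =
        ∑ j : Fin N, kernelMatrix p q v N i j • orthoSystem p q v j) ∧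
    -- the partial sums in terms of the lifted multiple kernels
    (∀ (N : ℕ) (ω : Ω), ∀ x ∈ domain n p,
      ∑ k ∈ Finset.range N,
          inner ℝ (f ω) (orthoSystem p q v k) * solution (orthoSystem p q v k) x =
        ∑ k : Fin N, kernelCoeffs p q v N (f ω) k * liftedMultipleKernel p q v k x) ∧
    -- the expansion of the solution in the lifted multiple kernels
    Tendsto (fun N : ℕ => stochasticHardyNorm n p ℙ (fun ω x =>
        solution (f ω) x - ∑ k : Fin N,
          kernelCoeffs p q v N (f ω) k * liftedMultipleKernel p q v k x))
      atTop (𝓝 0) := by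
  have hlim := hq.tendsto_remainder hf
  have hrem : ∀ N ω, ∀ x ∈ domain n p, solution (f ω) x - ∑ k ∈ Finset.range N,
      inner ℝ (f ω) (orthoSystem p q v k) * solution (orthoSystem p q v k) x =
        solution (remainder (orthoSystem p q v) N (f ω)) x := fun N ω x hx => by
    rw [remainder, solution_sub hx, solution_sum_smul hx]
  have hexp : Tendsto (fun N : ℕ => stochasticHardyNorm n p ℙ (fun ω x =>
        solution (f ω) x - ∑ k ∈ Finset.range N,
          inner ℝ (f ω) (orthoSystem p q v k) * solution (orthoSystem p q v k) x))
      atTop (𝓝 0) := by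
    obtain ⟨C, hC⟩ := exists_stochasticHardyNorm_solution_le (ℙ := ℙ) p
    refine tendsto_of_tendsto_of_tendsto_of_le_of_le tendsto_const_nhds ?_ (fun _ => zero_le)
      fun N => (stochasticHardyNorm_congr (hrem N)).trans_le (hC _)
    simpa using ENNReal.Tendsto.const_mul hlim (Or.inr ENNReal.coe_ne_top)
  refine ⟨hlim, memStochasticHardy_solution hf, fun N => ?_, hexp,
    fun N => ⟨fun i j => IsMaximalSelection.kernelMatrix_eq_zero N, hq.isUnit_det_kernelMatrix N,
      hq.multipleKernel_eq_sum N⟩, fun N ω x hx => hq.sum_solution_eq N (f ω) hx, ?_⟩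
  · have hS : MemLp (fun ω => ∑ k ∈ Finset.range N,
        inner ℝ (f ω) (orthoSystem p q v k) • orthoSystem p q v k) 2 ℙ := by
      refine memLp_finsetSum _ fun k _ => ?_
      exact ((ContinuousLinearMap.toSpanSingleton ℝ (orthoSystem p q v k)).comp_memLp'
        (hf.inner_const (𝕜 := ℝ) (orthoSystem p q v k)))
    exact (memStochasticHardy_solution hS).congr fun ω x hx => (solution_sum_smul hx _ _ _).symm
  · refine hexp.congr fun N => stochasticHardyNorm_congr fun ω x hx => ?_
    rw [hq.sum_solution_eq N (f ω) hx]
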